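/- Let $k$ be an algebraically closed field of characteristic zero (for instance $k=\mathbb C$); all Hopf algebras are over $k$, and $\Delta(a)=a_{(1)}\otimes a_{(2)}$, $\varepsilon$, $S$ denote comultiplication, counit and antipode. For a $k$-algebra $A$, let ${\rm cd}(A)=\sup\{n : H^n(A,M)\neq 0 \text{ for some } A\text{-bimodule } M\}\in\mathbb N\cup\{\infty\}$, where $H^n(A,M)={\rm Ext}^n(A,M)$, computed in the category of $A$-bimodules, is Hochschild cohomology. For a Hopf algebra $A$, a (right-right) Yetter–Drinfeld module over $A$ is a right $A$-module and right $A$-comodule $V$ such that $(v\cdot a)_{(0)}\otimes(v\cdot a)_{(1)}=v_{(0)}\cdot a_{(2)}\otimes S(a_{(1)})v_{(1)}a_{(3)}$ for all $v\in V$, $a\in A$; with the $A$-linear $A$-colinear maps these form an abelian category $\mathcal{YD}_A^A$. Let ${\rm cd}_{\rm GS}(A)=\sup\{n : {\rm Ext}^n_{\mathcal{YD}_A^A}(k,V)\neq 0 \text{ for some } V\in\mathcal{YD}_A^A\}\in\mathbb N\cup\{\infty\}$, where $k$ is the trivial Yetter–Drinfeld module ($v\cdot a=\varepsilon(a)v$,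 $v\mapsto v\otimes 1$). $A$ is cosemisimple if its category of comodules is semisimple. Let $A$ be a Hopf algebra and $\Gamma$ a group. An invariant cocentral action of $\Gamma$ on $A$ is a pair $(p,\alpha)$ where $p:A\to k\Gamma$ is a surjective Hopf algebra map with $p(a_{(1)})\otimes a_{(2)}=p(a_{(2)})\otimes a_{(1)}$ for all $a\in A$, and $\alpha$ is an action of $\Gamma$ on $A$ by Hopf algebra automorphisms with $p\circ\alpha_g=p$ for all $g\in\Gamma$. Put $A_g=\{a\in A : p(a_{(1)})\otimes a_{(2)}=g\otimes a\}$. A Hopf algebra $B$ is a graded twisting of $A$ by $\Gamma$ if, for some such $(p,\alpha)$, it is isomorphic as a Hopf algebra to the Hopf subalgebra $A^{t,\alpha}=\sum_{g\in\Gamma}A_g\otimes g$ of the crossed product Hopf algebra $A\rtimes\Gamma$, i.e. $A\otimes k\Gamma$ with the tensor product coalgebra structure and the product $(a\otimes g)(b\otimes h)=a\,\alpha_g(b)\otimes gh$. Theorem. Let $A$ and $B$ be Hopf algebras over $k$, and assume that $B$ is a graded twisting of $A$ by a finite abelian group. Then ${\rm cd}(A)={\rm cd}(B)$. If moreover $A$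 is cosemisimple, then ${\rm cd}_{\rm GS}(A)={\rm cd}_{\rm GS}(B)$. -/

import Mathlib

open scoped TensorProduct
open CategoryTheory CategoryTheory.Limits

universe u v

/-! ### Comodules and cosemisimplicity -/

/-- `ρ : V → V ⊗ C` is a right coaction of the coalgebra `C` on the vector space `V`
(coassociativity and counitality). -/
structure IsRightCoaction (k : Type u) {C V : Type u} [Field k] [AddCommGroup C] [Module k C]
    [Coalgebra k C] [AddCommGroup V] [Module k V] (ρ : V →ₗ[k] V ⊗[k] C) : Prop where
  coassoc : (TensorProduct.assoc k V C C).toLinearMap ∘ₗ ρ.rTensor C ∘ₗ ρ =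
    (Coalgebra.comul (R := k) (A := C)).lTensor V ∘ₗ ρ
  counit : (TensorProduct.rid k V).toLinearMap ∘ₗ
    (Coalgebra.counit (R := k) (A := C)).lTensor V ∘ₗ ρ = LinearMap.id

/-- `W ⊆ V` is a subcomodule for the coaction `ρ`: one has `ρ(W) ⊆ W ⊗ C`. -/
def IsSubcomodule {k C V : Type u} [Field k] [AddCommGroup C] [Module k C]
    [AddCommGroup V] [Module k V] (ρ : V →ₗ[k] V ⊗[k] C) (W : Submodule k V) : Prop :=
  ∀ w ∈ W, ρ w ∈ LinearMap.range (W.subtype.rTensor C)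

/-- The coalgebra `C` is cosemisimple: its category of right comodules is semisimple, i.e. every
subcomodule of a right `C`-comodule has a complementary subcomodule. -/
def IsCosemisimple (k C : Type u) [Field k] [AddCommGroup C] [Module k C] [Coalgebra k C] : Prop :=
  ∀ (V : Type u) [AddCommGroup V] [Module k V] (ρ : V →ₗ[k] V ⊗[k] C), IsRightCoaction k ρ →
    ∀ W : Submodule k V, IsSubcomodule ρ W →
      ∃ W' : Submodule k V, IsSubcomodule ρ W' ∧ IsCompl W W'

/-! ### Hochschild cohomology and the cohomological dimension -/

section Hochschild

variable (k A : Type u) [Field k] [Ring A] [Algebra k A]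

/-- The algebra `A` as an `A`-bimodule, i.e. as a left module over the enveloping algebra
`A ⊗ Aᵒᵖ`, with `(a ⊗ b) • x = a x b`. -/
noncomputable def regularBimodule : ModuleCat.{u} (A ⊗[k] Aᵐᵒᵖ) :=
  letI : Module (A ⊗[k] Aᵐᵒᵖ) A := TensorProduct.Algebra.module
  ModuleCat.of (A ⊗[k] Aᵐᵒᵖ) A

/-- Hochschild cohomology `Hⁿ(A, M)` of `A` with coefficients in the bimodule `M`, as
`Extⁿ(A, M)` in the category of `A`-bimodules. -/
abbrev HochschildCohomology (M : ModuleCat.{u} (A ⊗[k] Aᵐᵒᵖ)) (n : ℕ) : Type u :=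
  Abelian.Ext (regularBimodule k A) M n

/-- The Hochschild cohomological dimension
`cd(A) = sup {n | Hⁿ(A, M) ≠ 0 for some bimodule M} ∈ ℕ ∪ {∞}`. -/
noncomputable def cd : ℕ∞ :=
  ⨆ (n : ℕ) (_ : ∃ M : ModuleCat.{u} (A ⊗[k] Aᵐᵒᵖ), Nontrivial (HochschildCohomology k A M n)),
    (n : ℕ∞)

end Hochschild

/-! ### Yetter-Drinfeld modules -/

section YetterDrinfeld

variable {k A : Type u} [Field k] [Ring A] [HopfAlgebra k A]

/-- For a bilinear right action `v · a` on `V`, the linear map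
`(V ⊗ A) ⊗ (A ⊗ (A ⊗ A)) → V ⊗ A`, `(v ⊗ x) ⊗ (a ⊗ (b ⊗ c)) ↦ v · b ⊗ S(a) x c`
(see `ydTwist_tmul`). -/
noncomputable def ydTwist {V : Type u} [AddCommGroup V] [Module k V] (act : V →ₗ[k] A →ₗ[k] V) :
    (V ⊗[k] A) ⊗[k] (A ⊗[k] (A ⊗[k] A)) →ₗ[k] V ⊗[k] A :=
  TensorProduct.map (TensorProduct.lift act)
      (LinearMap.mul' k A ∘ₗ
        TensorProduct.map (HopfAlgebra.antipode k (A := A)) (LinearMap.mul' k A) ∘ₗ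
        (TensorProduct.leftComm k A A A).toLinearMap) ∘ₗ
    (TensorProduct.tensorTensorTensorComm k V A A (A ⊗[k] A)).toLinearMap ∘ₗ
    (TensorProduct.leftComm k A A A).toLinearMap.lTensor (V ⊗[k] A)

theorem ydTwist_tmul {V : Type u} [AddCommGroup V] [Module k V] (act : V →ₗ[k] A →ₗ[k] V)
    (v : V) (x a b c : A) :
    ydTwist act ((v ⊗ₜ[k] x) ⊗ₜ[k] (a ⊗ₜ[k] (b ⊗ₜ[k] c))) =
      act v b ⊗ₜ[k] (HopfAlgebra.antipode k a * x * c) := by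
  simp [ydTwist, mul_assoc]

/-- The iterated comultiplication `a ↦ a₍₁₎ ⊗ (a₍₂₎ ⊗ a₍₃₎)`. -/
noncomputable def comul₂ (k A : Type u) [Field k] [Ring A] [HopfAlgebra k A] :
    A →ₗ[k] A ⊗[k] (A ⊗[k] A) :=
  (Coalgebra.comul (R := k) (A := A)).lTensor A ∘ₗ Coalgebra.comul

/-- `act` and `coact` form a right-right Yetter-Drinfeld structure on `V` over `A`. -/
structure IsYetterDrinfeld {V : Type u} [AddCommGroup V] [Module k V]
    (act : V →ₗ[k] A →ₗ[k] V) (coact : V →ₗ[k] V ⊗[k] A) : Prop where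
  act_one : ∀ v, act v 1 = v
  act_mul : ∀ v a b, act v (a * b) = act (act v a) b
  coaction : IsRightCoaction k coact
  /-- `(v·a)₍₀₎ ⊗ (v·a)₍₁₎ = v₍₀₎·a₍₂₎ ⊗ S(a₍₁₎) v₍₁₎ a₍₃₎` -/
  compat : ∀ v a, coact (act v a) = ydTwist act (coact v ⊗ₜ[k] comul₂ k A a)

variable (k A) in
/-- A (right-right) Yetter-Drinfeld module over the Hopf algebra `A`. -/
structure YetterDrinfeld where
  carrier : Type u
  [addCommGroup : AddCommGroup carrier]
  [module : Module k carrier]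
  act : carrier →ₗ[k] A →ₗ[k] carrier
  coact : carrier →ₗ[k] carrier ⊗[k] A
  isYetterDrinfeld : IsYetterDrinfeld act coact

namespace YetterDrinfeld

attribute [instance] YetterDrinfeld.addCommGroup YetterDrinfeld.module

/-- A morphism of Yetter-Drinfeld modules: an `A`-linear and `A`-colinear map. -/
@[ext]
structure Hom (X Y : YetterDrinfeld k A) where
  lin : X.carrier →ₗ[k] Y.carrier
  map_act : ∀ x a, lin (X.act x a) = Y.act (lin x) a
  map_coact : ∀ x, Y.coact (lin x) = lin.rTensor A (X.coact x)

instance : Category (YetterDrinfeld k A) where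
  Hom X Y := Hom X Y
  id X := ⟨LinearMap.id, fun _ _ => rfl, fun _ => by simp⟩
  comp f g := ⟨g.lin ∘ₗ f.lin, fun x a => by simp [f.map_act, g.map_act],
    fun x => by simp [f.map_coact, g.map_coact, LinearMap.rTensor_comp]⟩

variable {X Y Z : YetterDrinfeld k A}

@[ext]
theorem hom_ext {f g : X ⟶ Y} (h : ∀ x, f.lin x = g.lin x) : f = g :=
  Hom.ext (LinearMap.ext h)

@[simp] theorem id_lin (X : YetterDrinfeld k A) : Hom.lin (𝟙 X) = LinearMap.id := rfl

@[simp] theorem comp_lin (f : X ⟶ Y) (g : Y ⟶ Z) : Hom.lin (f ≫ g) = g.lin ∘ₗ f.lin := rfl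

instance : Zero (X ⟶ Y) := ⟨⟨0, by simp, by simp⟩⟩
instance : Add (X ⟶ Y) :=
  ⟨fun f g => ⟨f.lin + g.lin, fun x a => by simp [f.map_act, g.map_act],
    fun x => by simp [f.map_coact, g.map_coact, LinearMap.rTensor_add]⟩⟩
instance : Neg (X ⟶ Y) :=
  ⟨fun f => ⟨-f.lin, fun x a => by simp [f.map_act],
    fun x => by simp [f.map_coact, LinearMap.rTensor_neg]⟩⟩

@[simp] theorem zero_lin : Hom.lin (0 : X ⟶ Y) = 0 := rfl
@[simp] theorem add_lin (f g : X ⟶ Y) : Hom.lin (f + g) = f.lin + g.lin := rfl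
@[simp] theorem neg_lin (f : X ⟶ Y) : Hom.lin (-f) = -f.lin := rfl

instance : AddCommGroup (X ⟶ Y) where
  add_assoc _ _ _ := by ext; simp [add_assoc]
  zero_add _ := by ext; simp
  add_zero _ := by ext; simp
  add_comm _ _ := by ext; simp [add_comm]
  neg_add_cancel _ := by ext; simp
  nsmul := nsmulRec
  zsmul := zsmulRec

instance : Preadditive (YetterDrinfeld k A) where

/-! The category of Yetter-Drinfeld modules is abelian. -/

theorem ydTwist_naturality {V W : Type u} [AddCommGroup V] [Module k V] [AddCommGroup W]
    [Module k W] {actV : V →ₗ[k] A →ₗ[k] V} {actW : W →ₗ[k] A →ₗ[k] W} (f : V →ₗ[k] W)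
    (hf : ∀ v a, f (actV v a) = actW (f v) a) (t : V ⊗[k] A) (s : A ⊗[k] (A ⊗[k] A)) :
    f.rTensor A (ydTwist actV (t ⊗ₜ[k] s)) = ydTwist actW (f.rTensor A t ⊗ₜ[k] s) := by
  have : f.rTensor A ∘ₗ ydTwist actV = ydTwist actW ∘ₗ (f.rTensor A).rTensor _ := by
    ext v x a b c
    simp [ydTwist_tmul, hf]
  exact LinearMap.congr_fun this (t ⊗ₜ[k] s)

/-- A Yetter-Drinfeld structure passes to a space embedded by an intertwining map. -/
theorem isYetterDrinfeld_of_injective {V : Type u} [AddCommGroup V] [Module k V]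
    (act : V →ₗ[k] A →ₗ[k] V) (coact : V →ₗ[k] V ⊗[k] A) (Y : YetterDrinfeld k A)
    (f : V →ₗ[k] Y.carrier) (hf : Function.Injective f)
    (h₁ : ∀ v a, f (act v a) = Y.act (f v) a)
    (h₂ : ∀ v, Y.coact (f v) = f.rTensor A (coact v)) : IsYetterDrinfeld act coact where
  act_one v := hf (by rw [h₁, Y.isYetterDrinfeld.act_one])
  act_mul v a b := hf (by simp only [h₁, Y.isYetterDrinfeld.act_mul])
  coaction :=
    { coassoc := by
        ext v
        apply Module.Flat.rTensor_preserves_injective_linearMap (M := A ⊗[k] A) f hf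
        have h := LinearMap.congr_fun Y.isYetterDrinfeld.coaction.coassoc (f v)
        have e₂ : coact.rTensor A ∘ₗ LinearMap.id = coact.rTensor A := rfl
        have n₁ : f.rTensor (A ⊗[k] A) ∘ₗ (TensorProduct.assoc k V A A).toLinearMap ∘ₗ
            coact.rTensor A =
            (TensorProduct.assoc k Y.carrier A A).toLinearMap ∘ₗ Y.coact.rTensor A ∘ₗ
              f.rTensor A := by
          have e : Y.coact ∘ₗ f = f.rTensor A ∘ₗ coact := LinearMap.ext h₂
          rw [← LinearMap.rTensor_comp, e, LinearMap.rTensor_comp, ← LinearMap.comp_assoc,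
            ← LinearMap.comp_assoc]
          congr 1
          ext; simp
        have n₂ : f.rTensor (A ⊗[k] A) ∘ₗ (Coalgebra.comul (R := k) (A := A)).lTensor V =
            (Coalgebra.comul (R := k) (A := A)).lTensor Y.carrier ∘ₗ f.rTensor A := by
          ext; simp
        have m₁ := LinearMap.congr_fun n₁ (coact v)
        have m₂ := LinearMap.congr_fun n₂ (coact v)
        simp only [LinearMap.comp_apply] at m₁ m₂ h ⊢
        rw [m₁, m₂, ← h₂, h]
      counit := by
        ext v
        apply hf
        have h := LinearMap.congr_fun Y.isYetterDrinfeld.coaction.counit (f v)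
        have n : f ∘ₗ (TensorProduct.rid k V).toLinearMap ∘ₗ
            (Coalgebra.counit (R := k) (A := A)).lTensor V =
            (TensorProduct.rid k Y.carrier).toLinearMap ∘ₗ
            (Coalgebra.counit (R := k) (A := A)).lTensor Y.carrier ∘ₗ f.rTensor A := by
          ext; simp
        have m := LinearMap.congr_fun n (coact v)
        simp only [LinearMap.comp_apply] at m h ⊢
        rw [m, ← h₂, h]
        rfl }
  compat v a := by
    apply Module.Flat.rTensor_preserves_injective_linearMap (M := A) f hf
    rw [← h₂, h₁, Y.isYetterDrinfeld.compat, ydTwist_naturality f h₁, h₂]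

/-- A Yetter-Drinfeld structure passes to a space spanned by the images of intertwining maps. -/
theorem isYetterDrinfeld_of_iSup_range {V : Type u} [AddCommGroup V] [Module k V]
    (act : V →ₗ[k] A →ₗ[k] V) (coact : V →ₗ[k] V ⊗[k] A) {ι : Type} (X : ι → YetterDrinfeld k A)
    (f : ∀ i, (X i).carrier →ₗ[k] V) (hf : ⨆ i, LinearMap.range (f i) = ⊤)
    (h₁ : ∀ i v a, f i ((X i).act v a) = act (f i v) a)
    (h₂ : ∀ i v, coact (f i v) = (f i).rTensor A ((X i).coact v)) :
    IsYetterDrinfeld act coact := by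
  have key : ∀ {W : Type u} [AddCommGroup W] [Module k W] (g g' : V →ₗ[k] W),
      (∀ i x, g (f i x) = g' (f i x)) → g = g' := by
    intro W _ _ g g' h
    have : (⊤ : Submodule k V) ≤ LinearMap.eqLocus g g' := by
      rw [← hf, iSup_le_iff]
      rintro i _ ⟨x, rfl⟩
      exact h i x
    exact LinearMap.ext fun x => this (Submodule.mem_top (x := x))
  refine ⟨fun v => ?_, fun v a b => ?_, ⟨?_, ?_⟩, fun v a => ?_⟩
  · refine LinearMap.congr_fun (key (act.flip 1) LinearMap.id fun i x => ?_) v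
    simp [← h₁, (X i).isYetterDrinfeld.act_one]
  · refine LinearMap.congr_fun (key (act.flip (a * b)) (act.flip b ∘ₗ act.flip a) fun i x => ?_) v
    simp [← h₁, (X i).isYetterDrinfeld.act_mul]
  · refine key _ _ fun i x => ?_
    have h := LinearMap.congr_fun (X i).isYetterDrinfeld.coaction.coassoc x
    have n₁ : (f i).rTensor (A ⊗[k] A) ∘ₗ (TensorProduct.assoc k (X i).carrier A A).toLinearMap ∘ₗ
        (X i).coact.rTensor A =
        (TensorProduct.assoc k V A A).toLinearMap ∘ₗ coact.rTensor A ∘ₗ (f i).rTensor A := by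
      have e : coact ∘ₗ f i = (f i).rTensor A ∘ₗ (X i).coact := LinearMap.ext (h₂ i)
      rw [← LinearMap.rTensor_comp, e, LinearMap.rTensor_comp, ← LinearMap.comp_assoc,
        ← LinearMap.comp_assoc]
      congr 1
      ext; simp
    have n₂ : (f i).rTensor (A ⊗[k] A) ∘ₗ
        (Coalgebra.comul (R := k) (A := A)).lTensor (X i).carrier =
        (Coalgebra.comul (R := k) (A := A)).lTensor V ∘ₗ (f i).rTensor A := by
      ext; simp
    have m₁ := LinearMap.congr_fun n₁ ((X i).coact x)
    have m₂ := LinearMap.congr_fun n₂ ((X i).coact x)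
    simp only [LinearMap.comp_apply] at m₁ m₂ h ⊢
    rw [h₂, ← m₁, ← m₂, h]
  · refine key _ _ fun i x => ?_
    have h := LinearMap.congr_fun (X i).isYetterDrinfeld.coaction.counit x
    have n : f i ∘ₗ (TensorProduct.rid k (X i).carrier).toLinearMap ∘ₗ
        (Coalgebra.counit (R := k) (A := A)).lTensor (X i).carrier =
        (TensorProduct.rid k V).toLinearMap ∘ₗ
        (Coalgebra.counit (R := k) (A := A)).lTensor V ∘ₗ (f i).rTensor A := by
      ext; simp
    have m := LinearMap.congr_fun n ((X i).coact x)
    simp only [LinearMap.comp_apply] at m h ⊢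
    rw [h₂, ← m, h]
    rfl
  · refine LinearMap.congr_fun (key (coact ∘ₗ act.flip a)
      (ydTwist act ∘ₗ (TensorProduct.mk k _ _).flip (comul₂ k A a) ∘ₗ coact) fun i x => ?_) v
    simp only [LinearMap.comp_apply, LinearMap.flip_apply, TensorProduct.mk_apply]
    rw [← h₁, h₂, h₂, (X i).isYetterDrinfeld.compat, ydTwist_naturality (f i) (h₁ i)]

/-- A morphism whose image lies in that of an injective morphism factors through it. -/
noncomputable def liftInj (f : X ⟶ Y) (hf : Function.Injective f.lin) (g : Z ⟶ Y)
    (h : ∀ z, g.lin z ∈ LinearMap.range f.lin) : Z ⟶ X :=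
  let l : Z.carrier →ₗ[k] X.carrier :=
    (LinearEquiv.ofInjective f.lin hf).symm.toLinearMap ∘ₗ g.lin.codRestrict _ h
  have hl : ∀ z, f.lin (l z) = g.lin z := fun z =>
    congrArg Subtype.val ((LinearEquiv.ofInjective f.lin hf).apply_symm_apply ⟨g.lin z, h z⟩)
  ⟨l, fun z a => hf (by rw [hl, f.map_act, hl, g.map_act]), fun z => by
    apply Module.Flat.rTensor_preserves_injective_linearMap (M := A) f.lin hf
    rw [← f.map_coact, hl, g.map_coact, ← show f.lin ∘ₗ l = g.lin from LinearMap.ext hl,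
      LinearMap.rTensor_comp, LinearMap.comp_apply]⟩

theorem liftInj_comp (f : X ⟶ Y) (hf : Function.Injective f.lin) (g : Z ⟶ Y)
    (h : ∀ z, g.lin z ∈ LinearMap.range f.lin) : liftInj f hf g h ≫ f = g :=
  hom_ext fun z =>
    congrArg Subtype.val ((LinearEquiv.ofInjective f.lin hf).apply_symm_apply ⟨g.lin z, h z⟩)

/-- A morphism vanishing on the kernel of a surjective morphism factors through it. -/
noncomputable def descSurj (f : X ⟶ Y) (hf : Function.Surjective f.lin) (g : X ⟶ Z)
    (h : LinearMap.ker f.lin ≤ LinearMap.ker g.lin) : Y ⟶ Z :=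
  let l : Y.carrier →ₗ[k] Z.carrier :=
    (LinearMap.ker f.lin).liftQ g.lin h ∘ₗ (f.lin.quotKerEquivOfSurjective hf).symm.toLinearMap
  have hl : ∀ x, l (f.lin x) = g.lin x := fun x => by
    have : (f.lin.quotKerEquivOfSurjective hf).symm (f.lin x) = (LinearMap.ker f.lin).mkQ x := by
      rw [LinearEquiv.symm_apply_eq]; rfl
    change (LinearMap.ker f.lin).liftQ g.lin h ((f.lin.quotKerEquivOfSurjective hf).symm _) = _
    rw [this]; rfl
  ⟨l, fun y a => by
    obtain ⟨x, rfl⟩ := hf y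
    rw [← f.map_act, hl, hl, g.map_act], fun y => by
    obtain ⟨x, rfl⟩ := hf y
    rw [hl, g.map_coact, f.map_coact, ← show l ∘ₗ f.lin = g.lin from LinearMap.ext hl,
      LinearMap.rTensor_comp, LinearMap.comp_apply]⟩

theorem comp_descSurj (f : X ⟶ Y) (hf : Function.Surjective f.lin) (g : X ⟶ Z)
    (h : LinearMap.ker f.lin ≤ LinearMap.ker g.lin) : f ≫ descSurj f hf g h = g :=
  hom_ext fun x => by
    have : (f.lin.quotKerEquivOfSurjective hf).symm (f.lin x) = (LinearMap.ker f.lin).mkQ x := by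
      rw [LinearEquiv.symm_apply_eq]; rfl
    change (LinearMap.ker f.lin).liftQ g.lin h ((f.lin.quotKerEquivOfSurjective hf).symm _) = _
    rw [this]; rfl

theorem mono_of_injective (f : X ⟶ Y) (hf : Function.Injective f.lin) : Mono f :=
  ⟨fun _ _ e => hom_ext fun z => hf (LinearMap.congr_fun (congrArg Hom.lin e) z)⟩

theorem epi_of_surjective (f : X ⟶ Y) (hf : Function.Surjective f.lin) : Epi f :=
  ⟨fun g h e => hom_ext fun y => by
    obtain ⟨x, rfl⟩ := hf y
    exact LinearMap.congr_fun (congrArg Hom.lin e) x⟩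

section Kernel

variable (f : X ⟶ Y)

theorem ker_coact_mem (x : LinearMap.ker f.lin) :
    X.coact x ∈ LinearMap.range ((LinearMap.ker f.lin).subtype.rTensor A) := by
  have e := Module.Flat.rTensor_exact A (LinearMap.exact_subtype_ker_map f.lin)
  refine (e (X.coact x)).1 ?_
  rw [← f.map_coact, x.2, map_zero]

/-- The coaction on the kernel of a morphism. -/
noncomputable def kerCoact : LinearMap.ker f.lin →ₗ[k] LinearMap.ker f.lin ⊗[k] A :=
  (LinearEquiv.ofInjective _ (Module.Flat.rTensor_preserves_injective_linearMap (M := A)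
    (LinearMap.ker f.lin).subtype Subtype.val_injective)).symm.toLinearMap ∘ₗ
    (X.coact ∘ₗ (LinearMap.ker f.lin).subtype).codRestrict _ (ker_coact_mem f)

theorem kerCoact_spec (x : LinearMap.ker f.lin) :
    X.coact x = (LinearMap.ker f.lin).subtype.rTensor A (kerCoact f x) :=
  (congrArg Subtype.val (LinearEquiv.apply_symm_apply (LinearEquiv.ofInjective _
    (Module.Flat.rTensor_preserves_injective_linearMap (M := A)
    (LinearMap.ker f.lin).subtype Subtype.val_injective)) ⟨_, ker_coact_mem f x⟩)).symm

/-- The action on the kernel of a morphism. -/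
noncomputable def kerAct : LinearMap.ker f.lin →ₗ[k] A →ₗ[k] LinearMap.ker f.lin :=
  LinearMap.mk₂ k
    (fun x a => ⟨X.act x a, by rw [LinearMap.mem_ker, f.map_act, x.2]; simp⟩)
    (fun _ _ _ => Subtype.ext (by simp)) (fun _ _ _ => Subtype.ext (by simp))
    (fun _ _ _ => Subtype.ext (by simp)) (fun _ _ _ => Subtype.ext (by simp))

/-- The kernel of a morphism of Yetter-Drinfeld modules. -/
noncomputable def kerObj : YetterDrinfeld k A where
  carrier := LinearMap.ker f.lin
  act := kerAct f
  coact := kerCoact f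
  isYetterDrinfeld := isYetterDrinfeld_of_injective _ _ X (LinearMap.ker f.lin).subtype
    Subtype.val_injective (fun _ _ => rfl) (kerCoact_spec f)

/-- The inclusion of the kernel. -/
noncomputable def kerι : kerObj f ⟶ X :=
  ⟨(LinearMap.ker f.lin).subtype, fun _ _ => rfl, kerCoact_spec f⟩

theorem kerι_injective : Function.Injective (kerι f).lin := Subtype.val_injective

theorem kerι_comp : kerι f ≫ f = 0 := hom_ext fun x => x.2

/-- An injective morphism is the kernel of any morphism whose kernel is its image. -/
noncomputable def isLimitOfInjective (i : Z ⟶ X) (hi : Function.Injective i.lin) (w : i ≫ f = 0)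
    (h : LinearMap.ker f.lin ≤ LinearMap.range i.lin) : IsLimit (KernelFork.ofι i w) :=
  haveI := mono_of_injective i hi
  KernelFork.IsLimit.ofι i w
    (fun g hg => liftInj i hi g fun z => h (LinearMap.congr_fun (congrArg Hom.lin hg) z))
    (fun g hg => liftInj_comp _ _ _ _)
    (fun g hg m hm => by rw [← cancel_mono i, hm, liftInj_comp])

instance : HasKernels (YetterDrinfeld k A) :=
  ⟨fun f => ⟨⟨⟨_, isLimitOfInjective f (kerι f) (kerι_injective f) (kerι_comp f) fun x hx =>
    ⟨⟨x, hx⟩, rfl⟩⟩⟩⟩⟩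

end Kernel

section Cokernel

variable (f : X ⟶ Y)

/-- The coaction on the cokernel of a morphism. -/
noncomputable def cokerCoact :
    (Y.carrier ⧸ LinearMap.range f.lin) →ₗ[k] (Y.carrier ⧸ LinearMap.range f.lin) ⊗[k] A :=
  (LinearMap.range f.lin).liftQ ((LinearMap.range f.lin).mkQ.rTensor A ∘ₗ Y.coact) (by
    rintro _ ⟨x, rfl⟩
    rw [LinearMap.mem_ker, LinearMap.comp_apply, f.map_coact, ← LinearMap.comp_apply,
      ← LinearMap.rTensor_comp, LinearMap.range_mkQ_comp]
    simp)

/-- The action on the cokernel of a morphism. -/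
noncomputable def cokerAct : (Y.carrier ⧸ LinearMap.range f.lin) →ₗ[k] A →ₗ[k]
    (Y.carrier ⧸ LinearMap.range f.lin) :=
  (LinearMap.range f.lin).liftQ (Y.act.compr₂ (LinearMap.range f.lin).mkQ) (by
    rintro _ ⟨x, rfl⟩
    rw [LinearMap.mem_ker]
    ext a
    simp [← f.map_act])

/-- The cokernel of a morphism of Yetter-Drinfeld modules. -/
noncomputable def cokerObj : YetterDrinfeld k A where
  carrier := Y.carrier ⧸ LinearMap.range f.lin
  act := cokerAct f
  coact := cokerCoact f
  isYetterDrinfeld := isYetterDrinfeld_of_iSup_range _ _ (fun _ : Unit => Y)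
    (fun _ => (LinearMap.range f.lin).mkQ) (by simp) (fun _ _ _ => rfl) (fun _ _ => rfl)

/-- The projection onto the cokernel. -/
noncomputable def cokerπ : Y ⟶ cokerObj f :=
  ⟨(LinearMap.range f.lin).mkQ, fun _ _ => rfl, fun _ => rfl⟩

theorem cokerπ_surjective : Function.Surjective (cokerπ f).lin :=
  (LinearMap.range f.lin).mkQ_surjective

theorem ker_cokerπ : LinearMap.ker (cokerπ f).lin = LinearMap.range f.lin :=
  Submodule.ker_mkQ _

theorem comp_cokerπ : f ≫ cokerπ f = 0 :=
  hom_ext fun x => LinearMap.congr_fun (LinearMap.range_mkQ_comp f.lin) x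

/-- A surjective morphism is the cokernel of any morphism whose image is its kernel. -/
noncomputable def isColimitOfSurjective (q : Y ⟶ Z) (hq : Function.Surjective q.lin)
    (w : f ≫ q = 0) (h : LinearMap.ker q.lin ≤ LinearMap.range f.lin) :
    IsColimit (CokernelCofork.ofπ q w) :=
  haveI := epi_of_surjective q hq
  CokernelCofork.IsColimit.ofπ q w
    (fun g hg => descSurj q hq g fun y hy => by
      obtain ⟨x, rfl⟩ := h hy
      exact LinearMap.congr_fun (congrArg Hom.lin hg) x)
    (fun g hg => comp_descSurj _ _ _ _)
    (fun g hg m hm => by rw [← cancel_epi q, hm, comp_descSurj])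

instance : HasCokernels (YetterDrinfeld k A) :=
  ⟨fun f => ⟨⟨⟨_, isColimitOfSurjective f (cokerπ f) (cokerπ_surjective f) (comp_cokerπ f)
    (ker_cokerπ f).le⟩⟩⟩⟩

end Cokernel

theorem injective_of_mono (f : X ⟶ Y) [Mono f] : Function.Injective f.lin := by
  rw [← LinearMap.ker_eq_bot, eq_bot_iff]
  intro x hx
  have h : kerι f = 0 := by rw [← cancel_mono f, kerι_comp, zero_comp]
  exact LinearMap.congr_fun (congrArg Hom.lin h) (⟨x, hx⟩ : LinearMap.ker f.lin)

theorem surjective_of_epi (f : X ⟶ Y) [Epi f] : Function.Surjective f.lin := by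
  rw [← LinearMap.range_eq_top, eq_top_iff]
  intro y _
  have h : cokerπ f = 0 := by rw [← cancel_epi f, comp_cokerπ, comp_zero]
  rw [← ker_cokerπ f, h]
  rfl

instance : IsNormalMonoCategory (YetterDrinfeld k A) where
  normalMonoOfMono f _ := ⟨⟨_, cokerπ f, comp_cokerπ f,
    isLimitOfInjective _ f (injective_of_mono f) _ (ker_cokerπ f).le⟩⟩

instance : IsNormalEpiCategory (YetterDrinfeld k A) where
  normalEpiOfEpi f _ := ⟨⟨_, kerι f, kerι_comp f,
    isColimitOfSurjective _ f (surjective_of_epi f) _ fun x hx => ⟨⟨x, hx⟩, rfl⟩⟩⟩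

variable (k A) in
/-- The zero Yetter-Drinfeld module. -/
def zeroObj : YetterDrinfeld k A where
  carrier := PUnit
  act := 0
  coact := 0
  isYetterDrinfeld := isYetterDrinfeld_of_iSup_range _ _ (fun i : Empty => i.elim)
    (fun i => i.elim) (Subsingleton.elim _ _) (fun i => i.elim) (fun i => i.elim)

instance : HasZeroObject (YetterDrinfeld k A) :=
  ⟨zeroObj k A, (IsZero.iff_id_eq_zero _).2 (hom_ext fun _ => rfl)⟩

variable (X Y) in
/-- The action on the direct sum. -/
def sumAct : X.carrier × Y.carrier →ₗ[k] A →ₗ[k] X.carrier × Y.carrier :=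
  (X.act.compr₂ (LinearMap.inl k _ _)).coprod (Y.act.compr₂ (LinearMap.inr k _ _))

variable (X Y) in
/-- The coaction on the direct sum. -/
noncomputable def sumCoact : X.carrier × Y.carrier →ₗ[k] (X.carrier × Y.carrier) ⊗[k] A :=
  ((LinearMap.inl k _ _).rTensor A ∘ₗ X.coact).coprod ((LinearMap.inr k _ _).rTensor A ∘ₗ Y.coact)

theorem fst_sumAct (x : X.carrier × Y.carrier) (a : A) :
    LinearMap.fst k _ _ (sumAct X Y x a) = X.act (LinearMap.fst k _ _ x) a := by
  simp [sumAct]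

theorem snd_sumAct (x : X.carrier × Y.carrier) (a : A) :
    LinearMap.snd k _ _ (sumAct X Y x a) = Y.act (LinearMap.snd k _ _ x) a := by
  simp [sumAct]

theorem inl_sumAct (x : X.carrier) (a : A) :
    LinearMap.inl k X.carrier Y.carrier (X.act x a) = sumAct X Y (LinearMap.inl k _ _ x) a := by
  simp [sumAct]

theorem inr_sumAct (y : Y.carrier) (a : A) :
    LinearMap.inr k X.carrier Y.carrier (Y.act y a) = sumAct X Y (LinearMap.inr k _ _ y) a := by
  simp [sumAct]

theorem inl_sumCoact (x : X.carrier) : sumCoact X Y (LinearMap.inl k _ _ x) =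
    (LinearMap.inl k X.carrier Y.carrier).rTensor A (X.coact x) := by
  simp [sumCoact]

theorem inr_sumCoact (y : Y.carrier) : sumCoact X Y (LinearMap.inr k _ _ y) =
    (LinearMap.inr k X.carrier Y.carrier).rTensor A (Y.coact y) := by
  simp [sumCoact]

theorem fst_sumCoact (x : X.carrier × Y.carrier) : X.coact (LinearMap.fst k _ _ x) =
    (LinearMap.fst k X.carrier Y.carrier).rTensor A (sumCoact X Y x) := by
  simp only [sumCoact, LinearMap.coprod_apply, LinearMap.comp_apply, map_add]
  simp only [← LinearMap.rTensor_comp_apply, LinearMap.fst_comp_inl, LinearMap.fst_comp_inr]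
  simp

theorem snd_sumCoact (x : X.carrier × Y.carrier) : Y.coact (LinearMap.snd k _ _ x) =
    (LinearMap.snd k X.carrier Y.carrier).rTensor A (sumCoact X Y x) := by
  simp only [sumCoact, LinearMap.coprod_apply, LinearMap.comp_apply, map_add]
  simp only [← LinearMap.rTensor_comp_apply, LinearMap.snd_comp_inl, LinearMap.snd_comp_inr]
  simp

variable (X Y) in
/-- The direct sum of two Yetter-Drinfeld modules. -/
noncomputable def sumObj : YetterDrinfeld k A where
  carrier := X.carrier × Y.carrier
  act := sumAct X Y
  coact := sumCoact X Y
  isYetterDrinfeld := isYetterDrinfeld_of_iSup_range _ _ (fun b => cond b X Y)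
    (fun b => match b with
      | true => LinearMap.inl k X.carrier Y.carrier
      | false => LinearMap.inr k X.carrier Y.carrier)
    (by rw [iSup_bool_eq]; exact LinearMap.sup_range_inl_inr)
    (by rintro (_ | _) v a; exacts [inr_sumAct v a, inl_sumAct v a])
    (by rintro (_ | _) v; exacts [inr_sumCoact v, inl_sumCoact v])

variable (X Y) in
/-- The direct sum as a bicone. -/
noncomputable def sumBicone : BinaryBicone X Y where
  pt := sumObj X Y
  fst := ⟨LinearMap.fst k _ _, fst_sumAct, fst_sumCoact⟩
  snd := ⟨LinearMap.snd k _ _, snd_sumAct, snd_sumCoact⟩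
  inl := ⟨LinearMap.inl k _ _, inl_sumAct, inl_sumCoact⟩
  inr := ⟨LinearMap.inr k _ _, inr_sumAct, inr_sumCoact⟩
  inl_fst := rfl
  inl_snd := hom_ext fun _ => rfl
  inr_fst := hom_ext fun _ => rfl
  inr_snd := rfl

theorem sum_total (x : X.carrier × Y.carrier) :
    LinearMap.inl k X.carrier Y.carrier (LinearMap.fst k _ _ x) +
      LinearMap.inr k X.carrier Y.carrier (LinearMap.snd k _ _ x) = x := by
  simp

instance : HasBinaryBiproducts (YetterDrinfeld k A) :=
  ⟨fun X Y => hasBinaryBiproduct_of_total (sumBicone X Y)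
    (hom_ext fun x => sum_total (X := X) (Y := Y) x)⟩

noncomputable instance : Abelian (YetterDrinfeld k A) where
  has_finite_products := by
    have : HasTerminal (YetterDrinfeld k A) := HasZeroObject.hasTerminal
    exact hasFiniteProducts_of_has_binary_and_terminal

variable (k A) in
/-- The trivial Yetter-Drinfeld module `k`: `v · a = ε(a) v` and `v ↦ v ⊗ 1`. -/
noncomputable def trivial : YetterDrinfeld k A where
  carrier := k
  act := (LinearMap.mul k k).compl₂ Coalgebra.counit
  coact := (TensorProduct.mk k k A).flip 1
  isYetterDrinfeld :=
    { act_one := fun v => by simp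
      act_mul := fun v a b => by simp [mul_assoc]
      coaction :=
        { coassoc := by
            ext
            simp [Algebra.TensorProduct.one_def]
          counit := by ext; simp }
      compat := fun v a => by
        have e : ydTwist ((LinearMap.mul k k).compl₂ (Coalgebra.counit (R := k) (A := A))) ∘ₗ
            TensorProduct.mk k _ _ (v ⊗ₜ[k] (1 : A)) =
            TensorProduct.mk k k A v ∘ₗ LinearMap.mul' k A ∘ₗ
              TensorProduct.map (HopfAlgebra.antipode k (A := A))
                ((TensorProduct.lid k A).toLinearMap ∘ₗ
                  (Coalgebra.counit (R := k) (A := A)).rTensor A) := by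
          ext a b c
          simp [ydTwist_tmul, TensorProduct.smul_tmul', mul_comm]
        have h := LinearMap.congr_fun e (comul₂ k A a)
        simp only [LinearMap.comp_apply, TensorProduct.mk_apply] at h
        have e₂ : TensorProduct.map (HopfAlgebra.antipode k (A := A))
                ((TensorProduct.lid k A).toLinearMap ∘ₗ
                  (Coalgebra.counit (R := k) (A := A)).rTensor A) (comul₂ k A a) =
            (HopfAlgebra.antipode k (A := A)).rTensor A (Coalgebra.comul a) := by
          rw [comul₂, LinearMap.comp_apply, LinearMap.lTensor, ← LinearMap.comp_apply,
            ← TensorProduct.map_comp, LinearMap.comp_assoc, Coalgebra.rTensor_counit_comp_comul]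
          congr 2
          ext; simp
        simp only [LinearMap.flip_apply, TensorProduct.mk_apply]
        rw [h, e₂, HopfAlgebra.mul_antipode_rTensor_comul_apply, Algebra.algebraMap_eq_smul_one]
        simp [TensorProduct.smul_tmul', mul_comm] }

end YetterDrinfeld

end YetterDrinfeld

/-! ### Gerstenhaber-Schack cohomology and its dimension -/

section GerstenhaberSchack

variable (k A : Type u) [Field k] [Ring A] [HopfAlgebra k A]

instance : HasExt.{u + 1} (YetterDrinfeld k A) := HasExt.standard _

/-- Gerstenhaber-Schack cohomology `Hⁿ_GS(A, V) = Extⁿ(k, V)` in the category of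
Yetter-Drinfeld modules over `A`. -/
abbrev GSCohomology (V : YetterDrinfeld k A) (n : ℕ) : Type (u + 1) :=
  Abelian.Ext (YetterDrinfeld.trivial k A) V n

/-- The Gerstenhaber-Schack cohomological dimension
`cd_GS(A) = sup {n | Hⁿ_GS(A, V) ≠ 0 for some Yetter-Drinfeld module V} ∈ ℕ ∪ {∞}`. -/
noncomputable def cdGS : ℕ∞ :=
  ⨆ (n : ℕ) (_ : ∃ V : YetterDrinfeld k A, Nontrivial (GSCohomology k A V n)), (n : ℕ∞)

end GerstenhaberSchack

/-! ### Crossed products -/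

section CrossedProduct

variable {k A : Type u} {Γ : Type v} [Field k] [Ring A] [HopfAlgebra k A] [Group Γ]

variable (k A Γ) in
/-- An action of the group `Γ` on the Hopf algebra `A` by Hopf algebra automorphisms. -/
structure HopfAction where
  toFun : Γ → (A ≃ₐc[k] A)
  map_one : ∀ a, toFun 1 a = a
  map_mul : ∀ g h a, toFun (g * h) a = toFun g (toFun h a)

instance : CoeFun (HopfAction k A Γ) (fun _ => Γ → (A ≃ₐc[k] A)) := ⟨HopfAction.toFun⟩

/-- The underlying space `A ⊗ k[Γ]` of the crossed product `A ⋊ Γ`. -/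
def CrossedProduct (_α : HopfAction k A Γ) : Type (max u v) := A ⊗[k] MonoidAlgebra k Γ

namespace CrossedProduct

variable (α : HopfAction k A Γ)

noncomputable instance instAddCommGroup : AddCommGroup (CrossedProduct α) :=
  inferInstanceAs (AddCommGroup (A ⊗[k] MonoidAlgebra k Γ))

noncomputable instance : Module k (CrossedProduct α) :=
  inferInstanceAs (Module k (A ⊗[k] MonoidAlgebra k Γ))

/-- The coalgebra structure of `A ⋊ Γ` is that of the tensor product `A ⊗ k[Γ]`. -/
noncomputable instance : Coalgebra k (CrossedProduct α) :=
  inferInstanceAs (Coalgebra k (A ⊗[k] MonoidAlgebra k Γ))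

/-- The element `a ⊗ g` of `A ⋊ Γ`, as a linear map in `a`. -/
noncomputable def of (g : Γ) : A →ₗ[k] CrossedProduct α :=
  (TensorProduct.mk k A (MonoidAlgebra k Γ)).flip (MonoidAlgebra.single g 1)

variable {α}

theorem induction {P : CrossedProduct α → Prop} (hof : ∀ g a, P (of α g a))
    (hadd : ∀ x y, P x → P y → P (x + y)) (x : CrossedProduct α) : P x := by
  have h0 : P 0 := by simpa using hof 1 0
  refine TensorProduct.induction_on (motive := P) x h0 (fun a y => ?_) hadd
  induction y using MonoidAlgebra.induction_linear with
  | zero => rw [TensorProduct.tmul_zero]; exact h0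
  | add y z hy hz => rw [TensorProduct.tmul_add]; exact hadd _ _ hy hz
  | single g r =>
    have : a ⊗ₜ[k] MonoidAlgebra.single g r = of α g (r • a) := by
      change _ = (r • a) ⊗ₜ[k] MonoidAlgebra.single g 1
      rw [TensorProduct.smul_tmul, MonoidAlgebra.smul_single, smul_eq_mul, mul_one]
    rw [this]
    exact hof _ _

variable (α)

/-- Left multiplication by `a ⊗ 1`. -/
noncomputable def mulA : A →ₗ[k] Module.End k (CrossedProduct α) :=
  LinearMap.rTensorHom (MonoidAlgebra k Γ) ∘ₗ LinearMap.mul k A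

/-- Left multiplication by `1 ⊗ y`, with `(1 ⊗ g)(b ⊗ h) = α_g(b) ⊗ gh`. -/
noncomputable def mulΓ : MonoidAlgebra k Γ →ₗ[k] Module.End k (CrossedProduct α) :=
  (Finsupp.lift (Module.End k (CrossedProduct α)) k Γ fun g =>
    TensorProduct.map (α g : A →ₗ[k] A)
      (LinearMap.mulLeft k (MonoidAlgebra.single g (1 : k)))) ∘ₗ
    (MonoidAlgebra.coeffLinearEquiv k).toLinearMap

/-- The multiplication of the crossed product, `(a ⊗ g)(b ⊗ h) = a α_g(b) ⊗ gh`
(see `of_mul_of`). -/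
noncomputable def mulHom :
    CrossedProduct α →ₗ[k] CrossedProduct α →ₗ[k] CrossedProduct α :=
  TensorProduct.lift ((LinearMap.mul k (Module.End k (CrossedProduct α))).compl₁₂ (mulA α) (mulΓ α))

noncomputable instance : Mul (CrossedProduct α) := ⟨fun x y => mulHom α x y⟩

noncomputable instance : One (CrossedProduct α) := ⟨of α 1 1⟩

theorem one_def : (1 : CrossedProduct α) = of α 1 1 := rfl

theorem mul_def (x y : CrossedProduct α) : x * y = mulHom α x y := rfl

theorem of_mul_of (g h : Γ) (a b : A) : of α g a * of α h b = of α (g * h) (a * α g b) := by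
  change (mulA α a * mulΓ α (MonoidAlgebra.single g 1)) (b ⊗ₜ[k] MonoidAlgebra.single h 1) =
    (a * α g b) ⊗ₜ[k] MonoidAlgebra.single (g * h) 1
  have : mulΓ α (MonoidAlgebra.single g 1) = TensorProduct.map (α g : A →ₗ[k] A)
      (LinearMap.mulLeft k (MonoidAlgebra.single g (1 : k))) := by
    have aux : ∀ {N : Type (max u v)} [AddCommGroup N] [Module k N] (F : Γ → N),
        (Finsupp.lift N k Γ F ∘ₗ (MonoidAlgebra.coeffLinearEquiv k).toLinearMap)
          (MonoidAlgebra.single g 1) = F g := fun F => by simp [Finsupp.lift_apply]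
    exact aux _
  rw [this]
  change (LinearMap.mul k A a).rTensor (MonoidAlgebra k Γ) (TensorProduct.map (α g : A →ₗ[k] A)
      (LinearMap.mulLeft k (MonoidAlgebra.single g (1 : k))) (b ⊗ₜ[k] MonoidAlgebra.single h 1)) = _
  simp [MonoidAlgebra.single_mul_single]

noncomputable instance : Ring (CrossedProduct α) where
  __ := instAddCommGroup α
  left_distrib x y z := by simp only [mul_def, map_add]
  right_distrib x y z := by simp only [mul_def, map_add, LinearMap.add_apply]
  zero_mul x := by simp only [mul_def, map_zero, LinearMap.zero_apply]
  mul_zero x := by simp only [mul_def, map_zero]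
  mul_assoc x y z := by
    have ladd : ∀ x y z : CrossedProduct α, (x + y) * z = x * z + y * z := fun x y z => by
      simp only [mul_def, map_add, LinearMap.add_apply]
    have radd : ∀ x y z : CrossedProduct α, x * (y + z) = x * y + x * z := fun x y z => by
      simp only [mul_def, map_add]
    induction x using induction with
    | hadd x x' hx hx' => rw [ladd, ladd, ladd, hx, hx']
    | hof g a =>
      induction y using induction with
      | hadd y y' hy hy' => rw [radd, ladd, ladd, radd, hy, hy']
      | hof h b =>
        induction z using induction with
        | hadd z z' hz hz' => rw [radd, radd, radd, hz, hz']
        | hof l c => simp only [of_mul_of, _root_.map_mul, α.map_mul, mul_assoc]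
  one_mul x := by
    induction x using induction with
    | hadd x y hx hy => rw [mul_def, map_add, ← mul_def, ← mul_def, hx, hy]
    | hof g a => rw [one_def, of_mul_of, one_mul, one_mul, α.map_one]
  mul_one x := by
    induction x using induction with
    | hadd x y hx hy => rw [mul_def, map_add, LinearMap.add_apply, ← mul_def, ← mul_def, hx, hy]
    | hof g a => rw [one_def, of_mul_of, _root_.map_one, mul_one, mul_one]

noncomputable instance : Algebra k (CrossedProduct α) :=
  Algebra.ofModule
    (fun r x y => by simp only [mul_def, map_smul, LinearMap.smul_apply])
    (fun r x y => by simp only [mul_def, map_smul])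

theorem comul_of (g : Γ) (a : A) :
    Coalgebra.comul (R := k) (of α g a) =
      TensorProduct.map (of α g) (of α g) (Coalgebra.comul (R := k) a) := by
  have h : Coalgebra.comul (R := k) (a ⊗ₜ[k] (MonoidAlgebra.single g (1 : k))) =
      TensorProduct.map ((TensorProduct.mk k A (MonoidAlgebra k Γ)).flip (MonoidAlgebra.single g 1))
        ((TensorProduct.mk k A (MonoidAlgebra k Γ)).flip (MonoidAlgebra.single g 1))
        (Coalgebra.comul (R := k) a) := by
    rw [TensorProduct.comul_tmul]
    induction (Coalgebra.comul (R := k) a) using TensorProduct.induction_on with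
    | zero => simp
    | tmul b c => simp
    | add x y hx hy => rw [TensorProduct.add_tmul, map_add, hx, hy, map_add]
  exact h

theorem counit_of (g : Γ) (a : A) :
    Coalgebra.counit (R := k) (of α g a) = Coalgebra.counit (R := k) a := by
  have h : Coalgebra.counit (R := k) (a ⊗ₜ[k] (MonoidAlgebra.single g (1 : k))) =
      Coalgebra.counit (R := k) a := by
    simp
  exact h

noncomputable instance : Bialgebra k (CrossedProduct α) :=
  Bialgebra.mk' k (CrossedProduct α)
    (by rw [one_def, counit_of, Bialgebra.counit_one])
    (fun {x y} => by
      induction x using induction with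
      | hadd x x' hx hx' => rw [add_mul, map_add, map_add, add_mul, hx, hx']
      | hof g a =>
        induction y using induction with
        | hadd y y' hy hy' => rw [mul_add, map_add, map_add, mul_add, hy, hy']
        | hof h b => simp [of_mul_of, counit_of])
    (by
      rw [one_def, comul_of, Bialgebra.comul_one]
      rfl)
    (fun {x y} => by
      induction x using induction with
      | hadd x x' hx hx' => rw [add_mul, map_add, map_add, add_mul, hx, hx']
      | hof g a =>
        induction y using induction with
        | hadd y y' hy hy' => rw [mul_add, map_add, map_add, mul_add, hy, hy']
        | hof h b =>
          rw [of_mul_of, comul_of, comul_of, comul_of, Bialgebra.comul_mul,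
            ← CoalgHomClass.map_comp_comul_apply]
          induction (Coalgebra.comul (R := k) a) using TensorProduct.induction_on with
          | zero => simp
          | add x y hx hy => simp only [add_mul, map_add, hx, hy]
          | tmul a₁ a₂ =>
            induction (Coalgebra.comul (R := k) b) using TensorProduct.induction_on with
            | zero => simp
            | add x y hx hy => simp only [mul_add, map_add, hx, hy]
            | tmul b₁ b₂ => simp [of_mul_of])

/-- The antipode of the crossed product, `S(a ⊗ g) = α_{g⁻¹}(S(a)) ⊗ g⁻¹`. -/
noncomputable def antipodeHom : CrossedProduct α →ₗ[k] CrossedProduct α :=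
  TensorProduct.lift (LinearMap.flip
    ((Finsupp.lift (A →ₗ[k] CrossedProduct α) k Γ fun g =>
      of α g⁻¹ ∘ₗ (α g⁻¹ : A →ₗ[k] A) ∘ₗ HopfAlgebra.antipode k (A := A)) ∘ₗ
      (MonoidAlgebra.coeffLinearEquiv k).toLinearMap))

theorem antipodeHom_of (g : Γ) (a : A) :
    antipodeHom α (of α g a) = of α g⁻¹ (α g⁻¹ (HopfAlgebra.antipode k a)) := by
  change TensorProduct.lift _ (a ⊗ₜ[k] MonoidAlgebra.single g (1 : k)) = _
  simp [Finsupp.lift_apply]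

/-- The crossed product Hopf algebra `A ⋊ Γ`. -/
noncomputable instance : HopfAlgebra k (CrossedProduct α) where
  antipode := antipodeHom α
  mul_antipode_rTensor_comul := by
    refine LinearMap.ext fun x => ?_
    simp only [LinearMap.comp_apply]
    induction x using induction with
    | hadd x y hx hy => simp only [map_add, hx, hy]
    | hof g a =>
      have e : LinearMap.mul' k (CrossedProduct α) ∘ₗ (antipodeHom α).rTensor _ ∘ₗ
          TensorProduct.map (of α g) (of α g) = of α 1 ∘ₗ (α g⁻¹ : A →ₗ[k] A) ∘ₗ
          LinearMap.mul' k A ∘ₗ (HopfAlgebra.antipode k (A := A)).rTensor A := by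
        ext a b
        simp [antipodeHom_of, of_mul_of]
      have h := LinearMap.congr_fun e (Coalgebra.comul (R := k) a)
      simp only [LinearMap.comp_apply] at h
      rw [comul_of, counit_of, h, HopfAlgebra.mul_antipode_rTensor_comul_apply]
      simp [Algebra.algebraMap_eq_smul_one, one_def]
  mul_antipode_lTensor_comul := by
    refine LinearMap.ext fun x => ?_
    simp only [LinearMap.comp_apply]
    induction x using induction with
    | hadd x y hx hy => simp only [map_add, hx, hy]
    | hof g a =>
      have e : LinearMap.mul' k (CrossedProduct α) ∘ₗ (antipodeHom α).lTensor _ ∘ₗ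
          TensorProduct.map (of α g) (of α g) = of α 1 ∘ₗ
          LinearMap.mul' k A ∘ₗ (HopfAlgebra.antipode k (A := A)).lTensor A := by
        ext a b
        simp [antipodeHom_of, of_mul_of, ← α.map_mul, α.map_one]
      have h := LinearMap.congr_fun e (Coalgebra.comul (R := k) a)
      simp only [LinearMap.comp_apply] at h
      rw [comul_of, counit_of, h, HopfAlgebra.mul_antipode_lTensor_comul_apply]
      simp [Algebra.algebraMap_eq_smul_one, one_def]

end CrossedProduct

end CrossedProduct

/-! ### Graded twistings -/

section GradedTwisting

variable (k A B : Type u) (Γ : Type v) [Field k] [Ring A] [HopfAlgebra k A]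
  [Ring B] [HopfAlgebra k B] [Group Γ]

/-- An invariant cocentral action `(p, α)` of the group `Γ` on the Hopf algebra `A`. -/
structure InvariantCocentralAction where
  /-- A Hopf algebra map `A → k[Γ]`. -/
  p : A →ₐc[k] MonoidAlgebra k Γ
  p_surjective : Function.Surjective p
  /-- `p(a₍₁₎) ⊗ a₍₂₎ = p(a₍₂₎) ⊗ a₍₁₎` -/
  p_cocentral : ∀ a : A, (p : A →ₗ[k] MonoidAlgebra k Γ).rTensor A (Coalgebra.comul a) =
    (p : A →ₗ[k] MonoidAlgebra k Γ).rTensor A (TensorProduct.comm k A A (Coalgebra.comul a))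
  /-- An action of `Γ` on `A` by Hopf algebra automorphisms. -/
  α : HopfAction k A Γ
  p_invariant : ∀ (g : Γ) (a : A), p (α g a) = p a

variable {k A Γ}

/-- The component `A_g = {a | p(a₍₁₎) ⊗ a₍₂₎ = g ⊗ a}` of the `Γ`-grading of `A` defined by `p`. -/
noncomputable def InvariantCocentralAction.component (c : InvariantCocentralAction k A Γ) (g : Γ) :
    Submodule k A :=
  LinearMap.eqLocus
    ((c.p : A →ₗ[k] MonoidAlgebra k Γ).rTensor A ∘ₗ Coalgebra.comul)
    (TensorProduct.mk k (MonoidAlgebra k Γ) A (MonoidAlgebra.single g 1))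

/-- The subspace `∑_g A_g ⊗ g` of `A ⋊ Γ`, which is the Hopf subalgebra `A^{t,α}`. -/
noncomputable def InvariantCocentralAction.twist (c : InvariantCocentralAction k A Γ) :
    Submodule k (CrossedProduct c.α) :=
  ⨆ g : Γ, (c.component g).map (CrossedProduct.of c.α g)

variable (k A Γ)

/-- `B` is a graded twisting of `A` by `Γ`: for some invariant cocentral action of `Γ` on `A`,
the Hopf algebra `B` is isomorphic to the Hopf subalgebra `∑_g A_g ⊗ g` of `A ⋊ Γ`, i.e. there is
an injective morphism of Hopf algebras `B → A ⋊ Γ` with image this subspace. -/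
def IsGradedTwisting : Prop :=
  ∃ (c : InvariantCocentralAction k A Γ) (j : B →ₐc[k] CrossedProduct c.α),
    Function.Injective j ∧ LinearMap.range (j : B →ₗ[k] CrossedProduct c.α) = c.twist

end GradedTwisting

/-!
# Cohomological dimensions of graded twistings

Let `B` be a graded twisting of `A` by the finite abelian group `Γ`, and `C = A ⋊ Γ`. The proof
compares both `A` and `B` with `C`. As a left `A`-module, `C` is free on the group-like elements
`u g = 1 ⊗ g`, which normalize `A`. The same holds with `B = ∑ A_g ⊗ g` in place of `A`: since
`A` is the direct sum of the `A_g`, one has `C = ⨁ B u_g`, and the `u g` normalize `B` because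
`Γ` is abelian and the action preserves the grading. Such a presentation of `C` is called a
`CrossedExtension` of `A` by `Γ` here, and it suffices to show that `A` and `C` have the same
dimensions whenever `C` is a crossed extension of `A` by a finite group
(`CrossedExtension.cd_eq` and `CrossedExtension.cdGS_eq`). Both dimensions are projective
dimensions, of the bimodule `A` and of the trivial Yetter-Drinfeld module
(`iSup_nontrivial_ext_congr`).

*Hochschild dimension.* The enveloping algebra of `C` is free over that of `A` on the elements
`u g ⊗ u h`, and projectivity of a `C`-bimodule can be tested over `A` by averaging over
`Γ × Γ`. Hence restriction from `C`-bimodules to `A`-bimodules preserves projective dimension.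
The restriction of `C` is the direct sum of the bimodules `A u_g`, each a twist of `A` by an
automorphism, and so has the same projective dimension as `A`.

*Gerstenhaber-Schack dimension.* The induction functor `V ↦ V ⊗_A C` from Yetter-Drinfeld modules
over `A` to those over `C` is left and right adjoint to the functor sending a Yetter-Drinfeld
module over `C` to its largest part whose coaction takes values in `A`
(`CrossedExtension.inducedRestrictAdj`, `CrossedExtension.restrictInducedAdj`). Both functors are
therefore exact and do not raise projective dimension
(`CategoryTheory.Adjunction.hasProjectiveDimensionLT_obj`). This last statement is proved without
enough projectives, by dimension shifting on extension classes. As the order of `Γ` is invertible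
in `k`, each of the two trivial modules is a retract of the image of the other.
-/

/-! ### Exact functors on extension groups -/

section ExtAdjunction

universe w w' w'' u' v' u'' v''

open CategoryTheory.Abelian

variable {C : Type u} [Category.{v} C] [Abelian C] {D : Type u'} [Category.{v'} D] [Abelian D]
  {E : Type u''} [Category.{v''} E] [Abelian E] [HasExt.{w} C] [HasExt.{w'} D] [HasExt.{w''} E]

open _root_.DerivedCategory in
/-- Classes of positive degree are effaceable: they vanish after pulling back along a suitable
epimorphism. In the derived category, write the class as a left fraction `s⁻¹ ≫ g` with `s : X' ⟶
X` a quasi-isomorphism from a complex concentrated in degrees `≤ 0`; then `X'⁰ ⟶ X` is the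
required epimorphism. -/
theorem Ext.exists_epi_comp_eq_zero {X Y : C} {n : ℕ} (e : Ext X Y (n + 1)) :
    ∃ (P : C) (p : P ⟶ X), Epi p ∧ (Ext.mk₀ p).comp e (zero_add _) = 0 := by
  let := HasDerivedCategory.standard C
  let t : ((DerivedCategory.singleFunctor C 0).obj Y)⟦((n + 1 : ℕ) : ℤ)⟧ ≅
      (DerivedCategory.singleFunctor C (-((n + 1 : ℕ) : ℤ))).obj Y :=
    ((DerivedCategory.singleFunctors C).shiftIso ((n + 1 : ℕ) : ℤ) (-((n + 1 : ℕ) : ℤ)) 0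
      (by simp)).app Y
  let f : Q.obj ((CochainComplex.singleFunctor C 0).obj X) ⟶
      Q.obj ((CochainComplex.singleFunctor C (-((n + 1 : ℕ) : ℤ))).obj Y) := e.hom ≫ t.hom
  obtain ⟨X', hX', s, hs, g, hf⟩ := right_fac_of_isStrictlyLE f 0
  have hd : ∀ i, X'.d 0 i = 0 := fun i => by
    by_cases hi : (0 : ℤ) < i
    · exact (CochainComplex.isZero_of_isStrictlyLE X' 0 i hi).eq_of_tgt _ _
    · refine X'.shape _ _ ?_
      simp only [ComplexShape.up_Rel]
      omega
  let j : (CochainComplex.singleFunctor C 0).obj (X'.X 0) ⟶ X' :=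
    HomologicalComplex.mkHomFromSingle (𝟙 _) (fun i _ => by simp [hd])
  let p : X'.X 0 ⟶ X := (CochainComplex.singleFunctor C 0).preimage (j ≫ s)
  have hp : (CochainComplex.singleFunctor C 0).map p = j ≫ s :=
    (CochainComplex.singleFunctor C 0).map_preimage _
  refine ⟨X'.X 0, p, ?_, ?_⟩
  · refine Preadditive.epi_of_cancel_zero _ fun {Z} h hh => ?_
    have h₁ : j ≫ (s ≫ (CochainComplex.singleFunctor C 0).map h) = 0 := by
      rw [← Category.assoc, ← hp, ← Functor.map_comp, hh, Functor.map_zero]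
    have h₂ : s ≫ (CochainComplex.singleFunctor C 0).map h = 0 := by
      apply HomologicalComplex.to_single_hom_ext
      have hj : j.f 0 = (HomologicalComplex.singleObjXSelf (ComplexShape.up ℤ) 0 (X'.X 0)).hom :=
        (HomologicalComplex.mkHomFromSingle_f _ _).trans (Category.comp_id _)
      have h₀ : j.f 0 ≫ (s ≫ (CochainComplex.singleFunctor C 0).map h).f 0 = 0 :=
        congrArg (fun φ => HomologicalComplex.Hom.f φ 0) h₁
      rw [hj] at h₀
      exact (cancel_epi (HomologicalComplex.singleObjXSelf (ComplexShape.up ℤ) 0 (X'.X 0)).hom).1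
        (h₀.trans comp_zero.symm)
    have h₃ : Q.map ((CochainComplex.singleFunctor C 0).map h) = 0 := by
      rw [← cancel_epi (Q.map s), ← Functor.map_comp, h₂, Functor.map_zero, comp_zero]
    exact (DerivedCategory.singleFunctor C 0).map_injective
      (h₃.trans ((DerivedCategory.singleFunctor C 0).map_zero _ _).symm)
  · apply Ext.ext
    rw [Ext.comp_hom, Ext.mk₀_hom, ShiftedHom.mk₀_comp, Ext.zero_hom,
      ← cancel_mono t.hom, zero_comp, Category.assoc]
    change Q.map ((CochainComplex.singleFunctor C 0).map p) ≫ f = 0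
    rw [hp, hf, Functor.map_comp, Category.assoc, IsIso.hom_inv_id_assoc, ← Functor.map_comp]
    have : j ≫ g = 0 := by
      apply HomologicalComplex.from_single_hom_ext
      exact (HomologicalComplex.isZero_single_obj_X _ _ _ _ (by omega)).eq_of_tgt _ _
    rw [this, Functor.map_zero]

/-- Every extension class is obtained from a morphism by successively composing with classes of
short exact sequences on the left. No projective or injective objects are needed. -/
theorem Ext.dimension_shifting_induction {X Y : C}
    {motive : ∀ {X : C} {n : ℕ}, Ext X Y n → Prop}
    (zero : ∀ {X : C} (f : X ⟶ Y), motive (Ext.mk₀ f))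
    (succ : ∀ {S : ShortComplex C} (hS : S.ShortExact) {n : ℕ} (e : Ext S.X₁ Y n),
      motive e → motive (hS.extClass.comp e (add_comm 1 n))) {n : ℕ} (e : Ext X Y n) :
    motive e := by
  induction n generalizing X with
  | zero =>
    obtain ⟨f, rfl⟩ := (Ext.mk₀_bijective X Y).2 e
    exact zero f
  | succ n hn =>
    obtain ⟨P, p, hp, he⟩ := Ext.exists_epi_comp_eq_zero e
    let S := ShortComplex.mk _ _ (kernel.condition p)
    have hS : S.ShortExact := { exact := ShortComplex.exact_kernel p }
    obtain ⟨e', rfl⟩ := Ext.contravariant_sequence_exact₃ hS Y e he (add_comm 1 n)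
    exact succ hS e' (hn e')

/-- A natural transformation between exact functors is compatible with their actions on extension
groups. -/
theorem Ext.mapExactFunctor_naturality {F G : C ⥤ D} [F.Additive] [PreservesFiniteLimits F]
    [PreservesFiniteColimits F] [G.Additive] [PreservesFiniteLimits G] [PreservesFiniteColimits G]
    (τ : F ⟶ G) {X Y : C} {n : ℕ} (e : Ext X Y n) :
    (e.mapExactFunctor F).comp (Ext.mk₀ (τ.app Y)) (add_zero n) =
      (Ext.mk₀ (τ.app X)).comp (e.mapExactFunctor G) (zero_add n) := by
  induction e using Ext.dimension_shifting_induction with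
  | zero f => simp [Ext.mapExactFunctor_mk₀]
  | @succ S hS n e' he' =>
    have hnat : (hS.map_of_exact F).extClass.comp (Ext.mk₀ (τ.app S.X₁)) (add_zero 1) =
        (Ext.mk₀ (τ.app S.X₃)).comp (hS.map_of_exact G).extClass (zero_add 1) :=
      ShortComplex.ShortExact.extClass_naturality (hS.map_of_exact F)
        (hS.map_of_exact G) (S.mapNatTrans τ)
    rw [Ext.mapExactFunctor_comp, Ext.mapExactFunctor_comp,
      Ext.comp_assoc_of_third_deg_zero, he', ← Ext.comp_assoc_of_second_deg_zero,
      Ext.mapExactFunctor_extClass, Ext.mapExactFunctor_extClass]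
    refine (congrArg (fun x => Ext.comp x (Ext.mapExactFunctor G e') (add_comm 1 n)) hnat).trans ?_
    exact Ext.comp_assoc _ _ _ _ _ (by omega)

theorem Ext.mapExactFunctor_id {X Y : C} {n : ℕ} (e : Ext X Y n) :
    e.mapExactFunctor (𝟭 C) = e := by
  induction e using Ext.dimension_shifting_induction with
  | zero f => simp [Ext.mapExactFunctor_mk₀]
  | succ hS e' he' =>
    rw [Ext.mapExactFunctor_comp, he', Ext.mapExactFunctor_extClass]
    rfl

theorem Ext.mapExactFunctor_mapExactFunctor (F : C ⥤ D) (G : D ⥤ E) [F.Additive]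
    [PreservesFiniteLimits F] [PreservesFiniteColimits F] [G.Additive] [PreservesFiniteLimits G]
    [PreservesFiniteColimits G] {X Y : C} {n : ℕ} (e : Ext X Y n) :
    (e.mapExactFunctor F).mapExactFunctor G = e.mapExactFunctor (F ⋙ G) := by
  induction e using Ext.dimension_shifting_induction with
  | zero f => simp [Ext.mapExactFunctor_mk₀]
  | succ hS e' he' =>
    rw [Ext.mapExactFunctor_comp, Ext.mapExactFunctor_comp, Ext.mapExactFunctor_comp, he',
      Ext.mapExactFunctor_extClass F, Ext.mapExactFunctor_extClass (F ⋙ G)]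
    exact congrArg (fun x => Ext.comp x (Ext.mapExactFunctor (F ⋙ G) e') (add_comm 1 _))
      (Ext.mapExactFunctor_extClass G (hS.map_of_exact F))

end ExtAdjunction

/-! ### Projective dimension -/

section ProjectiveDimension

universe w w' u' v'

variable {C : Type u} [Category.{v} C] [Abelian C] {D : Type u'} [Category.{v'} D] [Abelian D]

open CategoryTheory.Abelian in
/-- An exact left adjoint with exact right adjoint does not raise projective dimension: a class on
`F X` is recovered, through unit and counit, from its image under the right adjoint, which lives
on `X` after composition with the unit. -/
theorem CategoryTheory.Adjunction.hasProjectiveDimensionLT_obj {F : C ⥤ D} {G : D ⥤ C}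
    (adj : F ⊣ G) [F.Additive] [PreservesFiniteLimits F] [PreservesFiniteColimits F]
    [G.Additive] [PreservesFiniteLimits G] [PreservesFiniteColimits G] (X : C) (n : ℕ)
    [HasProjectiveDimensionLT X n] : HasProjectiveDimensionLT (F.obj X) n := by
  let := HasExt.standard C
  let := HasExt.standard D
  refine HasProjectiveDimensionLT.mk fun i hi Y e => ?_
  have h₀ : (Ext.mk₀ (adj.unit.app X)).comp
      ((e.mapExactFunctor G : Ext ((F ⋙ G).obj X) (G.obj Y) i)) (zero_add i) = 0 :=
    @Ext.eq_zero_of_hasProjectiveDimensionLT _ _ _ _ _ _ _ _ n ‹_› hi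
  have h₁ := congrArg (fun x => (Ext.mapExactFunctor F x).comp
    (Ext.mk₀ (adj.counit.app Y)) (add_zero i)) h₀
  simp only [Ext.mapExactFunctor_zero, Ext.zero_comp] at h₁
  rw [Ext.mapExactFunctor_comp, Ext.mapExactFunctor_mk₀] at h₁
  have h₂ : ((e.mapExactFunctor G).mapExactFunctor F).comp
      (Ext.mk₀ (adj.counit.app Y)) (add_zero i) =
      (Ext.mk₀ (adj.counit.app (F.obj X))).comp e (zero_add i) := by
    rw [Ext.mapExactFunctor_mapExactFunctor]
    refine (Ext.mapExactFunctor_naturality adj.counit e).trans ?_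
    rw [Ext.mapExactFunctor_id]
  have h₃ : (Ext.mk₀ (F.map (adj.unit.app X))).comp
      ((Ext.mk₀ (adj.counit.app (F.obj X))).comp e (zero_add i)) (zero_add i) = 0 := by
    rw [← h₂, ← h₁]
    exact (Ext.comp_assoc_of_third_deg_zero _ _ _ _).symm
  have h₄ := Ext.mk₀_comp_mk₀_assoc (F.map (adj.unit.app X)) (adj.counit.app (F.obj X)) e
  have h₅ : F.map (adj.unit.app X) ≫ adj.counit.app (F.obj X) = 𝟙 (F.obj X) :=
    adj.left_triangle_components X
  exact (Ext.mk₀_id_comp e).symm.trans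
    ((congrArg (fun f => (Ext.mk₀ f).comp e (zero_add i)) h₅.symm).trans (h₄.symm.trans h₃))

/-- An exact faithful functor that preserves and reflects projective objects preserves projective
dimension. -/
theorem hasProjectiveDimensionLT_map_iff (F : C ⥤ D) [F.Additive] [PreservesFiniteLimits F]
    [PreservesFiniteColimits F] [EnoughProjectives C] [F.PreservesProjectiveObjects]
    (hF : ∀ X, Projective (F.obj X) → Projective X) [F.Faithful] (X : C) (n : ℕ) :
    HasProjectiveDimensionLT (F.obj X) n ↔ HasProjectiveDimensionLT X n := by
  match n with
  | 0 =>
    rw [hasProjectiveDimensionLT_zero_iff_isZero, hasProjectiveDimensionLT_zero_iff_isZero,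
      IsZero.iff_id_eq_zero, IsZero.iff_id_eq_zero, ← F.map_id, F.map_eq_zero_iff]
  | 1 =>
    rw [← projective_iff_hasProjectiveDimensionLT_one,
      ← projective_iff_hasProjectiveDimensionLT_one]
    exact ⟨hF X, fun h => F.projective_obj X⟩
  | n + 2 =>
    let P : ProjectivePresentation X := Classical.arbitrary _
    let S := ShortComplex.mk _ _ (kernel.condition P.f)
    have hS : S.ShortExact := { exact := ShortComplex.exact_kernel P.f }
    have : Projective (S.map F).X₂ := F.projective_obj P.p
    exact ((hS.map_of_exact F).hasProjectiveDimensionLT_X₃_iff n this).trans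
      ((hasProjectiveDimensionLT_map_iff F hF _ _).trans
        (hS.hasProjectiveDimensionLT_X₃_iff n P.projective).symm)

open CategoryTheory.Abelian in
/-- The supremum defining the cohomological dimensions is the projective dimension of the object.
-/
theorem iSup_nontrivial_ext_le_iff [HasExt.{w} C] (X : C) (d : ℕ) :
    (⨆ (n : ℕ) (_ : ∃ Y : C, Nontrivial (Ext X Y n)), (n : ℕ∞)) ≤ d ↔
      HasProjectiveDimensionLT X (d + 1) := by
  rw [hasProjectiveDimensionLT_iff]
  simp only [iSup_le_iff, Nat.cast_le]
  constructor
  · intro h i hi Y e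
    by_contra he
    have := h i ⟨Y, ⟨e, 0, he⟩⟩
    omega
  · rintro h i ⟨Y, hY⟩
    by_contra hi
    obtain ⟨e, he⟩ := exists_ne (0 : Ext X Y i)
    exact he (h i (by omega) e)

open CategoryTheory.Abelian in
theorem iSup_nontrivial_ext_congr [HasExt.{w} C] [HasExt.{w'} D] {X : C} {X' : D}
    (h : ∀ n, HasProjectiveDimensionLT X n ↔ HasProjectiveDimensionLT X' n) :
    (⨆ (n : ℕ) (_ : ∃ Y : C, Nontrivial (Ext X Y n)), (n : ℕ∞)) =
      ⨆ (n : ℕ) (_ : ∃ Y : D, Nontrivial (Ext X' Y n)), (n : ℕ∞) :=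
  eq_of_forall_ge_iff fun d => by
    induction d using ENat.recTopCoe with
    | top => simp only [le_top]
    | coe d => rw [iSup_nontrivial_ext_le_iff, iSup_nontrivial_ext_le_iff, h]

open CategoryTheory.Abelian in
/-- An object whose identity is a finite sum of morphisms factoring through objects of projective
dimension `< n` has projective dimension `< n`. -/
theorem hasProjectiveDimensionLT_of_sum_eq_id {X : C} {ι : Type*} [Fintype ι] {Z : ι → C}
    (p : ∀ i, X ⟶ Z i) (j : ∀ i, Z i ⟶ X) (h : ∑ i, p i ≫ j i = 𝟙 X) (n : ℕ)
    (hZ : ∀ i, HasProjectiveDimensionLT (Z i) n) : HasProjectiveDimensionLT X n := by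
  let := HasExt.standard C
  refine HasProjectiveDimensionLT.mk fun i hi Y e => ?_
  rw [← Ext.mk₀_id_comp e, ← h, Ext.mk₀_sum, Ext.sum_comp]
  refine Finset.sum_eq_zero fun g _ => ?_
  rw [← Ext.mk₀_comp_mk₀_assoc,
    ((Ext.mk₀ (j g)).comp e (zero_add i)).eq_zero_of_hasProjectiveDimensionLT n hi, Ext.comp_zero]

end ProjectiveDimension

/-! ### Crossed extensions -/

section CrossedExtension

universe w

variable (k A : Type u) (C : Type w) (Γ : Type v) [Field k] [Ring A] [HopfAlgebra k A]
  [Ring C] [HopfAlgebra k C] [Group Γ] [Fintype Γ] [DecidableEq Γ]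

/-- A presentation of the Hopf algebra `C` as a crossed extension of `A` by the finite group `Γ`:
a morphism of Hopf algebras `A → C`, to be thought of as an inclusion, and group-like elements
`u g` normalizing `A`, such that `C` is free as a left `A`-module with basis `u`. Freeness is
expressed by the coordinate maps `proj g`. -/
structure CrossedExtension where
  /-- The inclusion of `A`. -/
  incl : A →ₐc[k] C
  /-- The group-like basis elements. -/
  u : Γ →* C
  comul_u : ∀ g, Coalgebra.comul (R := k) (u g) = u g ⊗ₜ[k] u g
  /-- The coordinate of an element of `C` at the basis element `u g`. -/
  proj : Γ → C →ₗ[k] A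
  proj_incl_mul : ∀ g h a, proj g (incl a * u h) = if g = h then a else 0
  sum_proj : ∀ c, ∑ g, incl (proj g c) * u g = c
  normal : ∀ g a, ∃ a', u g * incl a = incl a' * u g

namespace CrossedExtension

variable {k A C Γ} (E : CrossedExtension k A C Γ)

theorem proj_incl_mul_self (g : Γ) (a : A) : E.proj g (E.incl a * E.u g) = a := by
  simp [E.proj_incl_mul]

theorem incl_mul_injective (g : Γ) : Function.Injective fun a => E.incl a * E.u g :=
  Function.LeftInverse.injective (E.proj_incl_mul_self g)

theorem incl_injective : Function.Injective E.incl := fun _ _ h =>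
  E.incl_mul_injective 1 (congrArg (· * E.u 1) h)

@[simp] theorem u_mul_u_inv (g : Γ) : E.u g * E.u g⁻¹ = 1 := by simp [← map_mul]
@[simp] theorem u_inv_mul_u (g : Γ) : E.u g⁻¹ * E.u g = 1 := by simp [← map_mul]
@[simp] theorem u_mul_u_inv_mul (g : Γ) (c : C) : E.u g * (E.u g⁻¹ * c) = c := by
  simp [← mul_assoc]
@[simp] theorem u_inv_mul_u_mul (g : Γ) (c : C) : E.u g⁻¹ * (E.u g * c) = c := by
  simp [← mul_assoc]

theorem induction {P : C → Prop} (h : ∀ a g, P (E.incl a * E.u g))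
    (hadd : ∀ x y, P x → P y → P (x + y)) (c : C) : P c := by
  rw [← E.sum_proj c]
  exact Finset.sum_induction_nonempty _ P hadd Finset.univ_nonempty fun g _ => h _ _

/-- Conjugation by `u g`, as an endomorphism of `A`. -/
def θ (g : Γ) : A →ₗ[k] A := E.proj g ∘ₗ LinearMap.mulLeft k (E.u g) ∘ₗ (E.incl : A →ₗ[k] C)

theorem u_mul_incl (g : Γ) (a : A) : E.u g * E.incl a = E.incl (E.θ g a) * E.u g := by
  obtain ⟨a', h⟩ := E.normal g a
  have : E.θ g a = a' := by
    change E.proj g (E.u g * E.incl a) = a'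
    rw [h, E.proj_incl_mul_self]
  rw [this, h]

theorem incl_θ (g : Γ) (a : A) : E.incl (E.θ g a) = E.u g * E.incl a * E.u g⁻¹ := by
  rw [u_mul_incl, mul_assoc, u_mul_u_inv, mul_one]

theorem incl_θ_inv (g : Γ) (a : A) : E.incl (E.θ g⁻¹ a) = E.u g⁻¹ * E.incl a * E.u g := by
  rw [incl_θ, inv_inv]

theorem θ_mul (g : Γ) (a b : A) : E.θ g (a * b) = E.θ g a * E.θ g b := by
  apply E.incl_injective
  simp [incl_θ, mul_assoc]

theorem θ_one (g : Γ) : E.θ g 1 = 1 := by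
  apply E.incl_injective
  simp [incl_θ]

theorem θ_inv_θ (g : Γ) (a : A) : E.θ g⁻¹ (E.θ g a) = a := by
  apply E.incl_injective
  simp [incl_θ, mul_assoc]

theorem θ_θ_inv (g : Γ) (a : A) : E.θ g (E.θ g⁻¹ a) = a := by
  simpa using E.θ_inv_θ g⁻¹ a

/-- Conjugation by `u g`, as an automorphism of the algebra `A`. -/
def θEquiv (g : Γ) : A ≃ₐ[k] A :=
  AlgEquiv.ofLinearEquiv
    (LinearEquiv.ofLinearMap (E.θ g) (E.θ g⁻¹) (LinearMap.ext (E.θ_θ_inv g))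
      (LinearMap.ext (E.θ_inv_θ g))) (E.θ_one g) (E.θ_mul g)

end CrossedExtension

end CrossedExtension

/-! ### Projectivity along a crossed extension of rings -/

section FiniteExtension

variable {R T : Type u} [Ring R] [Ring T] (φ : R →+* T)

instance restrictScalars_preservesFiniteLimits :
    PreservesFiniteLimits (ModuleCat.restrictScalars.{u} φ) :=
  ⟨fun _ _ _ => ⟨inferInstance⟩⟩

/-- If `T` is projective over `R`, then coextension of scalars is exact, so its left adjoint,
restriction of scalars, preserves projective objects. -/
theorem restrictScalars_preservesProjectiveObjects
    [Module.Projective R ((ModuleCat.restrictScalars φ).obj (ModuleCat.of T T))] :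
    (ModuleCat.restrictScalars.{u} φ).PreservesProjectiveObjects := by
  have : (ModuleCat.coextendScalars.{u} φ).PreservesEpimorphisms := ⟨fun {M N} f hf => by
    rw [ModuleCat.epi_iff_surjective] at hf ⊢
    intro g
    obtain ⟨l, hl⟩ := Module.projective_lifting_property f.hom g hf
    exact ⟨l, hl⟩⟩
  exact Functor.preservesProjectiveObjects_of_adjunction_of_preservesEpimorphisms
    (ModuleCat.restrictCoextendScalarsAdj φ)

/-- Maschke averaging: suppose that `T` is spanned by the products `φ r * t g` with `t g`
normalizing the image of `R`, and that the order of `G` has a central inverse `c` in `T`. If a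
`T`-linear map has an `R`-linear section `s`, then `x ↦ c ∑ g, t g⁻¹ • s (t g • x)` is a
`T`-linear section. -/
theorem exists_linear_section_of_equivariant {G : Type*} [Group G] [Fintype G] (t : G →* T)
    (hspan : ∀ x, x ∈ AddSubmonoid.closure {x | ∃ r g, φ r * t g = x})
    (hnormal : ∀ g r, ∃ r', t g * φ r = φ r' * t g)
    (c : T) (hc : ∀ x, Commute c x) (hcard : c * (Fintype.card G : T) = 1)
    {X Y : Type*} [AddCommGroup X] [Module T X] [AddCommGroup Y] [Module T Y] (f : Y →ₗ[T] X)
    (s : X →+ Y) (hs : ∀ x, f (s x) = x) (hsφ : ∀ r x, s (φ r • x) = φ r • s x) :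
    ∃ s' : X →ₗ[T] Y, f ∘ₗ s' = LinearMap.id := by
  let S : X → Y := fun x => c • ∑ g, t g⁻¹ • s (t g • x)
  have hSadd : ∀ x y, S (x + y) = S x + S y := fun x y => by
    simp only [S, smul_add, map_add, Finset.sum_add_distrib]
  have hSmul : ∀ (a : T) x, S (a • x) = a • S x := fun a x => by
    induction hspan a using AddSubmonoid.closure_induction generalizing x with
    | zero => simp [S]
    | add a b _ _ ha hb => rw [add_smul, add_smul, hSadd, ha, hb]
    | mem a ha =>
      obtain ⟨r, h, rfl⟩ := ha
      have h₁ : ∀ x, S (φ r • x) = φ r • S x := fun x => by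
        simp only [S]
        rw [← mul_smul (φ r), ← (hc (φ r)).eq, mul_smul, Finset.smul_sum (r := φ r)]
        congr 1
        refine Finset.sum_congr rfl fun g _ => ?_
        obtain ⟨r', hr⟩ := hnormal g r
        have hr' : t g⁻¹ * φ r' = φ r * t g⁻¹ := by
          rw [← mul_one (φ r'), ← map_one t, ← mul_inv_cancel g, map_mul, ← mul_assoc, ← mul_assoc,
            mul_assoc (t g⁻¹), ← hr, ← mul_assoc, ← map_mul, inv_mul_cancel, map_one, one_mul]
        rw [← mul_smul, hr, mul_smul, hsφ, ← mul_smul, ← mul_smul, hr']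
      have h₂ : ∀ x, S (t h • x) = t h • S x := fun x => by
        simp only [S]
        rw [← mul_smul (t h), ← (hc (t h)).eq, mul_smul, Finset.smul_sum (r := t h)]
        congr 1
        refine Fintype.sum_equiv (Equiv.mulRight h) _ _ fun g => ?_
        rw [Equiv.coe_mulRight, ← mul_smul, ← mul_smul, ← map_mul, ← map_mul, mul_inv_rev,
          mul_inv_cancel_left]
      rw [mul_smul, h₁, h₂, mul_smul]
  refine ⟨⟨⟨S, hSadd⟩, hSmul⟩, LinearMap.ext fun x => ?_⟩
  change f (S x) = x
  simp only [S, map_smul, map_sum, hs, ← mul_smul, ← map_mul, inv_mul_cancel, map_one, one_smul,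
    Finset.sum_const, Finset.card_univ]
  rw [← Nat.cast_smul_eq_nsmul T, ← mul_smul, hcard, one_smul]

theorem projective_of_projective_restrictScalars {G : Type*} [Group G] [Fintype G] (t : G →* T)
    (hspan : ∀ x, x ∈ AddSubmonoid.closure {x | ∃ r g, φ r * t g = x})
    (hnormal : ∀ g r, ∃ r', t g * φ r = φ r' * t g)
    (c : T) (hc : ∀ x, Commute c x) (hcard : c * (Fintype.card G : T) = 1)
    (X : ModuleCat.{u} T) (hX : Projective ((ModuleCat.restrictScalars φ).obj X)) :
    Projective X := by
  rw [← IsProjective.iff_projective] at hX ⊢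
  refine Module.Projective.of_lifting_property'' fun f hf => ?_
  obtain ⟨s, hs⟩ := Module.projective_lifting_property
    ((ModuleCat.restrictScalars φ).map (ModuleCat.ofHom f)).hom LinearMap.id hf
  exact exists_linear_section_of_equivariant φ t hspan hnormal c hc hcard f s.toAddMonoidHom
    (LinearMap.congr_fun hs) s.map_smul

end FiniteExtension

/-! ### Hochschild dimension of a crossed extension -/

section HochschildDimension

variable {k A C : Type u} {Γ : Type v} [Field k] [Ring A] [HopfAlgebra k A]
  [Ring C] [HopfAlgebra k C] [Group Γ] [Fintype Γ] [DecidableEq Γ]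

theorem regularBimodule_smul (a : A) (b : Aᵐᵒᵖ) (x : A) :
    HSMul.hSMul (α := A ⊗[k] Aᵐᵒᵖ) (β := regularBimodule k A) (γ := regularBimodule k A)
      (a ⊗ₜ[k] b) x = a * x * b.unop :=
  (TensorProduct.Algebra.smul_def a b x).trans (by simp [mul_assoc])

/-- A morphism of bimodules, from an additive map compatible with pure tensors of the enveloping
algebra. -/
noncomputable def bimoduleHom {M N : ModuleCat.{u} (A ⊗[k] Aᵐᵒᵖ)} (f : M →+ N)
    (hf : ∀ (a b : A) (x : M), f ((a ⊗ₜ[k] MulOpposite.op b) • x) =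
      (a ⊗ₜ[k] MulOpposite.op b) • f x) : M ⟶ N :=
  ModuleCat.ofHom
    { f with
      map_smul' := fun r x => by
        change f (r • x) = r • f x
        induction r with
        | zero =>
          exact (congrArg f (zero_smul (A ⊗[k] Aᵐᵒᵖ) x)).trans
            ((map_zero f).trans (zero_smul (A ⊗[k] Aᵐᵒᵖ) (f x)).symm)
        | add r s hr hs => rw [add_smul, add_smul, map_add, hr, hs]
        | tmul a b => exact hf a b.unop x }

namespace CrossedExtension

variable (E : CrossedExtension k A C Γ)

/-- The inclusion of the enveloping algebra of `A` into that of `C`. -/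
noncomputable def enveloping : A ⊗[k] Aᵐᵒᵖ →ₐ[k] C ⊗[k] Cᵐᵒᵖ :=
  Algebra.TensorProduct.map (E.incl : A →ₐ[k] C) (AlgHom.op (E.incl : A →ₐ[k] C))

theorem enveloping_tmul (a b : A) : E.enveloping (a ⊗ₜ MulOpposite.op b) =
    E.incl a ⊗ₜ MulOpposite.op (E.incl b) := rfl

/-- The basis of the enveloping algebra of `C` over that of `A`, indexed by `Γ × Γ`. The inverse
in the second factor makes it multiplicative with values in the opposite algebra. -/
def envelopingU : Γ × Γ →* C ⊗[k] Cᵐᵒᵖ where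
  toFun g := E.u g.1 ⊗ₜ MulOpposite.op (E.u g.2⁻¹)
  map_one' := by simp [Algebra.TensorProduct.one_def]
  map_mul' g h := by simp [Algebra.TensorProduct.tmul_mul_tmul, ← MulOpposite.op_mul, ← map_mul]

theorem envelopingU_apply (g : Γ × Γ) :
    E.envelopingU g = E.u g.1 ⊗ₜ MulOpposite.op (E.u g.2⁻¹) := rfl

theorem enveloping_span (x : C ⊗[k] Cᵐᵒᵖ) :
    x ∈ AddSubmonoid.closure {x | ∃ r g, E.enveloping.toRingHom r * E.envelopingU g = x} := by
  induction x with
  | zero => exact zero_mem _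
  | add x y hx hy => exact add_mem hx hy
  | tmul c d =>
    induction c using E.induction with
    | hadd c c' hc hc' => rw [TensorProduct.add_tmul]; exact add_mem hc hc'
    | h a g =>
      obtain ⟨d, rfl⟩ := MulOpposite.op_surjective d
      induction d using E.induction with
      | hadd d d' hd hd' =>
        rw [MulOpposite.op_add, TensorProduct.tmul_add]; exact add_mem hd hd'
      | h b h =>
        refine AddSubmonoid.subset_closure ⟨a ⊗ₜ MulOpposite.op (E.θ h⁻¹ b), (g, h⁻¹), ?_⟩
        rw [AlgHom.toRingHom_eq_coe, RingHom.coe_coe, enveloping_tmul, envelopingU_apply,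
          Algebra.TensorProduct.tmul_mul_tmul, ← MulOpposite.op_mul, E.incl_θ_inv]
        simp [mul_assoc]

theorem enveloping_normal (g : Γ × Γ) (r : A ⊗[k] Aᵐᵒᵖ) : ∃ r', E.envelopingU g *
    E.enveloping.toRingHom r = E.enveloping.toRingHom r' * E.envelopingU g := by
  induction r with
  | zero => exact ⟨0, by simp⟩
  | add x y hx hy =>
    obtain ⟨x', hx⟩ := hx
    obtain ⟨y', hy⟩ := hy
    exact ⟨x' + y', by rw [map_add, mul_add, hx, hy, map_add, add_mul]⟩
  | tmul a b =>
    obtain ⟨b, rfl⟩ := MulOpposite.op_surjective b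
    refine ⟨E.θ g.1 a ⊗ₜ MulOpposite.op (E.θ g.2 b), ?_⟩
    simp only [AlgHom.toRingHom_eq_coe, RingHom.coe_coe, enveloping_tmul, envelopingU_apply,
      Algebra.TensorProduct.tmul_mul_tmul, ← MulOpposite.op_mul, E.incl_θ]
    simp [mul_assoc]

theorem proj_incl_mul' (g : Γ) (a : A) (c : C) : E.proj g (E.incl a * c) = a * E.proj g c := by
  induction c using E.induction with
  | hadd x y hx hy => rw [mul_add, map_add, map_add, mul_add, hx, hy]
  | h b h =>
    rw [← mul_assoc, ← map_mul, E.proj_incl_mul, E.proj_incl_mul]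
    split_ifs <;> simp

theorem proj_mul_incl (g : Γ) (c : C) (a : A) :
    E.proj g (c * E.incl a) = E.proj g c * E.θ g a := by
  induction c using E.induction with
  | hadd x y hx hy => rw [add_mul, map_add, map_add, add_mul, hx, hy]
  | h b h =>
    rw [mul_assoc, E.u_mul_incl, ← mul_assoc, ← map_mul, E.proj_incl_mul, E.proj_incl_mul]
    split_ifs with hgh
    · rw [hgh]
    · simp

/-- The coordinates of `C` as a free right `A`-module with basis `u`. -/
noncomputable def projRight (g : Γ) : C →ₗ[k] A := E.θ g⁻¹ ∘ₗ E.proj g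

theorem projRight_mul_incl (g : Γ) (c : C) (a : A) :
    E.projRight g (c * E.incl a) = E.projRight g c * a := by
  rw [projRight, LinearMap.comp_apply, LinearMap.comp_apply, E.proj_mul_incl, E.θ_mul, E.θ_inv_θ]

theorem sum_projRight (c : C) : ∑ g, E.u g * E.incl (E.projRight g c) = c := by
  conv_rhs => rw [← E.sum_proj c]
  refine Finset.sum_congr rfl fun g _ => ?_
  rw [projRight, LinearMap.comp_apply, E.u_mul_incl, E.θ_θ_inv]

/-- The coordinates of the enveloping algebra of `C` over that of `A` in the basis `envelopingU`.
-/
noncomputable def envelopingProj (g : Γ × Γ) : C ⊗[k] Cᵐᵒᵖ →ₗ[k] A ⊗[k] Aᵐᵒᵖ :=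
  TensorProduct.map (E.proj g.1) ((MulOpposite.opLinearEquiv k).toLinearMap ∘ₗ
    E.projRight g.2⁻¹ ∘ₗ (MulOpposite.opLinearEquiv k).symm.toLinearMap)

theorem envelopingProj_tmul (g : Γ × Γ) (c d : C) : E.envelopingProj g (c ⊗ₜ MulOpposite.op d) =
    E.proj g.1 c ⊗ₜ MulOpposite.op (E.projRight g.2⁻¹ d) := rfl

theorem envelopingProj_mul (g : Γ × Γ) (r : A ⊗[k] Aᵐᵒᵖ) (x : C ⊗[k] Cᵐᵒᵖ) :
    E.envelopingProj g (E.enveloping r * x) = r * E.envelopingProj g x := by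
  induction r with
  | zero => simp
  | add r s hr hs => rw [map_add, add_mul, map_add, hr, hs, add_mul]
  | tmul a b =>
    obtain ⟨b, rfl⟩ := MulOpposite.op_surjective b
    induction x with
    | zero => simp
    | add x y hx hy => rw [mul_add, map_add, hx, hy, map_add, mul_add]
    | tmul c d =>
      obtain ⟨d, rfl⟩ := MulOpposite.op_surjective d
      rw [enveloping_tmul, Algebra.TensorProduct.tmul_mul_tmul, ← MulOpposite.op_mul,
        envelopingProj_tmul, envelopingProj_tmul, Algebra.TensorProduct.tmul_mul_tmul,
        ← MulOpposite.op_mul, E.proj_incl_mul', E.projRight_mul_incl]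

theorem sum_envelopingProj (x : C ⊗[k] Cᵐᵒᵖ) :
    ∑ g, E.enveloping (E.envelopingProj g x) * E.envelopingU g = x := by
  induction x with
  | zero => simp
  | add x y hx hy =>
    simp only [map_add, add_mul, Finset.sum_add_distrib]
    rw [hx, hy]
  | tmul c d =>
    obtain ⟨d, rfl⟩ := MulOpposite.op_surjective d
    conv_rhs => rw [← E.sum_proj c, ← E.sum_projRight d]
    rw [← Equiv.sum_comp (Equiv.inv Γ) (fun g => E.u g * E.incl (E.projRight g d)),
      Finset.op_sum, TensorProduct.sum_tmul, Fintype.sum_prod_type]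
    refine Finset.sum_congr rfl fun g _ => ?_
    rw [TensorProduct.tmul_sum]
    refine Finset.sum_congr rfl fun h _ => ?_
    rw [envelopingProj_tmul, enveloping_tmul, envelopingU_apply,
      Algebra.TensorProduct.tmul_mul_tmul, ← MulOpposite.op_mul]
    rfl

theorem projective_enveloping : Module.Projective (A ⊗[k] Aᵐᵒᵖ)
    ((ModuleCat.restrictScalars E.enveloping.toRingHom).obj
      (ModuleCat.of (C ⊗[k] Cᵐᵒᵖ) (C ⊗[k] Cᵐᵒᵖ))) := by
  let M := (ModuleCat.restrictScalars E.enveloping.toRingHom).obj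
      (ModuleCat.of (C ⊗[k] Cᵐᵒᵖ) (C ⊗[k] Cᵐᵒᵖ))
  let i : M →ₗ[A ⊗[k] Aᵐᵒᵖ] (Γ × Γ →₀ A ⊗[k] Aᵐᵒᵖ) :=
    (Finsupp.linearEquivFunOnFinite _ _ _).symm.toLinearMap ∘ₗ LinearMap.pi fun g =>
      { toFun := E.envelopingProj g
        map_add' := (E.envelopingProj g).map_add
        map_smul' := E.envelopingProj_mul g }
  let s : (Γ × Γ →₀ A ⊗[k] Aᵐᵒᵖ) →ₗ[A ⊗[k] Aᵐᵒᵖ] M :=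
    Finsupp.linearCombination _ (fun g => (E.envelopingU g : M))
  refine Module.Projective.of_split i s (LinearMap.ext fun x => ?_)
  refine Eq.trans ?_ (E.sum_envelopingProj x)
  change s (i x) = _
  refine (Finsupp.linearCombination_eq_fintype_linearCombination_apply _ _ _).trans ?_
  rfl

/-- The automorphism of the enveloping algebra of `A` that twists the right factor by `θ g`. -/
noncomputable def twistEquiv (g : Γ) : A ⊗[k] Aᵐᵒᵖ ≃ₐ[k] A ⊗[k] Aᵐᵒᵖ :=
  Algebra.TensorProduct.congr AlgEquiv.refl (AlgEquiv.op (E.θEquiv g))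

/-- The bimodule `A` with right action twisted by `θ g`, that is `a • x • b = a x θ_g(b)`. -/
noncomputable def twistedBimodule (g : Γ) : ModuleCat.{u} (A ⊗[k] Aᵐᵒᵖ) :=
  (ModuleCat.restrictScalars (E.twistEquiv g).toRingEquiv.toRingHom).obj (regularBimodule k A)

theorem hasProjectiveDimensionLT_twistedBimodule_iff (g : Γ) (n : ℕ) :
    HasProjectiveDimensionLT (E.twistedBimodule g) n ↔
      HasProjectiveDimensionLT (regularBimodule k A) n := by
  let F := ModuleCat.restrictScalars.{u} (E.twistEquiv g).toRingEquiv.toRingHom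
  have : F.IsEquivalence := ModuleCat.restrictScalars_isEquivalence_of_ringEquiv _
  exact hasProjectiveDimensionLT_map_iff F
    (fun X hX => F.projective_of_map_projective hX) _ n

/-- The bimodule `C` over `A`. -/
noncomputable def restrictedBimodule : ModuleCat.{u} (A ⊗[k] Aᵐᵒᵖ) :=
  (ModuleCat.restrictScalars E.enveloping.toRingHom).obj (regularBimodule k C)

theorem twistedBimodule_smul (g : Γ) (a b x : A) :
    HSMul.hSMul (α := A ⊗[k] Aᵐᵒᵖ) (β := E.twistedBimodule g) (γ := E.twistedBimodule g)
      (a ⊗ₜ[k] MulOpposite.op b) x = a * x * E.θ g b :=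
  regularBimodule_smul a (MulOpposite.op (E.θ g b)) x

theorem restrictedBimodule_smul (a b : A) (x : C) :
    HSMul.hSMul (α := A ⊗[k] Aᵐᵒᵖ) (β := E.restrictedBimodule) (γ := E.restrictedBimodule)
      (a ⊗ₜ[k] MulOpposite.op b) x = E.incl a * x * E.incl b :=
  regularBimodule_smul (E.incl a) (MulOpposite.op (E.incl b)) x

/-- The inclusion of the summand `A u_g` of the `A`-bimodule `C`. -/
noncomputable def twistedBimoduleι (g : Γ) : E.twistedBimodule g ⟶ E.restrictedBimodule :=
  bimoduleHom
    ({ toFun := fun a => E.incl a * E.u g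
       map_zero' := by rw [map_zero, zero_mul]
       map_add' := fun a b => by rw [map_add, add_mul] } : A →+ C) fun a b (x : A) => by
    refine (congrArg (fun y : A => E.incl y * E.u g) (E.twistedBimodule_smul g a b x)).trans ?_
    refine Eq.trans ?_ (E.restrictedBimodule_smul a b (E.incl x * E.u g : C)).symm
    have (x : A) : E.incl (a * x * E.θ g b) * E.u g = E.incl a * (E.incl x * E.u g) * E.incl b := by
      rw [mul_assoc, mul_assoc, mul_assoc, E.u_mul_incl, map_mul, map_mul, mul_assoc, mul_assoc]
    exact this x

/-- The projection of the `A`-bimodule `C` onto its summand `A u_g`. -/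
noncomputable def twistedBimoduleπ (g : Γ) : E.restrictedBimodule ⟶ E.twistedBimodule g :=
  bimoduleHom (E.proj g : C →+ A) fun a b (x : C) => by
    refine (congrArg (E.proj g) (E.restrictedBimodule_smul a b x)).trans ?_
    refine Eq.trans ?_ (E.twistedBimodule_smul g a b (E.proj g x)).symm
    have (x : C) : E.proj g (E.incl a * x * E.incl b) = a * E.proj g x * E.θ g b := by
      rw [mul_assoc, E.proj_incl_mul', E.proj_mul_incl, mul_assoc]
    exact this x

theorem sum_twistedBimoduleπ_ι :
    ∑ g, E.twistedBimoduleπ g ≫ E.twistedBimoduleι g = 𝟙 E.restrictedBimodule := by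
  ext x
  rw [ModuleCat.hom_sum, LinearMap.sum_apply]
  exact E.sum_proj x

variable [CharZero k]

/-- The projective dimension of a `C`-bimodule does not change on restriction to `A`: the
enveloping algebra of `C` is free over that of `A`, and projectivity can be tested after
restriction by averaging over `Γ × Γ`. -/
theorem hasProjectiveDimensionLT_enveloping_iff (X : ModuleCat.{u} (C ⊗[k] Cᵐᵒᵖ)) (n : ℕ) :
    HasProjectiveDimensionLT ((ModuleCat.restrictScalars E.enveloping.toRingHom).obj X) n ↔
      HasProjectiveDimensionLT X n := by
  have := E.projective_enveloping
  have := restrictScalars_preservesProjectiveObjects E.enveloping.toRingHom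
  refine hasProjectiveDimensionLT_map_iff _ (fun X hX => ?_) X n
  refine projective_of_projective_restrictScalars E.enveloping.toRingHom E.envelopingU
    E.enveloping_span E.enveloping_normal
    (algebraMap k _ (Fintype.card (Γ × Γ) : k)⁻¹) (fun x => Algebra.commutes _ x) ?_ X hX
  rw [← map_natCast (algebraMap k (C ⊗[k] Cᵐᵒᵖ)), ← map_mul, inv_mul_cancel₀, map_one]
  exact Nat.cast_ne_zero.2 Fintype.card_ne_zero

/-- As an `A`-bimodule, `C` is the direct sum of the twists of `A` by the automorphisms `θ g`,
which all have the projective dimension of `A`. -/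
theorem cd_eq (E : CrossedExtension k A C Γ) : cd k A = cd k C := by
  refine iSup_nontrivial_ext_congr fun n => ?_
  rw [← E.hasProjectiveDimensionLT_enveloping_iff]
  constructor
  · intro h
    exact hasProjectiveDimensionLT_of_sum_eq_id E.twistedBimoduleπ E.twistedBimoduleι
      E.sum_twistedBimoduleπ_ι n fun g =>
        (E.hasProjectiveDimensionLT_twistedBimodule_iff g n).2 h
  · intro h
    rw [← E.hasProjectiveDimensionLT_twistedBimodule_iff 1]
    have : HasProjectiveDimensionLT E.restrictedBimodule n := h
    exact Retract.hasProjectiveDimensionLT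
      ⟨E.twistedBimoduleι 1, E.twistedBimoduleπ 1,
        ModuleCat.hom_ext (LinearMap.ext fun a => E.proj_incl_mul_self 1 a)⟩ n

end CrossedExtension

end HochschildDimension

/-! ### Coalgebra structure and antipode of a crossed extension -/

theorem BialgHom.map_antipode {k A C : Type*} [CommRing k] [Ring A] [HopfAlgebra k A] [Ring C]
    [HopfAlgebra k C] (f : A →ₐc[k] C) (a : A) :
    f (HopfAlgebra.antipode k a) = HopfAlgebra.antipode k (f a) := by
  have h : WithConv.toConv ((f : A →ₗ[k] C) ∘ₗ HopfAlgebra.antipode k) =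
      WithConv.toConv (HopfAlgebra.antipode k ∘ₗ (f : A →ₗ[k] C)) := by
    apply left_inv_eq_right_inv (a := WithConv.toConv (f : A →ₗ[k] C))
    · ext a
      rw [(Coalgebra.Repr.arbitrary k a).convMul_apply]
      simp only [LinearMap.comp_apply, LinearMap.coe_coe, ← map_mul, ← map_sum,
        HopfAlgebra.sum_antipode_mul_eq_algebraMap_counit, LinearMap.convOne_apply]
      exact AlgHomClass.commutes f _
    · ext a
      rw [(Coalgebra.Repr.arbitrary k a).convMul_apply]
      have := HopfAlgebra.sum_mul_antipode_eq_algebraMap_counit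
        ((Coalgebra.Repr.arbitrary k a).induced f)
      simpa using this
  exact LinearMap.congr_fun (congrArg WithConv.ofConv h) a

section CrossedExtension

variable {k A C : Type u} {Γ : Type v} [Field k] [Ring A] [HopfAlgebra k A]
  [Ring C] [HopfAlgebra k C] [Group Γ] [Fintype Γ] [DecidableEq Γ]

open Coalgebra TensorProduct

namespace CrossedExtension

variable (E : CrossedExtension k A C Γ)

/-- The inclusion of `A` as a linear map. -/
def inclₗ : A →ₗ[k] C := (E.incl : A →ₗ[k] C)

@[simp] theorem inclₗ_apply (a : A) : E.inclₗ a = E.incl a := rfl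

theorem inclₗ_injective : Function.Injective E.inclₗ := E.incl_injective

/-- The inclusion `a ↦ a u_g` of the summand of `C` at `g`. It is a morphism of coalgebras. -/
def ι (g : Γ) : A →ₗ[k] C := LinearMap.mulRight k (E.u g) ∘ₗ E.inclₗ

@[simp] theorem ι_apply (g : Γ) (a : A) : E.ι g a = E.incl a * E.u g := rfl

theorem ι_one : E.ι 1 = E.inclₗ := by ext; simp

theorem counit_u (g : Γ) : counit (R := k) (E.u g) = 1 := by
  have h := Coalgebra.rTensor_counit_comul (R := k) (E.u g)
  rw [E.comul_u, LinearMap.rTensor_tmul] at h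
  have h' := congrArg (TensorProduct.lid k C) h
  rw [TensorProduct.lid_tmul, TensorProduct.lid_tmul, one_smul] at h'
  have h'' := congrArg (counit (R := k)) (congrArg (· * E.u g⁻¹) h')
  simpa using h''

theorem antipode_u (g : Γ) : HopfAlgebra.antipode k (E.u g) = E.u g⁻¹ := by
  have h := HopfAlgebra.mul_antipode_rTensor_comul_apply (R := k) (E.u g)
  rw [E.comul_u, E.counit_u, map_one, LinearMap.rTensor_tmul, LinearMap.mul'_apply] at h
  have h' := congrArg (· * E.u g⁻¹) h
  simpa [mul_assoc] using h'

theorem comul_incl (a : A) : comul (R := k) (E.incl a) = map E.inclₗ E.inclₗ (comul (R := k) a) :=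
  (CoalgHomClass.map_comp_comul_apply E.incl a).symm

theorem counit_incl (a : A) : counit (R := k) (E.incl a) = counit (R := k) a :=
  CoalgHomClass.counit_comp_apply E.incl a

theorem comul_ι (g : Γ) (a : A) :
    comul (R := k) (E.ι g a) = map (E.ι g) (E.ι g) (comul (R := k) a) := by
  rw [ι_apply, Bialgebra.comul_mul, E.comul_u, comul_incl]
  induction comul (R := k) a with
  | zero => simp
  | add x y hx hy => simp only [map_add, add_mul, hx, hy]
  | tmul a b => simp

theorem comul₂_ι (g : Γ) (a : A) :
    comul₂ k C (E.ι g a) = map (E.ι g) (map (E.ι g) (E.ι g)) (comul₂ k A a) := by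
  rw [comul₂, comul₂, LinearMap.comp_apply, LinearMap.comp_apply, comul_ι]
  induction comul (R := k) a with
  | zero => simp
  | add x y hx hy => simp only [map_add, hx, hy]
  | tmul a b => simp only [TensorProduct.map_tmul, LinearMap.lTensor_tmul, comul_ι]

theorem comul₂_incl (a : A) :
    comul₂ k C (E.incl a) = map E.inclₗ (map E.inclₗ E.inclₗ) (comul₂ k A a) := by
  have := E.comul₂_ι 1 a
  rwa [ι_one] at this

theorem comul₂_u (g : Γ) : comul₂ k C (E.u g) = E.u g ⊗ₜ (E.u g ⊗ₜ E.u g) := by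
  simp [comul₂, E.comul_u]

theorem counit_θ (g : Γ) (a : A) : counit (R := k) (E.θ g a) = counit (R := k) a := by
  rw [← E.counit_incl, E.incl_θ, Bialgebra.counit_mul, Bialgebra.counit_mul, E.counit_u,
    E.counit_u, E.counit_incl, one_mul, mul_one]

theorem map_inclₗ_injective {V W : Type u} [AddCommGroup V] [Module k V] [AddCommGroup W]
    [Module k W] {f : V →ₗ[k] W} (hf : Function.Injective f) :
    Function.Injective (map f E.inclₗ) := by
  rw [← LinearMap.lTensor_comp_rTensor, LinearMap.coe_comp]
  exact (Module.Flat.lTensor_preserves_injective_linearMap _ E.inclₗ_injective).comp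
    (Module.Flat.rTensor_preserves_injective_linearMap _ hf)

theorem comul_θ (g : Γ) (a : A) :
    comul (R := k) (E.θ g a) = map (E.θ g) (E.θ g) (comul (R := k) a) := by
  apply E.map_inclₗ_injective E.inclₗ_injective
  rw [← E.comul_incl, E.incl_θ, Bialgebra.comul_mul, Bialgebra.comul_mul, E.comul_u,
    E.comul_u, E.comul_incl]
  induction comul (R := k) a with
  | zero => simp
  | add x y hx hy => simp only [map_add, add_mul, mul_add, hx, hy]
  | tmul a b => simp [E.incl_θ]

theorem comul₂_θ (g : Γ) (a : A) :
    comul₂ k A (E.θ g a) = map (E.θ g) (map (E.θ g) (E.θ g)) (comul₂ k A a) := by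
  rw [comul₂, LinearMap.comp_apply, LinearMap.comp_apply, comul_θ]
  induction comul (R := k) a with
  | zero => simp
  | add x y hx hy => simp only [map_add, hx, hy]
  | tmul a b => simp only [TensorProduct.map_tmul, LinearMap.lTensor_tmul, comul_θ]

theorem antipode_incl (a : A) :
    HopfAlgebra.antipode k (E.incl a) = E.incl (HopfAlgebra.antipode k a) :=
  (BialgHom.map_antipode E.incl a).symm

theorem antipode_ι (g : Γ) (a : A) :
    HopfAlgebra.antipode k (E.ι g a) = E.u g⁻¹ * E.incl (HopfAlgebra.antipode k a) := by
  rw [ι_apply, HopfAlgebra.antipode_mul_antidistrib, antipode_u, antipode_incl]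

theorem θ_group_mul (g h : Γ) (a : A) : E.θ (g * h) a = E.θ g (E.θ h a) := by
  apply E.incl_injective
  simp [incl_θ, mul_assoc]

theorem θ_group_one (a : A) : E.θ 1 a = a := by
  apply E.incl_injective
  simp [incl_θ]

theorem antipode_θ (g : Γ) (a : A) :
    HopfAlgebra.antipode k (E.θ g a) = E.θ g (HopfAlgebra.antipode k a) := by
  apply E.incl_injective
  rw [← E.antipode_incl, E.incl_θ, E.incl_θ, HopfAlgebra.antipode_mul_antidistrib,
    HopfAlgebra.antipode_mul_antidistrib, E.antipode_u, E.antipode_u, E.antipode_incl, inv_inv,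
    mul_assoc]

/-! ### The part of a Yetter-Drinfeld module supported on the subalgebra -/

/-- The linear form on `C` that is the counit on `A` and zero on `A u_g` for `g ≠ 1`. In the dual
algebra of `C` it is an idempotent, through which comodules split off their part supported on `A`.
-/
def e : C →ₗ[k] k := counit ∘ₗ E.proj 1

theorem e_ι (g : Γ) (a : A) : E.e (E.incl a * E.u g) = if g = 1 then counit (R := k) a else 0 := by
  rw [e, LinearMap.comp_apply, E.proj_incl_mul]
  split_ifs <;> simp_all

theorem e_incl_mul (a : A) (c : C) : E.e (E.incl a * c) = counit (R := k) a * E.e c := by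
  rw [e, LinearMap.comp_apply, E.proj_incl_mul', Bialgebra.counit_mul, LinearMap.comp_apply]

theorem e_mul_incl (a : A) (c : C) : E.e (c * E.incl a) = E.e c * counit (R := k) a := by
  rw [e, LinearMap.comp_apply, E.proj_mul_incl, Bialgebra.counit_mul, E.counit_θ,
    LinearMap.comp_apply]

theorem e_incl (a : A) : E.e (E.incl a) = counit (R := k) a := by
  have := E.e_ι 1 a
  simpa using this

theorem e_conj (g : Γ) (c : C) : E.e (E.u g⁻¹ * c * E.u g) = E.e c := by
  induction c using E.induction with
  | hadd x y hx hy => rw [mul_add, add_mul, map_add, map_add, hx, hy]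
  | h a h =>
    rw [← mul_assoc, E.u_mul_incl, mul_assoc, mul_assoc, ← map_mul, ← map_mul, E.e_ι, E.e_ι,
      E.counit_θ]
    congr 1
    simp [inv_mul_eq_one]

theorem e_antipode_mul (g : Γ) (a b : A) (c : C) :
    E.e (HopfAlgebra.antipode k (E.ι g a) * c * E.ι g b) =
      counit (R := k) a * E.e c * counit (R := k) b := by
  rw [antipode_ι, ι_apply, ← mul_assoc, mul_assoc (E.u g⁻¹), mul_assoc (E.u g⁻¹), e_conj, mul_assoc,
    e_incl_mul, e_mul_incl, HopfAlgebra.counit_antipode, mul_assoc]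

theorem lTensor_e_comul (c : C) :
    TensorProduct.rid k C (E.e.lTensor C (comul (R := k) c)) = E.incl (E.proj 1 c) := by
  induction c using E.induction with
  | hadd x y hx hy => simp only [map_add, hx, hy]
  | h a g =>
    have h (t : A ⊗[k] A) : TensorProduct.rid k C (E.e.lTensor C (map (E.ι g) (E.ι g) t)) =
        if g = 1 then E.incl (TensorProduct.rid k A (counit.lTensor A t)) else 0 := by
      induction t with
      | zero => simp
      | add x y hx hy => simp only [map_add, hx, hy]; split_ifs <;> simp
      | tmul a b => simp only [TensorProduct.map_tmul, LinearMap.lTensor_tmul, ι_apply, E.e_ι,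
          TensorProduct.rid_tmul]; split_ifs with hg <;> simp [hg]
    rw [← ι_apply, comul_ι, h, Coalgebra.lTensor_counit_comul, TensorProduct.rid_tmul, one_smul,
      ι_apply, E.proj_incl_mul]
    simp only [eq_comm (a := g)]
    split_ifs <;> simp

theorem rTensor_e_comul (c : C) :
    TensorProduct.lid k C (E.e.rTensor C (comul (R := k) c)) = E.incl (E.proj 1 c) := by
  induction c using E.induction with
  | hadd x y hx hy => simp only [map_add, hx, hy]
  | h a g =>
    have h (t : A ⊗[k] A) : TensorProduct.lid k C (E.e.rTensor C (map (E.ι g) (E.ι g) t)) =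
        if g = 1 then E.incl (TensorProduct.lid k A (counit.rTensor A t)) else 0 := by
      induction t with
      | zero => simp
      | add x y hx hy => simp only [map_add, hx, hy]; split_ifs <;> simp
      | tmul a b => simp only [TensorProduct.map_tmul, LinearMap.rTensor_tmul, ι_apply, E.e_ι,
          TensorProduct.lid_tmul]; split_ifs with hg <;> simp [hg]
    rw [← ι_apply, comul_ι, h, Coalgebra.rTensor_counit_comul, TensorProduct.lid_tmul, one_smul,
      ι_apply, E.proj_incl_mul]
    simp only [eq_comm (a := g)]
    split_ifs <;> simp

end CrossedExtension

end CrossedExtension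

section CounitOuter

variable (k A : Type u) [Field k] [Ring A] [HopfAlgebra k A]

/-- The map `a ⊗ (b ⊗ c) ↦ ε(a) ε(c) b`. -/
noncomputable def counitOuter : A ⊗[k] (A ⊗[k] A) →ₗ[k] A :=
  (TensorProduct.lid k A).toLinearMap ∘ₗ TensorProduct.map Coalgebra.counit
    ((TensorProduct.rid k A).toLinearMap ∘ₗ Coalgebra.counit.lTensor A)

variable {k A}

theorem counitOuter_tmul (a b c : A) : counitOuter k A (a ⊗ₜ (b ⊗ₜ c)) =
    Coalgebra.counit (R := k) a • Coalgebra.counit (R := k) c • b := by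
  simp only [counitOuter, LinearMap.comp_apply, TensorProduct.map_tmul, LinearEquiv.coe_coe,
    LinearMap.lTensor_tmul, TensorProduct.rid_tmul, TensorProduct.lid_tmul]

theorem counitOuter_comul₂ (a : A) : counitOuter k A (comul₂ k A a) = a := by
  have h (t : A ⊗[k] A) : counitOuter k A (Coalgebra.comul.lTensor A t) =
      TensorProduct.lid k A (Coalgebra.counit.rTensor A t) := by
    induction t with
    | zero => simp
    | add x y hx hy => simp only [map_add, hx, hy]
    | tmul a b => simp [counitOuter]
  rw [comul₂, LinearMap.comp_apply, h, Coalgebra.rTensor_counit_comul, TensorProduct.lid_tmul,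
    one_smul]

end CounitOuter

section Support

variable {k A C : Type u} {Γ : Type v} [Field k] [Ring A] [HopfAlgebra k A]
  [Ring C] [HopfAlgebra k C] [Group Γ] [Fintype Γ] [DecidableEq Γ]

open YetterDrinfeld

namespace CrossedExtension

variable (E : CrossedExtension k A C Γ)

/-- The action `v ↦ v₍₀₎ e(v₍₁₎)` of the linear form `e` on a comodule over `C`. -/
noncomputable def supportLin {V : Type u} [AddCommGroup V] [Module k V] (ρ : V →ₗ[k] V ⊗[k] C) :
    V →ₗ[k] V :=
  (TensorProduct.rid k V).toLinearMap ∘ₗ E.e.lTensor V ∘ₗ ρ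

theorem supportLin_apply {V : Type u} [AddCommGroup V] [Module k V] (ρ : V →ₗ[k] V ⊗[k] C)
    (v : V) : E.supportLin ρ v = TensorProduct.rid k V (E.e.lTensor V (ρ v)) := rfl

theorem coaction_supportLin {V : Type u} [AddCommGroup V] [Module k V] {ρ : V →ₗ[k] V ⊗[k] C}
    (hρ : IsRightCoaction k ρ) (v : V) :
    ρ (E.supportLin ρ v) = (E.inclₗ ∘ₗ E.proj 1).lTensor V (ρ v) := by
  have h := congrArg (((TensorProduct.rid k C).toLinearMap ∘ₗ E.e.lTensor C).lTensor V)
    (LinearMap.congr_fun hρ.coassoc v)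
  simp only [LinearMap.comp_apply, ← LinearMap.lTensor_comp_apply] at h
  have e₁ : (TensorProduct.rid k C).toLinearMap ∘ₗ E.e.lTensor C ∘ₗ Coalgebra.comul =
      E.inclₗ ∘ₗ E.proj 1 := LinearMap.ext E.lTensor_e_comul
  rw [LinearMap.comp_assoc, e₁] at h
  rw [← h, E.supportLin_apply]
  generalize ρ v = t
  induction t with
  | zero => simp
  | add x y hx hy => simp only [map_add, hx, hy]
  | tmul v c =>
    simp only [LinearMap.lTensor_tmul, LinearMap.rTensor_tmul, TensorProduct.rid_tmul, map_smul]
    generalize ρ v = t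
    induction t with
    | zero => simp
    | add x y hx hy => simp only [map_add, TensorProduct.add_tmul, smul_add, hx, hy]
    | tmul v d => simp

theorem rTensor_supportLin {V : Type u} [AddCommGroup V] [Module k V] {ρ : V →ₗ[k] V ⊗[k] C}
    (hρ : IsRightCoaction k ρ) (v : V) :
    (E.supportLin ρ).rTensor C (ρ v) = (E.inclₗ ∘ₗ E.proj 1).lTensor V (ρ v) := by
  have h := congrArg (((TensorProduct.lid k C).toLinearMap ∘ₗ E.e.rTensor C).lTensor V)
    (LinearMap.congr_fun hρ.coassoc v)
  simp only [LinearMap.comp_apply, ← LinearMap.lTensor_comp_apply] at h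
  have e₁ : (TensorProduct.lid k C).toLinearMap ∘ₗ E.e.rTensor C ∘ₗ Coalgebra.comul =
      E.inclₗ ∘ₗ E.proj 1 := LinearMap.ext E.rTensor_e_comul
  rw [LinearMap.comp_assoc, e₁] at h
  rw [← h]
  generalize ρ v = t
  induction t with
  | zero => simp
  | add x y hx hy => simp only [map_add, hx, hy]
  | tmul v c =>
    simp only [LinearMap.rTensor_tmul, E.supportLin_apply]
    generalize ρ v = t
    induction t with
    | zero => simp
    | add x y hx hy => simp only [map_add, TensorProduct.add_tmul, hx, hy]
    | tmul v d => simp [TensorProduct.smul_tmul]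

theorem supportLin_act (W : YetterDrinfeld k C) (w : W.carrier) (c : C) :
    E.supportLin W.coact (W.act w c) = W.act (E.supportLin W.coact w) c := by
  induction c using E.induction with
  | hadd x y hx hy => simp only [map_add, hx, hy]
  | h a g =>
    rw [← ι_apply, E.supportLin_apply, W.isYetterDrinfeld.compat, E.comul₂_ι, E.supportLin_apply]
    have key (t : W.carrier ⊗[k] C) (s : A ⊗[k] (A ⊗[k] A)) :
        TensorProduct.rid k _ (E.e.lTensor _ (ydTwist W.act (t ⊗ₜ
          TensorProduct.map (E.ι g) (TensorProduct.map (E.ι g) (E.ι g)) s))) =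
        W.act (TensorProduct.rid k _ (E.e.lTensor _ t)) (E.ι g (counitOuter k A s)) := by
      induction t with
      | zero => simp
      | add x y hx hy => simp only [map_add, TensorProduct.add_tmul, LinearMap.add_apply, hx, hy]
      | tmul w x =>
        induction s with
        | zero => simp
        | add x y hx hy => simp only [map_add, TensorProduct.tmul_add, hx, hy]
        | tmul a s =>
          induction s with
          | zero => simp
          | add x y hx hy => simp only [map_add, TensorProduct.tmul_add, hx, hy]
          | tmul b c =>
            simp only [TensorProduct.map_tmul, ydTwist_tmul, LinearMap.lTensor_tmul,
              E.e_antipode_mul, TensorProduct.rid_tmul, counitOuter_tmul, map_smul,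
              LinearMap.smul_apply, smul_smul]
            congr 1
            ring
    rw [key, counitOuter_comul₂]

/-- The idempotent endomorphism `v ↦ v₍₀₎ e(v₍₁₎)` of a Yetter-Drinfeld module over `C`. Its image
is the largest subcomodule whose coaction takes values in `A`. Linearity over `C` holds because
`e` is invariant under conjugation by the `u g`. -/
noncomputable def support (W : YetterDrinfeld k C) : W ⟶ W where
  lin := E.supportLin W.coact
  map_act w c := E.supportLin_act W w c
  map_coact w := by
    rw [E.coaction_supportLin W.isYetterDrinfeld.coaction,
      E.rTensor_supportLin W.isYetterDrinfeld.coaction]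

theorem support_apply (W : YetterDrinfeld k C) (w : W.carrier) :
    (E.support W).lin w = TensorProduct.rid k _ (E.e.lTensor _ (W.coact w)) := rfl

theorem coact_support (W : YetterDrinfeld k C) (w : W.carrier) :
    W.coact ((E.support W).lin w) = (E.inclₗ ∘ₗ E.proj 1).lTensor _ (W.coact w) :=
  E.coaction_supportLin W.isYetterDrinfeld.coaction w

theorem support_naturality {W W' : YetterDrinfeld k C} (f : W ⟶ W') (w : W.carrier) :
    f.lin ((E.support W).lin w) = (E.support W').lin (f.lin w) := by
  rw [support_apply, support_apply, f.map_coact]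
  generalize W.coact w = t
  induction t with
  | zero => simp
  | add x y hx hy => simp only [map_add, hx, hy]
  | tmul w c => simp

theorem support_support (W : YetterDrinfeld k C) (w : W.carrier) :
    (E.support W).lin ((E.support W).lin w) = (E.support W).lin w := by
  rw [support_apply, coact_support, support_apply, ← LinearMap.lTensor_comp_apply]
  congr 3
  refine LinearMap.ext fun c => ?_
  rw [LinearMap.comp_apply, LinearMap.comp_apply, inclₗ_apply, e_incl]
  rfl

end CrossedExtension

end Support

section YetterDrinfeldAdjunction

variable {k A C : Type u} {Γ : Type u} [Field k] [Ring A] [HopfAlgebra k A]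
  [Ring C] [HopfAlgebra k C] [Group Γ] [Fintype Γ] [DecidableEq Γ]

open YetterDrinfeld

section Coaction

variable {V W : Type u} [AddCommGroup V] [Module k V] [AddCommGroup W] [Module k W]
  {ρ : V →ₗ[k] V ⊗[k] A} {σ : W →ₗ[k] W ⊗[k] C} {f : V →ₗ[k] W} {χ : A →ₗ[k] C}

/-- If `f` intertwines `ρ` and `σ` along a linear map `χ` of coefficients, it intertwines their
iterates. -/
theorem assoc_rTensor_coaction (h : ∀ v, σ (f v) = TensorProduct.map f χ (ρ v)) (v : V) :
    TensorProduct.assoc k W C C (σ.rTensor C (σ (f v))) =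
      TensorProduct.map f (TensorProduct.map χ χ)
        (TensorProduct.assoc k V A A (ρ.rTensor A (ρ v))) := by
  rw [h]
  generalize ρ v = t
  induction t with
  | zero => simp
  | add x y hx hy => simp only [map_add, hx, hy]
  | tmul v a =>
    simp only [TensorProduct.map_tmul, LinearMap.rTensor_tmul, h]
    generalize ρ v = t
    induction t with
    | zero => simp
    | add x y hx hy => simp only [map_add, TensorProduct.add_tmul, hx, hy]
    | tmul v b => simp

theorem lTensor_comul_coaction (h : ∀ v, σ (f v) = TensorProduct.map f χ (ρ v))
    (hχ : ∀ a, Coalgebra.comul (R := k) (χ a) = TensorProduct.map χ χ (Coalgebra.comul (R := k) a))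
    (v : V) : (Coalgebra.comul (R := k)).lTensor W (σ (f v)) =
      TensorProduct.map f (TensorProduct.map χ χ) ((Coalgebra.comul (R := k)).lTensor V (ρ v)) := by
  rw [h]
  generalize ρ v = t
  induction t with
  | zero => simp
  | add x y hx hy => simp only [map_add, hx, hy]
  | tmul v a => simp [hχ]

theorem rid_lTensor_counit_coaction (h : ∀ v, σ (f v) = TensorProduct.map f χ (ρ v))
    (hχ : ∀ a, Coalgebra.counit (R := k) (χ a) = Coalgebra.counit (R := k) a) (v : V) :
    TensorProduct.rid k W ((Coalgebra.counit (R := k)).lTensor W (σ (f v))) =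
      f (TensorProduct.rid k V ((Coalgebra.counit (R := k)).lTensor V (ρ v))) := by
  rw [h]
  generalize ρ v = t
  induction t with
  | zero => simp
  | add x y hx hy => simp only [map_add, hx, hy]
  | tmul v a => simp [hχ]

end Coaction

namespace CrossedExtension

variable (E : CrossedExtension k A C Γ)

/-! ### Restriction of Yetter-Drinfeld modules -/

/-- The image of the idempotent `support`, as the kernel of the complementary idempotent. -/
noncomputable def supported (W : YetterDrinfeld k C) : YetterDrinfeld k C :=
  kerObj (𝟙 W + -E.support W)

/-- The inclusion of the part supported on `A`. -/
noncomputable def supportedι (W : YetterDrinfeld k C) : E.supported W ⟶ W :=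
  kerι (𝟙 W + -E.support W)

theorem supportedι_injective (W : YetterDrinfeld k C) : Function.Injective (E.supportedι W).lin :=
  kerι_injective _

theorem support_supportedι (W : YetterDrinfeld k C) (x : (E.supported W).carrier) :
    (E.support W).lin ((E.supportedι W).lin x) = (E.supportedι W).lin x := by
  have h : (E.supportedι W).lin x + -(E.support W).lin ((E.supportedι W).lin x) = 0 :=
    LinearMap.congr_fun (congrArg Hom.lin (kerι_comp (𝟙 W + -E.support W))) x
  exact (add_neg_eq_zero.1 h).symm

/-- A linear map into a Yetter-Drinfeld module that is fixed by `support` factors through the part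
supported on `A`. -/
noncomputable def supportedLift {V : Type u} [AddCommGroup V] [Module k V] {W : YetterDrinfeld k C}
    (f : V →ₗ[k] W.carrier) (hf : ∀ v, (E.support W).lin (f v) = f v) :
    V →ₗ[k] (E.supported W).carrier :=
  f.codRestrict (LinearMap.ker (𝟙 W + -E.support W : W ⟶ W).lin) fun v => by simp [hf]

theorem lTensor_coact_supported (W : YetterDrinfeld k C) (x : (E.supported W).carrier) :
    (E.inclₗ ∘ₗ E.proj 1).lTensor _ ((E.supported W).coact x) = (E.supported W).coact x := by
  rw [← E.coact_support]
  congr 1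
  apply E.supportedι_injective
  rw [E.support_naturality, E.support_supportedι]

/-- A Yetter-Drinfeld module over `C` whose coaction takes values in `A` is a Yetter-Drinfeld
module over `A` by restricting the action. -/
theorem isYetterDrinfeld_of_lTensor (D : YetterDrinfeld k C)
    (ρ : D.carrier →ₗ[k] D.carrier ⊗[k] A) (h : ∀ x, E.inclₗ.lTensor _ (ρ x) = D.coact x) :
    IsYetterDrinfeld (D.act.compl₂ E.inclₗ) ρ where
  act_one v := by simp [D.isYetterDrinfeld.act_one]
  act_mul v a b := by simp [D.isYetterDrinfeld.act_mul]
  coaction :=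
    have h' : ∀ x, D.coact (LinearMap.id (R := k) x) =
      TensorProduct.map LinearMap.id E.inclₗ (ρ x) := fun x => (h x).symm
    { coassoc := by
        refine LinearMap.ext fun v => ?_
        have hinj : Function.Injective (TensorProduct.map (LinearMap.id (R := k) (M := D.carrier))
            (TensorProduct.map E.inclₗ E.inclₗ)) :=
          Module.Flat.lTensor_preserves_injective_linearMap _
            (E.map_inclₗ_injective E.inclₗ_injective)
        refine hinj ?_
        refine (assoc_rTensor_coaction h' v).symm.trans (Eq.trans ?_
          (lTensor_comul_coaction h' E.comul_incl v))
        exact LinearMap.congr_fun D.isYetterDrinfeld.coaction.coassoc v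
      counit := by
        refine LinearMap.ext fun v => ?_
        refine (rid_lTensor_counit_coaction h' E.counit_incl v).symm.trans ?_
        exact LinearMap.congr_fun D.isYetterDrinfeld.coaction.counit v }
  compat v a := by
    apply Module.Flat.lTensor_preserves_injective_linearMap _ E.inclₗ_injective
    rw [h, LinearMap.compl₂_apply, inclₗ_apply, D.isYetterDrinfeld.compat, E.comul₂_incl, ← h]
    have key : ydTwist D.act ∘ₗ TensorProduct.map (E.inclₗ.lTensor _)
        (TensorProduct.map E.inclₗ (TensorProduct.map E.inclₗ E.inclₗ)) =
        E.inclₗ.lTensor _ ∘ₗ ydTwist (D.act.compl₂ E.inclₗ) := by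
      ext v x a b c
      simp [ydTwist_tmul, E.antipode_incl]
    exact LinearMap.congr_fun key (ρ v ⊗ₜ comul₂ k A a)

/-- Restriction of Yetter-Drinfeld modules from `C` to `A`: the part supported on `A`, with the
restricted action. -/
noncomputable def restrict (W : YetterDrinfeld k C) : YetterDrinfeld k A where
  carrier := (E.supported W).carrier
  act := (E.supported W).act.compl₂ E.inclₗ
  coact := (E.proj 1).lTensor _ ∘ₗ (E.supported W).coact
  isYetterDrinfeld := E.isYetterDrinfeld_of_lTensor _ _ fun x => by
    rw [LinearMap.comp_apply, ← LinearMap.lTensor_comp_apply, E.lTensor_coact_supported]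

/-- The inclusion of the restriction into the original module. -/
noncomputable def restrictι (W : YetterDrinfeld k C) : (E.restrict W).carrier →ₗ[k] W.carrier :=
  (E.supportedι W).lin

theorem restrictι_injective (W : YetterDrinfeld k C) : Function.Injective (E.restrictι W) :=
  E.supportedι_injective W

theorem restrictι_act (W : YetterDrinfeld k C) (x : (E.restrict W).carrier) (a : A) :
    E.restrictι W ((E.restrict W).act x a) = W.act (E.restrictι W x) (E.incl a) :=
  (E.supportedι W).map_act x (E.incl a)

theorem coact_restrictι (W : YetterDrinfeld k C) (x : (E.restrict W).carrier) :
    W.coact (E.restrictι W x) =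
      TensorProduct.map (E.restrictι W) E.inclₗ ((E.restrict W).coact x) := by
  refine ((E.supportedι W).map_coact x).trans ?_
  refine (congrArg _ (E.lTensor_coact_supported W x).symm).trans ?_
  exact (TensorProduct.map_map _ _ _ _ _).trans (TensorProduct.map_map
    (E.supportedι W).lin E.inclₗ LinearMap.id (E.proj 1) ((E.supported W).coact x)).symm

theorem support_eq_of_coact {V : YetterDrinfeld k A} {W : YetterDrinfeld k C}
    {f : V.carrier →ₗ[k] W.carrier}
    (hf : ∀ v, W.coact (f v) = TensorProduct.map f E.inclₗ (V.coact v)) (v : V.carrier) :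
    (E.support W).lin (f v) = f v := by
  have h : f (TensorProduct.rid k _ (Coalgebra.counit.lTensor _ (V.coact v))) = f v :=
    congrArg f (LinearMap.congr_fun V.isYetterDrinfeld.coaction.counit v)
  rw [E.support_apply, hf]
  refine Eq.trans ?_ h
  generalize V.coact v = t
  induction t with
  | zero => simp
  | add x y hx hy => simp only [map_add, hx, hy]
  | tmul v a => simp [E.e_incl]

/-- A linear map `V → W` compatible with the actions and coactions along `A → C` is a morphism
from `V` to the restriction of `W`. -/
noncomputable def toRestrict {V : YetterDrinfeld k A} {W : YetterDrinfeld k C}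
    (f : V.carrier →ₗ[k] W.carrier) (hact : ∀ v a, f (V.act v a) = W.act (f v) (E.incl a))
    (hcoact : ∀ v, W.coact (f v) = TensorProduct.map f E.inclₗ (V.coact v)) :
    V ⟶ E.restrict W where
  lin := E.supportedLift f (E.support_eq_of_coact hcoact)
  map_act v a := by
    apply E.restrictι_injective
    rw [E.restrictι_act]
    exact hact v a
  map_coact v := by
    apply E.map_inclₗ_injective (E.restrictι_injective W)
    rw [← E.coact_restrictι]
    refine (hcoact v).trans (Eq.trans ?_ (LinearMap.map_rTensor _ _ _ _ _).symm)
    rfl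

/-- Restriction of a morphism. -/
noncomputable def restrictMap {W W' : YetterDrinfeld k C} (g : W ⟶ W') :
    E.restrict W ⟶ E.restrict W' :=
  E.toRestrict (g.lin ∘ₗ E.restrictι W)
    (fun x a => by simp only [LinearMap.comp_apply, E.restrictι_act, g.map_act])
    (fun x => by
      rw [LinearMap.comp_apply, g.map_coact, E.coact_restrictι, LinearMap.rTensor_map])

/-- Restriction as a functor. -/
noncomputable def restrictFunctor : YetterDrinfeld k C ⥤ YetterDrinfeld k A where
  obj := E.restrict
  map := E.restrictMap
  map_id _ := hom_ext fun _ => E.restrictι_injective _ rfl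
  map_comp _ _ := hom_ext fun _ => E.restrictι_injective _ rfl

instance : E.restrictFunctor.Additive where
  map_add {_ W' f g} := hom_ext fun x => E.restrictι_injective W'
    (map_add (E.restrictι W') ((E.restrictMap f).lin x) ((E.restrictMap g).lin x)).symm

/-- A linear map `W → V` that is `A`-linear and colinear along the projection `C → A` is defined
on the restriction of `W`. -/
noncomputable def fromRestrict {V : YetterDrinfeld k A} {W : YetterDrinfeld k C}
    (f : W.carrier →ₗ[k] V.carrier) (hact : ∀ w a, f (W.act w (E.incl a)) = V.act (f w) a)
    (hcoact : ∀ w, V.coact (f w) = TensorProduct.map f (E.proj 1) (W.coact w)) :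
    E.restrict W ⟶ V where
  lin := f ∘ₗ E.restrictι W
  map_act x a := by rw [LinearMap.comp_apply, E.restrictι_act, hact, LinearMap.comp_apply]
  map_coact x := by
    rw [LinearMap.comp_apply, hcoact, E.coact_restrictι, TensorProduct.map_map]
    congr 2
    exact LinearMap.ext fun a => by simpa using E.proj_incl_mul_self 1 a

/-! ### Induction of Yetter-Drinfeld modules -/

section Induced

variable (V : YetterDrinfeld k A)

/-- The action of `C` on the induced module `V ⊗_A C`. The latter is realized as the space of
functions `Γ → V`, the function `single h v` standing for `v ⊗ u_h`. -/
noncomputable def inducedAct : (Γ → V.carrier) →ₗ[k] C →ₗ[k] (Γ → V.carrier) :=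
  LinearMap.lsum k (fun _ => V.carrier) k fun h => ∑ g,
    (V.act.compl₂ (E.proj g ∘ₗ LinearMap.mulLeft k (E.u h))).compr₂
      (LinearMap.single k (fun _ => V.carrier) g)

/-- The coaction on the induced module, `v ⊗ u_h ↦ (v₍₀₎ ⊗ u_h) ⊗ u_h⁻¹ v₍₁₎ u_h`. -/
noncomputable def inducedCoact : (Γ → V.carrier) →ₗ[k] (Γ → V.carrier) ⊗[k] C :=
  LinearMap.lsum k (fun _ => V.carrier) k fun h =>
    TensorProduct.map (LinearMap.single k (fun _ => V.carrier) h) (E.inclₗ ∘ₗ E.θ h⁻¹) ∘ₗ V.coact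

variable {V}

theorem pi_induction {V : Type*} [AddCommGroup V] {P : (Γ → V) → Prop}
    (h : ∀ g v, P (Pi.single g v)) (hadd : ∀ x y, P x → P y → P (x + y)) (f : Γ → V) : P f := by
  rw [← Finset.univ_sum_single f]
  exact Finset.sum_induction_nonempty _ P hadd Finset.univ_nonempty fun g _ => h _ _

theorem inducedAct_single (h g : Γ) (v : V.carrier) (a : A) :
    E.inducedAct V (Pi.single h v) (E.ι g a) = Pi.single (h * g) (V.act v (E.θ h a)) := by
  rw [inducedAct, LinearMap.lsum_piSingle, LinearMap.sum_apply, LinearMap.sum_apply]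
  have hp (x : Γ) : E.proj x (E.u h * E.ι g a) = if x = h * g then E.θ h a else 0 := by
    rw [ι_apply, ← mul_assoc, E.u_mul_incl, mul_assoc, ← map_mul, E.proj_incl_mul]
  rw [Finset.sum_eq_single (h * g)]
  · simp [hp, -ι_apply]
  · intro x _ hx
    simp [hp, hx, -ι_apply]
  · simp

theorem inducedAct_apply (F : Γ → V.carrier) (g : Γ) (a : A) (h : Γ) :
    E.inducedAct V F (E.ι g a) h = V.act (F (h * g⁻¹)) (E.θ (h * g⁻¹) a) := by
  induction F using pi_induction with
  | hadd x y hx hy => simp only [map_add, LinearMap.add_apply, Pi.add_apply, hx, hy]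
  | h x v =>
    rw [inducedAct_single]
    by_cases hh : x = h * g⁻¹
    · subst hh
      simp
    · rw [Pi.single_eq_of_ne (Ne.symm hh), Pi.single_eq_of_ne, map_zero, LinearMap.zero_apply]
      rintro rfl
      simp at hh

theorem inducedCoact_single (h : Γ) (v : V.carrier) :
    E.inducedCoact V (Pi.single h v) =
      TensorProduct.map (LinearMap.single k (fun _ => V.carrier) h) (E.inclₗ ∘ₗ E.θ h⁻¹)
        (V.coact v) := by
  rw [inducedCoact, LinearMap.lsum_piSingle]
  rfl

/-- The Yetter-Drinfeld condition for the induced module, on pure tensors: the conjugations by `u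
h` in the coaction and in the action cancel. -/
theorem ydTwist_inducedAct (g h : Γ) (t : V.carrier ⊗[k] A) (s : A ⊗[k] (A ⊗[k] A)) :
    ydTwist (E.inducedAct V)
        (TensorProduct.map (LinearMap.single k (fun _ => V.carrier) h) (E.inclₗ ∘ₗ E.θ h⁻¹) t ⊗ₜ
          TensorProduct.map (E.ι g) (TensorProduct.map (E.ι g) (E.ι g)) s) =
      TensorProduct.map (LinearMap.single k (fun _ => V.carrier) (h * g))
        (E.inclₗ ∘ₗ E.θ (h * g)⁻¹) (ydTwist V.act (t ⊗ₜ
          TensorProduct.map (E.θ h) (TensorProduct.map (E.θ h) (E.θ h)) s)) := by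
  induction t with
  | zero => simp
  | add x y hx hy => simp only [map_add, TensorProduct.add_tmul, hx, hy]
  | tmul v x =>
    induction s with
    | zero => simp
    | add x y hx hy => simp only [map_add, TensorProduct.tmul_add, hx, hy]
    | tmul a s =>
      induction s with
      | zero => simp
      | add x y hx hy => simp only [map_add, TensorProduct.tmul_add, hx, hy]
      | tmul b c =>
        simp only [TensorProduct.map_tmul, ydTwist_tmul, LinearMap.comp_apply,
          LinearMap.coe_single, E.inducedAct_single, E.antipode_ι]
        congr 1
        rw [E.ι_apply, mul_inv_rev, E.θ_group_mul, E.antipode_θ, E.θ_mul, E.θ_mul, E.θ_mul,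
          E.θ_mul, E.θ_inv_θ,
          E.θ_inv_θ, E.inclₗ_apply, E.inclₗ_apply, map_mul, map_mul, E.incl_θ_inv g,
          E.incl_θ_inv g, E.incl_θ_inv g]
        simp [mul_assoc]

variable (V) in
theorem isYetterDrinfeld_induced : IsYetterDrinfeld (E.inducedAct V) (E.inducedCoact V) where
  act_one F := by
    have h1 : (1 : C) = E.ι 1 1 := by simp
    refine funext fun h => ?_
    rw [h1, E.inducedAct_apply, inv_one, mul_one, E.θ_one, V.isYetterDrinfeld.act_one]
  act_mul F c d := by
    induction c using E.induction with
    | hadd x y hx hy => simp only [add_mul, map_add, LinearMap.add_apply, hx, hy]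
    | h a g =>
      induction d using E.induction with
      | hadd x y hx hy => simp only [mul_add, map_add, hx, hy]
      | h b g' =>
        have e : E.incl a * E.u g * (E.incl b * E.u g') = E.ι (g * g') (a * E.θ g b) := by
          rw [ι_apply, map_mul, map_mul, E.incl_θ]
          simp [mul_assoc]
        rw [e, ← ι_apply, ← ι_apply]
        refine funext fun h => ?_
        simp only [E.inducedAct_apply, mul_inv_rev, E.θ_mul, V.isYetterDrinfeld.act_mul,
          ← E.θ_group_mul, mul_assoc, inv_mul_cancel, mul_one]
  coaction :=
    have hχ (h : Γ) (v) : E.inducedCoact V (LinearMap.single k (fun _ => V.carrier) h v) =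
        TensorProduct.map (LinearMap.single k (fun _ => V.carrier) h) (E.inclₗ ∘ₗ E.θ h⁻¹)
          (V.coact v) := E.inducedCoact_single h v
    { coassoc := by
        refine LinearMap.pi_ext fun h v => ?_
        refine (assoc_rTensor_coaction (hχ h) v).trans (Eq.trans ?_
          (lTensor_comul_coaction (hχ h) (fun a => ?_) v).symm)
        · exact congrArg _ (LinearMap.congr_fun V.isYetterDrinfeld.coaction.coassoc v)
        · rw [LinearMap.comp_apply, inclₗ_apply, E.comul_incl, E.comul_θ,
            TensorProduct.map_map]
      counit := by
        refine LinearMap.pi_ext fun h v => ?_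
        refine (rid_lTensor_counit_coaction (hχ h) (fun a => ?_) v).trans ?_
        · rw [LinearMap.comp_apply, inclₗ_apply, E.counit_incl, E.counit_θ]
        · exact congrArg _ (LinearMap.congr_fun V.isYetterDrinfeld.coaction.counit v) }
  compat F c := by
    induction c using E.induction with
    | hadd x y hx hy => simp only [map_add, TensorProduct.tmul_add, hx, hy]
    | h a g =>
      induction F using pi_induction with
      | hadd x y hx hy =>
        simp only [map_add, LinearMap.add_apply, TensorProduct.add_tmul, hx, hy]
      | h h v =>
        rw [← ι_apply, E.inducedAct_single, E.inducedCoact_single, V.isYetterDrinfeld.compat,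
          E.comul₂_θ, E.inducedCoact_single, E.comul₂_ι, E.ydTwist_inducedAct]

variable (V) in
/-- The Yetter-Drinfeld module over `C` induced from one over `A`. -/
noncomputable def induced : YetterDrinfeld k C where
  carrier := Γ → V.carrier
  act := E.inducedAct V
  coact := E.inducedCoact V
  isYetterDrinfeld := E.isYetterDrinfeld_induced V

end Induced

/-- The map `v ↦ v ⊗ u_g` into the induced module. -/
noncomputable def inducedSingle (V : YetterDrinfeld k A) (g : Γ) :
    V.carrier →ₗ[k] (E.induced V).carrier := LinearMap.single k (fun _ => V.carrier) g

/-- The component at `u_g` of an element of the induced module. -/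
def inducedEval (V : YetterDrinfeld k A) (g : Γ) :
    (E.induced V).carrier →ₗ[k] V.carrier := LinearMap.proj g

/-- The linear map on the induced module with given values on the components. -/
noncomputable def inducedLift {V : YetterDrinfeld k A} {X : Type u} [AddCommGroup X] [Module k X]
    (f : Γ → V.carrier →ₗ[k] X) : (E.induced V).carrier →ₗ[k] X :=
  LinearMap.lsum k (fun _ => V.carrier) k f

theorem inducedLift_single {V : YetterDrinfeld k A} {X : Type u} [AddCommGroup X] [Module k X]
    (f : Γ → V.carrier →ₗ[k] X) (g : Γ) (v : V.carrier) :
    E.inducedLift f (E.inducedSingle V g v) = f g v :=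
  LinearMap.lsum_piSingle k (fun _ : Γ => V.carrier) k f g v

theorem inducedEval_single_self {V : YetterDrinfeld k A} (g : Γ) (v : V.carrier) :
    E.inducedEval V g (E.inducedSingle V g v) = v :=
  Pi.single_eq_same (M := fun _ : Γ => V.carrier) g v

theorem inducedEval_single_of_ne {V : YetterDrinfeld k A} {g h : Γ} (hgh : g ≠ h) (v : V.carrier) :
    E.inducedEval V g (E.inducedSingle V h v) = 0 :=
  Pi.single_eq_of_ne (M := fun _ : Γ => V.carrier) hgh v

theorem sum_inducedSingle_eval {V : YetterDrinfeld k A} (F : (E.induced V).carrier) :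
    ∑ g, E.inducedSingle V g (E.inducedEval V g F) = F :=
  Finset.univ_sum_single (M := fun _ : Γ => V.carrier) F

theorem inducedEval_sum_single {V : YetterDrinfeld k A} {X : Type u} [AddCommGroup X] [Module k X]
    (f : Γ → X →ₗ[k] V.carrier) (g : Γ) (x : X) :
    E.inducedEval V g ((∑ h, E.inducedSingle V h ∘ₗ f h) x) = f g x := by
  simp only [LinearMap.sum_apply, map_sum, LinearMap.comp_apply]
  rw [Finset.sum_eq_single g (fun h _ hh => E.inducedEval_single_of_ne hh.symm _) (by simp)]
  exact E.inducedEval_single_self g _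

theorem induced_ext {V : YetterDrinfeld k A} {F G : (E.induced V).carrier}
    (h : ∀ g, E.inducedEval V g F = E.inducedEval V g G) : F = G :=
  funext h

theorem induced_induction {V : YetterDrinfeld k A} {P : (E.induced V).carrier → Prop}
    (h : ∀ g v, P (E.inducedSingle V g v)) (hadd : ∀ x y, P x → P y → P (x + y))
    (F : (E.induced V).carrier) : P F :=
  pi_induction (V := V.carrier) (P := P) h hadd F

theorem inducedEval_act {V : YetterDrinfeld k A} (F : (E.induced V).carrier) (g : Γ) (a : A)
    (h : Γ) : E.inducedEval V h ((E.induced V).act F (E.ι g a)) =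
      V.act (E.inducedEval V (h * g⁻¹) F) (E.θ (h * g⁻¹) a) :=
  E.inducedAct_apply F g a h

theorem inducedSingle_act {V : YetterDrinfeld k A} (h g : Γ) (v : V.carrier) (a : A) :
    (E.induced V).act (E.inducedSingle V h v) (E.ι g a) =
      E.inducedSingle V (h * g) (V.act v (E.θ h a)) :=
  E.inducedAct_single h g v a

theorem coact_inducedSingle {V : YetterDrinfeld k A} (h : Γ) (v : V.carrier) :
    (E.induced V).coact (E.inducedSingle V h v) =
      TensorProduct.map (E.inducedSingle V h) (E.inclₗ ∘ₗ E.θ h⁻¹) (V.coact v) :=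
  E.inducedCoact_single h v

/-- The coaction on `w · u_g`, for `u_g` group-like, is `w₍₀₎ · u_g ⊗ u_g⁻¹ w₍₁₎ u_g`. -/
theorem coact_act_u {W : YetterDrinfeld k C} (w : W.carrier) (g : Γ) :
    W.coact (W.act w (E.u g)) = TensorProduct.map (W.act.flip (E.u g))
      (LinearMap.mulRight k (E.u g) ∘ₗ LinearMap.mulLeft k (E.u g⁻¹)) (W.coact w) := by
  rw [W.isYetterDrinfeld.compat, E.comul₂_u]
  generalize W.coact w = t
  induction t with
  | zero => simp
  | add x y hx hy => simp only [map_add, TensorProduct.add_tmul, hx, hy]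
  | tmul w c => simp [ydTwist_tmul, E.antipode_u]

/-- A linear map `V → W` compatible with the actions and coactions along `A → C` extends to the
morphism `v ⊗ u_g ↦ f(v) · u_g` on the induced module. -/
noncomputable def fromInduced {V : YetterDrinfeld k A} {W : YetterDrinfeld k C}
    (f : V.carrier →ₗ[k] W.carrier) (hact : ∀ v a, f (V.act v a) = W.act (f v) (E.incl a))
    (hcoact : ∀ v, W.coact (f v) = TensorProduct.map f E.inclₗ (V.coact v)) :
    E.induced V ⟶ W where
  lin := E.inducedLift fun g => W.act.flip (E.u g) ∘ₗ f
  map_act F c := by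
    induction c using E.induction with
    | hadd x y hx hy => rw [map_add, map_add, map_add, hx, hy]
    | h a g =>
      induction F using E.induced_induction with
      | hadd x y hx hy => simp only [map_add, LinearMap.add_apply, hx, hy]
      | h h v =>
        rw [← ι_apply, inducedSingle_act, inducedLift_single, inducedLift_single,
          LinearMap.comp_apply, LinearMap.comp_apply, LinearMap.flip_apply, LinearMap.flip_apply,
          hact, ← W.isYetterDrinfeld.act_mul, ← W.isYetterDrinfeld.act_mul, map_mul E.u,
          ← mul_assoc, ← E.u_mul_incl, ι_apply, mul_assoc]
  map_coact F := by
    induction F using E.induced_induction with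
    | hadd x y hx hy => simp only [map_add, hx, hy]
    | h h v =>
      rw [coact_inducedSingle, inducedLift_single, LinearMap.comp_apply, LinearMap.flip_apply,
        E.coact_act_u, hcoact, TensorProduct.map_map, LinearMap.rTensor_map]
      congr 2
      · exact LinearMap.ext fun v =>
          (E.inducedLift_single (fun g => W.act.flip (E.u g) ∘ₗ f) h v).symm
      · exact LinearMap.ext fun a => (E.incl_θ_inv h a).symm

theorem fromInduced_single {V : YetterDrinfeld k A} {W : YetterDrinfeld k C}
    (f : V.carrier →ₗ[k] W.carrier) (hact : ∀ v a, f (V.act v a) = W.act (f v) (E.incl a))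
    (hcoact : ∀ v, W.coact (f v) = TensorProduct.map f E.inclₗ (V.coact v)) (g : Γ)
    (v : V.carrier) :
    (E.fromInduced f hact hcoact).lin (E.inducedSingle V g v) = W.act (f v) (E.u g) :=
  E.inducedLift_single _ g v

theorem fromInduced_single_one {V : YetterDrinfeld k A} {W : YetterDrinfeld k C}
    (f : V.carrier →ₗ[k] W.carrier) (hact : ∀ v a, f (V.act v a) = W.act (f v) (E.incl a))
    (hcoact : ∀ v, W.coact (f v) = TensorProduct.map f E.inclₗ (V.coact v)) (v : V.carrier) :
    (E.fromInduced f hact hcoact).lin (E.inducedSingle V 1 v) = f v := by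
  rw [fromInduced_single, map_one, W.isYetterDrinfeld.act_one]

theorem induced_hom_ext {V : YetterDrinfeld k A} {W : YetterDrinfeld k C} {F G : E.induced V ⟶ W}
    (h : ∀ v, F.lin (E.inducedSingle V 1 v) = G.lin (E.inducedSingle V 1 v)) : F = G := by
  refine hom_ext fun x => ?_
  induction x using E.induced_induction with
  | hadd x y hx hy => rw [map_add, map_add, hx, hy]
  | h g v =>
    have e : E.inducedSingle V g v = (E.induced V).act (E.inducedSingle V 1 v) (E.ι g 1) := by
      rw [inducedSingle_act, one_mul, E.θ_one, V.isYetterDrinfeld.act_one]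
    rw [e, F.map_act, G.map_act, h]

theorem inducedSingle_one_act {V : YetterDrinfeld k A} (v : V.carrier) (a : A) :
    E.inducedSingle V 1 (V.act v a) = (E.induced V).act (E.inducedSingle V 1 v) (E.incl a) := by
  rw [← inclₗ_apply, ← ι_one, inducedSingle_act, mul_one, E.θ_group_one]

theorem coact_inducedSingle_one {V : YetterDrinfeld k A} (v : V.carrier) :
    (E.induced V).coact (E.inducedSingle V 1 v) =
      TensorProduct.map (E.inducedSingle V 1) E.inclₗ (V.coact v) := by
  rw [E.coact_inducedSingle]
  congr 2
  exact LinearMap.ext fun a => by rw [LinearMap.comp_apply, inv_one, E.θ_group_one]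

/-- Induction of a morphism. -/
noncomputable def inducedMap {V V' : YetterDrinfeld k A} (f : V ⟶ V') :
    E.induced V ⟶ E.induced V' :=
  E.fromInduced (E.inducedSingle V' 1 ∘ₗ f.lin)
    (fun v a => by rw [LinearMap.comp_apply, f.map_act, inducedSingle_one_act,
      LinearMap.comp_apply])
    (fun v => by rw [LinearMap.comp_apply, coact_inducedSingle_one, f.map_coact,
      LinearMap.map_rTensor])

theorem inducedMap_single {V V' : YetterDrinfeld k A} (f : V ⟶ V') (v : V.carrier) :
    (E.inducedMap f).lin (E.inducedSingle V 1 v) = E.inducedSingle V' 1 (f.lin v) :=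
  E.fromInduced_single_one _ _ _ _

/-- Induction as a functor. -/
noncomputable def inducedFunctor : YetterDrinfeld k A ⥤ YetterDrinfeld k C where
  obj := E.induced
  map := E.inducedMap
  map_id _ := E.induced_hom_ext fun v => E.inducedMap_single _ v
  map_comp f g := E.induced_hom_ext fun v => by
    rw [inducedMap_single, comp_lin, comp_lin, LinearMap.comp_apply, LinearMap.comp_apply,
      inducedMap_single, inducedMap_single]

instance : E.inducedFunctor.Additive where
  map_add {V V' f g} := E.induced_hom_ext (F := E.inducedMap (f + g))
    (G := E.inducedMap f + E.inducedMap g) fun v => by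
      rw [add_lin, LinearMap.add_apply, inducedMap_single, inducedMap_single, inducedMap_single,
        add_lin, LinearMap.add_apply, map_add]

/-! ### The two adjunctions between induction and restriction -/

/-- Morphisms from an induced module and morphisms into a restriction both correspond to linear
maps `V → W` compatible with the structures along `A → C`. -/
noncomputable def inducedRestrictHomEquiv (V : YetterDrinfeld k A) (W : YetterDrinfeld k C) :
    (E.induced V ⟶ W) ≃ (V ⟶ E.restrict W) where
  toFun F := E.toRestrict (F.lin ∘ₗ E.inducedSingle V 1)
    (fun v a => by rw [LinearMap.comp_apply, inducedSingle_one_act, F.map_act,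
      LinearMap.comp_apply])
    (fun v => by rw [LinearMap.comp_apply, F.map_coact, coact_inducedSingle_one,
      LinearMap.rTensor_map])
  invFun G := E.fromInduced (E.restrictι W ∘ₗ G.lin)
    (fun v a => by rw [LinearMap.comp_apply, G.map_act, restrictι_act, LinearMap.comp_apply])
    (fun v => by rw [LinearMap.comp_apply, coact_restrictι, G.map_coact, LinearMap.map_rTensor])
  left_inv F := E.induced_hom_ext fun v => E.fromInduced_single_one _ _ _ _
  right_inv G := hom_ext fun v => E.restrictι_injective W (E.fromInduced_single_one _ _ _ _)

theorem inducedRestrictHomEquiv_symm_single {V : YetterDrinfeld k A} {W : YetterDrinfeld k C}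
    (G : V ⟶ E.restrict W) (v : V.carrier) :
    ((E.inducedRestrictHomEquiv V W).symm G).lin (E.inducedSingle V 1 v) =
      E.restrictι W (G.lin v) :=
  (E.inducedLift_single (fun g => W.act.flip (E.u g) ∘ₗ E.restrictι W ∘ₗ G.lin) 1 v).trans (by
    rw [LinearMap.comp_apply, LinearMap.flip_apply, map_one, W.isYetterDrinfeld.act_one,
      LinearMap.comp_apply])

theorem inducedRestrictHomEquiv_symm_naturality {V V' : YetterDrinfeld k A}
    {W : YetterDrinfeld k C} (f : V' ⟶ V) (g : V ⟶ E.restrict W) :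
    (E.inducedRestrictHomEquiv V' W).symm (f ≫ g) =
      E.inducedMap f ≫ (E.inducedRestrictHomEquiv V W).symm g :=
  E.induced_hom_ext fun v => by
    rw [comp_lin, LinearMap.comp_apply, inducedMap_single, inducedRestrictHomEquiv_symm_single,
      inducedRestrictHomEquiv_symm_single, comp_lin, LinearMap.comp_apply]

/-- Induction is left adjoint to restriction. -/
noncomputable def inducedRestrictAdj : E.inducedFunctor ⊣ E.restrictFunctor :=
  Adjunction.mkOfHomEquiv
    { homEquiv := E.inducedRestrictHomEquiv
      homEquiv_naturality_left_symm := E.inducedRestrictHomEquiv_symm_naturality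
      homEquiv_naturality_right := fun _ _ => hom_ext fun _ => E.restrictι_injective _ rfl }

theorem apply_support_of_coact {V : YetterDrinfeld k A} {W : YetterDrinfeld k C}
    {f : W.carrier →ₗ[k] V.carrier}
    (hcoact : ∀ w, V.coact (f w) = TensorProduct.map f (E.proj 1) (W.coact w)) (w : W.carrier) :
    f ((E.support W).lin w) = f w := by
  have h : TensorProduct.rid k _ (Coalgebra.counit.lTensor _ (V.coact (f w))) = f w :=
    LinearMap.congr_fun V.isYetterDrinfeld.coaction.counit (f w)
  rw [E.support_apply, ← h, hcoact]
  generalize W.coact w = t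
  induction t with
  | zero => simp
  | add x y hx hy => simp only [map_add, hx, hy]
  | tmul v a => simp [e]

theorem incl_θ_inv_proj_one_conj (h : Γ) (c : C) :
    E.incl (E.θ h⁻¹ (E.proj 1 (E.u h * c * E.u h⁻¹))) = E.incl (E.proj 1 c) := by
  induction c using E.induction with
  | hadd x y hx hy => simp only [mul_add, add_mul, map_add, hx, hy]
  | h a g =>
    rw [← mul_assoc, E.u_mul_incl, mul_assoc, mul_assoc, ← map_mul, ← map_mul,
      E.proj_incl_mul, E.proj_incl_mul]
    by_cases hg : g = 1
    · simp [hg, E.θ_inv_θ]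
    · have : 1 ≠ h * (g * h⁻¹) := fun e => hg (by
        have e' := congrArg (fun x => h⁻¹ * x * h) e
        simpa [mul_assoc] using e'.symm)
      simp [Ne.symm hg, this]

/-- A linear map `f : W → V` that is `A`-linear and colinear along the projection `C → A` induces
the morphism `w ↦ ∑ g, f(w · u_g⁻¹) ⊗ u_g` into the induced module. -/
noncomputable def toInduced {V : YetterDrinfeld k A} {W : YetterDrinfeld k C}
    (f : W.carrier →ₗ[k] V.carrier) (hact : ∀ w a, f (W.act w (E.incl a)) = V.act (f w) a)
    (hcoact : ∀ w, V.coact (f w) = TensorProduct.map f (E.proj 1) (W.coact w)) :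
    W ⟶ E.induced V :=
  let l : W.carrier →ₗ[k] (E.induced V).carrier :=
    ∑ g, E.inducedSingle V g ∘ₗ f ∘ₗ W.act.flip (E.u g⁻¹)
  have hl (w) (g) : E.inducedEval V g (l w) = f (W.act w (E.u g⁻¹)) := by
    rw [inducedEval_sum_single, LinearMap.comp_apply, LinearMap.flip_apply]
  { lin := l
    map_act := fun w c => by
      induction c using E.induction with
      | hadd x y hx hy => rw [map_add, map_add, map_add, hx, hy]
      | h a g =>
        refine E.induced_ext fun h => ?_
        rw [hl, ← ι_apply, inducedEval_act, hl, ← hact, ← W.isYetterDrinfeld.act_mul,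
          ← W.isYetterDrinfeld.act_mul, E.incl_θ]
        simp [mul_assoc]
    map_coact := fun w => by
      -- `l` factors through `support`, so that only the `A`-part of the coaction contributes
      have hs : l ∘ₗ (E.support W).lin = l := LinearMap.ext fun w => E.induced_ext fun g => by
        rw [LinearMap.comp_apply, hl, hl, ← (E.support W).map_act, E.apply_support_of_coact hcoact]
      have h₁ : l.rTensor C (W.coact w) =
          TensorProduct.map l (E.inclₗ ∘ₗ E.proj 1) (W.coact w) := by
        conv_lhs => rw [← hs]
        rw [LinearMap.rTensor_comp_apply, ← (E.support W).map_coact, E.coact_support,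
          ← LinearMap.comp_apply, LinearMap.rTensor_comp_lTensor]
      rw [h₁]
      change (E.induced V).coact ((∑ g, E.inducedSingle V g ∘ₗ f ∘ₗ W.act.flip (E.u g⁻¹)) w) =
        TensorProduct.mapBilinear (.id k) _ _ _ _
          (∑ g, E.inducedSingle V g ∘ₗ f ∘ₗ W.act.flip (E.u g⁻¹)) (E.inclₗ ∘ₗ E.proj 1) (W.coact w)
      rw [map_sum, LinearMap.sum_apply, LinearMap.sum_apply, LinearMap.sum_apply, map_sum]
      refine Finset.sum_congr rfl fun h _ => ?_
      rw [LinearMap.comp_apply, LinearMap.comp_apply, coact_inducedSingle, LinearMap.flip_apply,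
        hcoact, E.coact_act_u, TensorProduct.map_map, TensorProduct.map_map,
        TensorProduct.mapBilinear_apply]
      congr 2
      exact LinearMap.ext fun c => by simpa using E.incl_θ_inv_proj_one_conj h c }

theorem inducedEval_toInduced {V : YetterDrinfeld k A} {W : YetterDrinfeld k C}
    (f : W.carrier →ₗ[k] V.carrier) (hact : ∀ w a, f (W.act w (E.incl a)) = V.act (f w) a)
    (hcoact : ∀ w, V.coact (f w) = TensorProduct.map f (E.proj 1) (W.coact w)) (w : W.carrier)
    (g : Γ) : E.inducedEval V g ((E.toInduced f hact hcoact).lin w) = f (W.act w (E.u g⁻¹)) :=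
  E.inducedEval_sum_single (fun g => f ∘ₗ W.act.flip (E.u g⁻¹)) g w

/-- The projection of a Yetter-Drinfeld module onto its restriction. -/
noncomputable def restrictπ (W : YetterDrinfeld k C) : W.carrier →ₗ[k] (E.restrict W).carrier :=
  E.supportedLift (E.support W).lin (E.support_support W)

theorem restrictι_restrictπ (W : YetterDrinfeld k C) (w : W.carrier) :
    E.restrictι W (E.restrictπ W w) = (E.support W).lin w := rfl

theorem restrictπ_restrictι (W : YetterDrinfeld k C) (x : (E.restrict W).carrier) :
    E.restrictπ W (E.restrictι W x) = x :=
  E.restrictι_injective W (E.support_supportedι W x)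

theorem restrictπ_act (W : YetterDrinfeld k C) (w : W.carrier) (a : A) :
    E.restrictπ W (W.act w (E.incl a)) = (E.restrict W).act (E.restrictπ W w) a := by
  apply E.restrictι_injective
  rw [restrictι_act, restrictι_restrictπ, restrictι_restrictπ, (E.support W).map_act]

theorem coact_restrictπ (W : YetterDrinfeld k C) (w : W.carrier) :
    (E.restrict W).coact (E.restrictπ W w) =
      TensorProduct.map (E.restrictπ W) (E.proj 1) (W.coact w) := by
  apply E.map_inclₗ_injective (E.restrictι_injective W)
  rw [← coact_restrictι, restrictι_restrictπ, TensorProduct.map_map]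
  change _ = TensorProduct.map (E.support W).lin (E.inclₗ ∘ₗ E.proj 1) (W.coact w)
  rw [← LinearMap.lTensor_comp_rTensor, LinearMap.comp_apply, ← (E.support W).map_coact,
    ← E.coact_support, E.support_support]

theorem inducedEval_inducedMap {V V' : YetterDrinfeld k A} (f : V ⟶ V') (g : Γ)
    (F : (E.induced V).carrier) :
    E.inducedEval V' g ((E.inducedMap f).lin F) = f.lin (E.inducedEval V g F) := by
  induction F using E.induced_induction with
  | hadd x y hx hy => simp only [map_add, hx, hy]
  | h h v =>
    have e : (E.inducedMap f).lin (E.inducedSingle V h v) = E.inducedSingle V' h (f.lin v) := by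
      refine (E.fromInduced_single _ _ _ h v).trans ?_
      have := E.inducedSingle_act 1 h (f.lin v) 1
      rwa [ι_apply, map_one, one_mul, one_mul, E.θ_one, V'.isYetterDrinfeld.act_one] at this
    rw [e]
    by_cases hg : g = h
    · rw [hg, inducedEval_single_self, inducedEval_single_self]
    · rw [inducedEval_single_of_ne _ hg, inducedEval_single_of_ne _ hg, map_zero]

theorem inducedEval_one_act {V : YetterDrinfeld k A} (F : (E.induced V).carrier) (a : A) :
    E.inducedEval V 1 ((E.induced V).act F (E.incl a)) = V.act (E.inducedEval V 1 F) a := by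
  rw [← inclₗ_apply, ← ι_one, inducedEval_act, inv_one, mul_one, E.θ_group_one]

theorem coact_inducedEval_one {V : YetterDrinfeld k A} (F : (E.induced V).carrier) :
    V.coact (E.inducedEval V 1 F) =
      TensorProduct.map (E.inducedEval V 1) (E.proj 1) ((E.induced V).coact F) := by
  induction F using E.induced_induction with
  | hadd x y hx hy => simp only [map_add, hx, hy]
  | h g v =>
    rw [coact_inducedSingle, TensorProduct.map_map]
    by_cases hg : 1 = g
    · have h₁ : E.inducedEval V 1 ∘ₗ E.inducedSingle V 1 = LinearMap.id :=
        LinearMap.ext fun v => E.inducedEval_single_self 1 v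
      have h₂ : E.proj 1 ∘ₗ E.inclₗ ∘ₗ E.θ 1⁻¹ = LinearMap.id := LinearMap.ext fun a => by
        rw [inv_one, LinearMap.comp_apply, LinearMap.comp_apply, E.θ_group_one]
        simpa using E.proj_incl_mul_self 1 a
      rw [← hg, h₁, h₂, TensorProduct.map_id, inducedEval_single_self]
      rfl
    · have h₁ : E.inducedEval V 1 ∘ₗ E.inducedSingle V g = 0 :=
        LinearMap.ext fun v => E.inducedEval_single_of_ne hg v
      rw [h₁, TensorProduct.map_zero_left, inducedEval_single_of_ne _ hg, map_zero,
        LinearMap.zero_apply]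

/-- Morphisms from a restriction and morphisms into an induced module both correspond to linear
maps `W → V` that are `A`-linear and colinear along the projection `C → A`. -/
noncomputable def restrictInducedHomEquiv (W : YetterDrinfeld k C) (V : YetterDrinfeld k A) :
    (E.restrict W ⟶ V) ≃ (W ⟶ E.induced V) where
  toFun G := E.toInduced (G.lin ∘ₗ E.restrictπ W)
    (fun w a => by rw [LinearMap.comp_apply, restrictπ_act, G.map_act, LinearMap.comp_apply])
    (fun w => by rw [LinearMap.comp_apply, G.map_coact, coact_restrictπ, LinearMap.rTensor_map])
  invFun H := E.fromRestrict (E.inducedEval V 1 ∘ₗ H.lin)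
    (fun w a => by rw [LinearMap.comp_apply, H.map_act, inducedEval_one_act, LinearMap.comp_apply])
    (fun w => by rw [LinearMap.comp_apply, coact_inducedEval_one, H.map_coact,
      LinearMap.map_rTensor])
  left_inv G := hom_ext fun x => by
    change E.inducedEval V 1 ((E.toInduced _ _ _).lin (E.restrictι W x)) = _
    rw [inducedEval_toInduced, inv_one, map_one, W.isYetterDrinfeld.act_one,
      LinearMap.comp_apply, restrictπ_restrictι]
  right_inv H := hom_ext fun w => E.induced_ext fun g => by
    rw [inducedEval_toInduced]
    change (E.inducedEval V 1 ∘ₗ H.lin) ((E.support W).lin _) = _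
    rw [E.apply_support_of_coact (V := V)]
    · rw [LinearMap.comp_apply, H.map_act]
      have := E.inducedEval_act (H.lin w) g⁻¹ 1 1
      rwa [ι_apply, map_one, one_mul, E.θ_one, V.isYetterDrinfeld.act_one, inv_inv, one_mul] at this
    · intro w
      rw [LinearMap.comp_apply, coact_inducedEval_one, H.map_coact, LinearMap.map_rTensor]

theorem inducedEval_restrictInducedHomEquiv {W : YetterDrinfeld k C} {V : YetterDrinfeld k A}
    (G : E.restrict W ⟶ V) (w : W.carrier) (g : Γ) :
    E.inducedEval V g ((E.restrictInducedHomEquiv W V G).lin w) =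
      G.lin (E.restrictπ W (W.act w (E.u g⁻¹))) :=
  E.inducedEval_sum_single (fun g => (G.lin ∘ₗ E.restrictπ W) ∘ₗ W.act.flip (E.u g⁻¹)) g w

theorem restrictInducedHomEquiv_naturality {W : YetterDrinfeld k C} {V V' : YetterDrinfeld k A}
    (f : E.restrict W ⟶ V) (g : V ⟶ V') : E.restrictInducedHomEquiv W V' (f ≫ g) =
      E.restrictInducedHomEquiv W V f ≫ E.inducedMap g :=
  hom_ext fun w => E.induced_ext fun h => by
    rw [comp_lin, LinearMap.comp_apply, inducedEval_inducedMap,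
      inducedEval_restrictInducedHomEquiv, inducedEval_restrictInducedHomEquiv, comp_lin,
      LinearMap.comp_apply]

/-- Induction is also right adjoint to restriction, because `Γ` is finite. Both functors are
therefore exact. -/
noncomputable def restrictInducedAdj : E.restrictFunctor ⊣ E.inducedFunctor :=
  Adjunction.mkOfHomEquiv
    { homEquiv := E.restrictInducedHomEquiv
      homEquiv_naturality_left_symm := fun _ _ => hom_ext fun _ => rfl
      homEquiv_naturality_right := E.restrictInducedHomEquiv_naturality }

/-! ### Gerstenhaber-Schack dimension of a crossed extension -/

instance : PreservesFiniteColimits E.inducedFunctor :=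
  have := E.inducedRestrictAdj.leftAdjoint_preservesColimits
  inferInstance

instance : PreservesFiniteLimits E.inducedFunctor :=
  have := E.restrictInducedAdj.rightAdjoint_preservesLimits
  inferInstance

instance : PreservesFiniteColimits E.restrictFunctor :=
  have := E.restrictInducedAdj.leftAdjoint_preservesColimits
  inferInstance

instance : PreservesFiniteLimits E.restrictFunctor :=
  have := E.inducedRestrictAdj.rightAdjoint_preservesLimits
  inferInstance

theorem toInduced_comp_fromInduced {V : YetterDrinfeld k A} {W : YetterDrinfeld k C}
    {f : W.carrier →ₗ[k] V.carrier} (hact : ∀ w a, f (W.act w (E.incl a)) = V.act (f w) a)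
    (hcoact : ∀ w, V.coact (f w) = TensorProduct.map f (E.proj 1) (W.coact w))
    {f' : V.carrier →ₗ[k] W.carrier} (hact' : ∀ v a, f' (V.act v a) = W.act (f' v) (E.incl a))
    (hcoact' : ∀ v, W.coact (f' v) = TensorProduct.map f' E.inclₗ (V.coact v))
    (h : ∀ w, (Fintype.card Γ : k) • f' (f w) = w) :
    E.toInduced f hact hcoact ≫ E.fromInduced f' hact' hcoact' = 𝟙 W := by
  refine hom_ext fun w => ?_
  have hf : (E.toInduced f hact hcoact).lin w =
      ∑ g, E.inducedSingle V g (f (W.act w (E.u g⁻¹))) := by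
    rw [← E.sum_inducedSingle_eval ((E.toInduced f hact hcoact).lin w)]
    simp only [inducedEval_toInduced]
  rw [comp_lin, LinearMap.comp_apply, hf, map_sum, id_lin, LinearMap.id_apply]
  simp only [fromInduced_single]
  have h' (w) : f' (f w) = (Fintype.card Γ : k)⁻¹ • w := by
    rcases eq_or_ne (Fintype.card Γ : k) 0 with h0 | h0
    · have hz (w : W.carrier) : w = 0 := by rw [← h w, h0, zero_smul]
      rw [hz (f' _), hz w, smul_zero]
    · rw [eq_inv_smul_iff₀ h0, h]
  simp only [h', map_smul, LinearMap.smul_apply, ← W.isYetterDrinfeld.act_mul, u_inv_mul_u,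
    W.isYetterDrinfeld.act_one, Finset.sum_const, Finset.card_univ]
  rw [← Nat.cast_smul_eq_nsmul k, ← h', h]

/-- Induction and restriction do not raise projective dimension. The trivial module of `A` is a
retract of the restriction of that of `C`, and, the order of `Γ` being invertible, the trivial
module of `C` is a retract of the module induced from that of `A`. -/
theorem hasProjectiveDimensionLT_trivial_iff (E : CrossedExtension k A C Γ) [CharZero k] (n : ℕ) :
    HasProjectiveDimensionLT (YetterDrinfeld.trivial k A) n ↔
      HasProjectiveDimensionLT (YetterDrinfeld.trivial k C) n := by
  let kA := YetterDrinfeld.trivial k A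
  let kC := YetterDrinfeld.trivial k C
  let i : kA.carrier →ₗ[k] kC.carrier := LinearMap.id (R := k) (M := k)
  have hi₁ (v : kA.carrier) (a : A) : i (kA.act v a) = kC.act (i v) (E.incl a) :=
    congrArg (fun x : k => (show k from v) * x) (E.counit_incl a).symm
  have hi₂ (v : kA.carrier) : kC.coact (i v) = TensorProduct.map i E.inclₗ (kA.coact v) :=
    congrArg (fun c : C => (show k from v) ⊗ₜ[k] c) (map_one E.incl).symm
  -- the scalar `r` is `1` for the restriction and `|Γ|⁻¹` for the induced module
  let p (r : k) : kC.carrier →ₗ[k] kA.carrier := r • LinearMap.id (R := k) (M := k)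
  have hp₁ (r : k) (v : kC.carrier) (a : A) :
      p r (kC.act v (E.incl a)) = kA.act (p r v) a := by
    change r * ((show k from v) * Coalgebra.counit (R := k) (E.incl a)) =
      (r * (show k from v)) * Coalgebra.counit (R := k) a
    rw [E.counit_incl, mul_assoc]
  have hp₂ (r : k) (v : kC.carrier) :
      kA.coact (p r v) = TensorProduct.map (p r) (E.proj 1) (kC.coact v) :=
    congrArg (fun a : A => (r * (show k from v)) ⊗ₜ[k] a)
      (by simpa using (E.proj_incl_mul_self 1 1).symm)
  constructor
  · intro h
    have hL : HasProjectiveDimensionLT (E.induced kA) n :=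
      E.inducedRestrictAdj.hasProjectiveDimensionLT_obj kA n
    refine Retract.hasProjectiveDimensionLT (Y := E.induced kA)
      ⟨E.toInduced (p (Fintype.card Γ : k)⁻¹) (hp₁ _) (hp₂ _), E.fromInduced i hi₁ hi₂, ?_⟩ n
    refine E.toInduced_comp_fromInduced _ _ _ _ fun w => ?_
    exact mul_inv_cancel_left₀ (Nat.cast_ne_zero.2 Fintype.card_ne_zero) (show k from w)
  · intro h
    have hR : HasProjectiveDimensionLT (E.restrict kC) n :=
      E.restrictInducedAdj.hasProjectiveDimensionLT_obj kC n
    refine Retract.hasProjectiveDimensionLT (Y := E.restrict kC)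
      ⟨E.toRestrict i hi₁ hi₂, E.fromRestrict (p 1) (hp₁ 1) (hp₂ 1), ?_⟩ n
    exact hom_ext fun v => one_mul (show k from v)

theorem cdGS_eq (E : CrossedExtension k A C Γ) [CharZero k] : cdGS k A = cdGS k C :=
  iSup_nontrivial_ext_congr E.hasProjectiveDimensionLT_trivial_iff

end CrossedExtension

end YetterDrinfeldAdjunction

/-! ### Crossed products as crossed extensions -/

section CrossedExtensionTransport

universe w w' v'

variable {k A : Type u} {C : Type w} {C' : Type w'} {Γ : Type v} {Γ' : Type v'} [Field k] [Ring A]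
  [HopfAlgebra k A] [Ring C] [HopfAlgebra k C] [Ring C'] [HopfAlgebra k C'] [Group Γ] [Fintype Γ]
  [DecidableEq Γ] [Group Γ'] [Fintype Γ'] [DecidableEq Γ']

/-- Transport of a crossed extension along isomorphisms of the Hopf algebra `C` and of the group.
-/
noncomputable def CrossedExtension.congr (E : CrossedExtension k A C Γ) (φ : C ≃ₐc[k] C')
    (f : Γ' ≃* Γ) : CrossedExtension k A C' Γ' where
  incl := (φ : C →ₐc[k] C').comp E.incl
  u := (φ : C →* C').comp (E.u.comp f.toMonoidHom)
  comul_u g := by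
    change Coalgebra.comul (R := k) (φ (E.u (f g))) = φ (E.u (f g)) ⊗ₜ φ (E.u (f g))
    rw [← CoalgHomClass.map_comp_comul_apply, E.comul_u]
    rfl
  proj g := E.proj (f g) ∘ₗ (φ.toCoalgEquiv.toLinearEquiv.symm : C' →ₗ[k] C)
  proj_incl_mul g h a := by
    change E.proj (f g) (φ.toCoalgEquiv.toLinearEquiv.symm (φ (E.incl a) * φ (E.u (f h)))) = _
    rw [← map_mul]
    refine (congrArg (E.proj (f g)) (φ.toCoalgEquiv.toLinearEquiv.symm_apply_apply _)).trans ?_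
    rw [E.proj_incl_mul]
    simp only [EmbeddingLike.apply_eq_iff_eq]
  sum_proj c := by
    obtain ⟨c, rfl⟩ := φ.toCoalgEquiv.toLinearEquiv.surjective c
    change ∑ g, φ (E.incl (E.proj (f g) (φ.toCoalgEquiv.toLinearEquiv.symm
      (φ.toCoalgEquiv.toLinearEquiv c)))) * φ (E.u (f g)) = φ c
    simp only [LinearEquiv.symm_apply_apply, ← map_mul, ← map_sum]
    exact congrArg φ
      ((f.toEquiv.sum_comp fun g => E.incl (E.proj g c) * E.u g).trans (E.sum_proj c))
  normal g a := by
    obtain ⟨a', h⟩ := E.normal (f g) a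
    refine ⟨a', ?_⟩
    change φ (E.u (f g)) * φ (E.incl a) = φ (E.incl a') * φ (E.u (f g))
    rw [← map_mul, h, map_mul]

end CrossedExtensionTransport

section CrossedProduct

universe v'

variable {k A : Type u} {Γ : Type v} {Γ' : Type v'} [Field k] [Ring A] [HopfAlgebra k A] [Group Γ]
  [Group Γ']

/-- The action of `Γ'` obtained from an action of `Γ` along a morphism `Γ' → Γ`. -/
def HopfAction.comap (α : HopfAction k A Γ) (f : Γ' →* Γ) : HopfAction k A Γ' where
  toFun g := α (f g)
  map_one a := by rw [_root_.map_one, α.map_one]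
  map_mul g h a := by rw [_root_.map_mul, α.map_mul]

namespace CrossedProduct

/-- The linear isomorphism underlying `comapEquiv`. -/
noncomputable def comapLin (α : HopfAction k A Γ) (f : Γ' ≃* Γ) :
    CrossedProduct (α.comap f.toMonoidHom) ≃ₗ[k] CrossedProduct α :=
  TensorProduct.congr (LinearEquiv.refl k A) (MonoidAlgebra.domCongr k k f).toLinearEquiv

theorem comapLin_of (α : HopfAction k A Γ) (f : Γ' ≃* Γ) (g : Γ') (a : A) :
    comapLin α f (of _ g a) = of α (f g) a := by
  change a ⊗ₜ[k] MonoidAlgebra.domCongr k k f (MonoidAlgebra.single g 1) =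
    a ⊗ₜ[k] MonoidAlgebra.single (f g) 1
  rw [MonoidAlgebra.domCongr_single]

/-- Isomorphic groups acting compatibly have isomorphic crossed products. -/
noncomputable def comapEquiv (α : HopfAction k A Γ) (f : Γ' ≃* Γ) :
    CrossedProduct (α.comap f.toMonoidHom) ≃ₐc[k] CrossedProduct α :=
  BialgEquiv.ofAlgEquiv
    (AlgEquiv.ofLinearEquiv (comapLin α f) (by
      rw [one_def, one_def, comapLin_of, map_one f])
      (fun x y => by
        induction x using induction with
        | hadd x x' hx hx' => rw [add_mul, map_add, map_add, add_mul, hx, hx']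
        | hof g a =>
          induction y using induction with
          | hadd y y' hy hy' => rw [mul_add, map_add, map_add, mul_add, hy, hy']
          | hof h b =>
            rw [of_mul_of, comapLin_of, comapLin_of, comapLin_of, of_mul_of, map_mul f]
            rfl))
    (AlgHom.ext fun x => by
      change Coalgebra.counit (R := k) (comapLin α f x) = Coalgebra.counit (R := k) x
      induction x using induction with
      | hadd x y hx hy => rw [map_add, map_add, map_add, hx, hy]
      | hof g a => rw [comapLin_of, counit_of, counit_of])
    (AlgHom.ext fun x => by
      change TensorProduct.map (comapLin α f).toLinearMap (comapLin α f).toLinearMap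
        (Coalgebra.comul (R := k) x) = Coalgebra.comul (R := k) (comapLin α f x)
      induction x using induction with
      | hadd x y hx hy => rw [map_add, map_add, map_add, map_add, hx, hy]
      | hof g a =>
        rw [comapLin_of, comul_of, comul_of, TensorProduct.map_map]
        congr 2 <;> exact LinearMap.ext fun a => comapLin_of α f g a)

variable (α : HopfAction k A Γ)

/-- The inclusion of `A` into the crossed product. -/
noncomputable def inclHom : A →ₐc[k] CrossedProduct α :=
  BialgHom.ofAlgHom
    (AlgHom.ofLinearMap (of α 1) (one_def α).symm fun a b => by
      rw [of_mul_of, one_mul, α.map_one])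
    (AlgHom.ext fun a => counit_of α 1 a)
    (AlgHom.ext fun a => (comul_of α 1 a).symm)

theorem inclHom_apply (a : A) : inclHom α a = of α 1 a := rfl

/-- The group-like elements `1 ⊗ g` of the crossed product. -/
noncomputable def groupLike : Γ →* CrossedProduct α where
  toFun g := of α g 1
  map_one' := rfl
  map_mul' g h := by rw [of_mul_of, _root_.map_one (α g), one_mul]

theorem groupLike_apply (g : Γ) : groupLike α g = of α g 1 := rfl

theorem of_mul_groupLike (g h : Γ) (a : A) : of α g a * groupLike α h = of α (g * h) a := by
  rw [groupLike_apply, of_mul_of, _root_.map_one (α g), mul_one]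

theorem groupLike_mul_of (g h : Γ) (a : A) :
    groupLike α g * of α h a = of α (g * h) (α g a) := by
  rw [groupLike_apply, of_mul_of, one_mul]

theorem comul_groupLike (g : Γ) :
    Coalgebra.comul (R := k) (groupLike α g) = groupLike α g ⊗ₜ[k] groupLike α g := by
  rw [groupLike_apply, comul_of, Bialgebra.comul_one, Algebra.TensorProduct.one_def,
    TensorProduct.map_tmul]

/-- The coefficient in `A` of an element of the crossed product at a group element. -/
noncomputable def coeff (g : Γ) : CrossedProduct α →ₗ[k] A :=
  (TensorProduct.rid k A).toLinearMap ∘ₗ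
    (Finsupp.lapply g ∘ₗ (MonoidAlgebra.coeffLinearEquiv k).toLinearMap).lTensor A

theorem coeff_of [DecidableEq Γ] (g h : Γ) (a : A) :
    coeff α g (of α h a) = if g = h then a else 0 := by
  change TensorProduct.rid k A (a ⊗ₜ[k] (MonoidAlgebra.single h (1 : k)).coeff g) = _
  rw [TensorProduct.rid_tmul, MonoidAlgebra.coeff_single, Finsupp.single_apply]
  simp only [eq_comm (a := g)]
  split_ifs <;> simp

/-- The crossed product `A ⋊ Γ` is a crossed extension of `A`. -/
noncomputable def crossedExtension [Fintype Γ] [DecidableEq Γ] :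
    CrossedExtension k A (CrossedProduct α) Γ where
  incl := inclHom α
  u := groupLike α
  comul_u := comul_groupLike α
  proj := coeff α
  proj_incl_mul g h a := by rw [inclHom_apply, of_mul_groupLike, one_mul, coeff_of]
  sum_proj c := by
    induction c using induction with
    | hadd x y hx hy => simp only [map_add, add_mul, Finset.sum_add_distrib, hx, hy]
    | hof h a =>
      simp only [inclHom_apply, of_mul_groupLike, one_mul, coeff_of]
      rw [Finset.sum_eq_single h (fun g _ hg => by rw [if_neg hg, map_zero]) (by simp), if_pos rfl]
  normal g a := ⟨α g a, by
    rw [inclHom_apply, inclHom_apply, of_mul_groupLike, groupLike_mul_of, mul_one, one_mul]⟩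

end CrossedProduct

end CrossedProduct

/-! ### Graded twistings as crossed extensions -/

/-- The coefficient at a group element, as a linear form. -/
noncomputable def MonoidAlgebra.lcoeff (k : Type*) [Field k] {Γ : Type*} (g : Γ) :
    MonoidAlgebra k Γ →ₗ[k] k :=
  Finsupp.lapply g ∘ₗ (MonoidAlgebra.coeffLinearEquiv k).toLinearMap

theorem MonoidAlgebra.lcoeff_single {k Γ : Type*} [Field k] [DecidableEq Γ] (g h : Γ) (r : k) :
    MonoidAlgebra.lcoeff k g (MonoidAlgebra.single h r) = if g = h then r else 0 := by
  simp [MonoidAlgebra.lcoeff, Finsupp.single_apply, eq_comm (a := g)]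

theorem MonoidAlgebra.lid_rTensor_lcoeff_comul {k Γ : Type*} [Field k] (g : Γ)
    (x : MonoidAlgebra k Γ) :
    TensorProduct.lid k _ ((MonoidAlgebra.lcoeff k g).rTensor _ (Coalgebra.comul (R := k) x)) =
      MonoidAlgebra.lcoeff k g x • MonoidAlgebra.single g 1 := by
  classical
  induction x using MonoidAlgebra.induction_linear with
  | zero => simp
  | add x y hx hy => simp only [map_add, hx, hy, add_smul]
  | single h r =>
    simp only [MonoidAlgebra.comul_single, CommSemiring.comul_apply, TensorProduct.map_tmul,
      LinearMap.rTensor_tmul, MonoidAlgebra.lsingle_apply, MonoidAlgebra.lcoeff_single,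
      TensorProduct.lid_tmul]
    split_ifs with hg <;> simp [hg]

section GradedTwisting

namespace InvariantCocentralAction

variable {k A : Type u} {Γ : Type v} [Field k] [Ring A] [HopfAlgebra k A]

section

variable [Group Γ] (c : InvariantCocentralAction k A Γ)

theorem mem_component {g : Γ} {a : A} : a ∈ c.component g ↔
    (c.p : A →ₗ[k] MonoidAlgebra k Γ).rTensor A (Coalgebra.comul a) =
      MonoidAlgebra.single g 1 ⊗ₜ[k] a := Iff.rfl

/-- The projection of `A` onto the component `A_g`, `a ↦ p(a₍₁₎)_g a₍₂₎`. -/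
noncomputable def projComponent (g : Γ) : A →ₗ[k] A :=
  (TensorProduct.lid k A).toLinearMap ∘ₗ (MonoidAlgebra.lcoeff k g).rTensor A ∘ₗ
    (c.p : A →ₗ[k] MonoidAlgebra k Γ).rTensor A ∘ₗ Coalgebra.comul

theorem projComponent_apply (g : Γ) (a : A) : c.projComponent g a =
    TensorProduct.lid k A ((MonoidAlgebra.lcoeff k g).rTensor A
      ((c.p : A →ₗ[k] MonoidAlgebra k Γ).rTensor A (Coalgebra.comul a))) := rfl

theorem projComponent_of_mem [DecidableEq Γ] {g h : Γ} {a : A} (ha : a ∈ c.component h) :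
    c.projComponent g a = if g = h then a else 0 := by
  rw [projComponent_apply, c.mem_component.1 ha, LinearMap.rTensor_tmul,
    MonoidAlgebra.lcoeff_single, TensorProduct.lid_tmul]
  split_ifs <;> simp

theorem projComponent_mem (g : Γ) (a : A) : c.projComponent g a ∈ c.component g := by
  let P : A →ₗ[k] MonoidAlgebra k Γ := c.p
  -- `Φ (a ⊗ b ⊗ c) = p(a)_g p(b) ⊗ c`, applied to both sides of coassociativity
  let Φ : A ⊗[k] (A ⊗[k] A) →ₗ[k] MonoidAlgebra k Γ ⊗[k] A :=
    (TensorProduct.lid k _).toLinearMap ∘ₗ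
      TensorProduct.map (MonoidAlgebra.lcoeff k g ∘ₗ P) (P.rTensor A)
  have h := congrArg Φ (Coalgebra.coassoc_apply (R := k) a)
  have h₁ (t : A ⊗[k] A) : Φ (Coalgebra.comul.lTensor A t) = P.rTensor A (Coalgebra.comul
      (TensorProduct.lid k A ((MonoidAlgebra.lcoeff k g).rTensor A (P.rTensor A t)))) := by
    induction t with
    | zero => simp
    | add x y hx hy => simp only [map_add, hx, hy]
    | tmul x y => simp [Φ]
  have h₂ (t : A ⊗[k] A) (y : A) : Φ (TensorProduct.assoc k A A A (t ⊗ₜ y)) =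
      TensorProduct.lid k _ ((MonoidAlgebra.lcoeff k g).rTensor _
        (TensorProduct.map P P t)) ⊗ₜ y := by
    induction t with
    | zero => simp
    | add x y hx hy => simp only [map_add, TensorProduct.add_tmul, hx, hy]
    | tmul x y => simp [Φ, TensorProduct.smul_tmul']
  have h₃ (t : A ⊗[k] A) : Φ (TensorProduct.assoc k A A A (Coalgebra.comul.rTensor A t)) =
      MonoidAlgebra.single g 1 ⊗ₜ
        TensorProduct.lid k A ((MonoidAlgebra.lcoeff k g).rTensor A (P.rTensor A t)) := by
    induction t with
    | zero => simp
    | add x y hx hy => simp only [map_add, TensorProduct.tmul_add, hx, hy]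
    | tmul x y =>
      rw [LinearMap.rTensor_tmul, h₂, show TensorProduct.map P P (Coalgebra.comul x) =
        Coalgebra.comul (P x) from CoalgHomClass.map_comp_comul_apply c.p x,
        MonoidAlgebra.lid_rTensor_lcoeff_comul, TensorProduct.smul_tmul, LinearMap.rTensor_tmul,
        LinearMap.rTensor_tmul, TensorProduct.lid_tmul]
  rw [h₁, h₃] at h
  exact h.symm

theorem sum_projComponent [Fintype Γ] (a : A) : ∑ g, c.projComponent g a = a := by
  have h₀ (x : MonoidAlgebra k Γ) :
      ∑ g, MonoidAlgebra.lcoeff k g x = Coalgebra.counit (R := k) x := by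
    classical
    induction x using MonoidAlgebra.induction_linear with
    | zero => simp
    | add x y hx hy => simp only [map_add, Finset.sum_add_distrib, hx, hy]
    | single h r => simp [MonoidAlgebra.lcoeff_single]
  have h₁ (t : A ⊗[k] A) : ∑ g, TensorProduct.lid k A ((MonoidAlgebra.lcoeff k g).rTensor A
      ((c.p : A →ₗ[k] MonoidAlgebra k Γ).rTensor A t)) =
      TensorProduct.lid k A (Coalgebra.counit.rTensor A t) := by
    induction t with
    | zero => simp
    | add x y hx hy => simp only [map_add, Finset.sum_add_distrib, hx, hy]
    | tmul x y =>
      simp only [LinearMap.rTensor_tmul, TensorProduct.lid_tmul]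
      rw [← Finset.sum_smul, h₀]
      exact congrArg (· • y) (CoalgHomClass.counit_comp_apply c.p x)
  simp only [projComponent_apply]
  rw [h₁, Coalgebra.rTensor_counit_comul, TensorProduct.lid_tmul, one_smul]

theorem α_mem_component {g h : Γ} {a : A} (ha : a ∈ c.component h) :
    c.α g a ∈ c.component h := by
  rw [mem_component] at ha ⊢
  have hP : (c.p : A →ₗ[k] MonoidAlgebra k Γ) ∘ₗ (c.α g : A →ₗ[k] A) = c.p :=
    LinearMap.ext fun a => c.p_invariant g a
  rw [← CoalgHomClass.map_comp_comul_apply, LinearMap.rTensor_map]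
  have := congrArg ((c.α g : A →ₗ[k] A).lTensor (MonoidAlgebra k Γ)) ha
  rw [LinearMap.lTensor_tmul, ← LinearMap.comp_apply, LinearMap.lTensor_comp_rTensor] at this
  refine Eq.trans ?_ this
  exact congrArg (fun f => TensorProduct.map f (c.α g : A →ₗ[k] A) (Coalgebra.comul a)) hP

theorem of_mem_twist {g : Γ} {a : A} (ha : a ∈ c.component g) :
    CrossedProduct.of c.α g a ∈ c.twist :=
  Submodule.mem_iSup_of_mem g (Submodule.mem_map_of_mem ha)

theorem twist_induction {P : CrossedProduct c.α → Prop}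
    (hof : ∀ g, ∀ a ∈ c.component g, P (CrossedProduct.of c.α g a))
    (hadd : ∀ x y, P x → P y → P (x + y)) {x : CrossedProduct c.α} (hx : x ∈ c.twist) : P x := by
  refine Submodule.iSup_induction _ (motive := P) hx ?_ ?_ hadd
  · rintro g _ ⟨a, ha, rfl⟩
    exact hof g a ha
  · simpa using hof 1 0 (zero_mem _)

/-- The coordinate map of `A ⋊ Γ` over the subalgebra `∑ A_x ⊗ x` in the basis `1 ⊗ g`: it sends
`a ⊗ h` to `a' ⊗ hg⁻¹`, where `a'` is the component of `a` of degree `hg⁻¹`. -/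
noncomputable def twistCoeff [Fintype Γ] (g : Γ) : CrossedProduct c.α →ₗ[k] CrossedProduct c.α :=
  ∑ x : Γ, CrossedProduct.of c.α (x * g⁻¹) ∘ₗ c.projComponent (x * g⁻¹) ∘ₗ
    CrossedProduct.coeff c.α x

theorem twistCoeff_of [Fintype Γ] (g h : Γ) (a : A) :
    c.twistCoeff g (CrossedProduct.of c.α h a) =
      CrossedProduct.of c.α (h * g⁻¹) (c.projComponent (h * g⁻¹) a) := by
  classical
  simp only [twistCoeff, LinearMap.sum_apply, LinearMap.comp_apply, CrossedProduct.coeff_of]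
  rw [Finset.sum_eq_single h (fun x _ hx => by rw [if_neg hx, map_zero, map_zero]) (by simp),
    if_pos rfl]

theorem twistCoeff_mem [Fintype Γ] (g : Γ) (x : CrossedProduct c.α) :
    c.twistCoeff g x ∈ c.twist := by
  induction x using CrossedProduct.induction with
  | hadd x y hx hy => rw [map_add]; exact add_mem hx hy
  | hof h a => rw [twistCoeff_of]; exact c.of_mem_twist (c.projComponent_mem _ a)

theorem twistCoeff_mul_groupLike [Fintype Γ] [DecidableEq Γ] (g h : Γ) {x : CrossedProduct c.α}
    (hx : x ∈ c.twist) :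
    c.twistCoeff g (x * CrossedProduct.groupLike c.α h) = if g = h then x else 0 := by
  refine c.twist_induction (P := fun x =>
    c.twistCoeff g (x * CrossedProduct.groupLike c.α h) = if g = h then x else 0)
    (fun f a ha => ?_) (fun x y hx hy => ?_) hx
  · rw [CrossedProduct.of_mul_groupLike, twistCoeff_of, c.projComponent_of_mem ha]
    by_cases hg : g = h
    · simp [hg]
    · have : f * h * g⁻¹ ≠ f := by
        rw [mul_assoc, Ne, mul_eq_left, mul_inv_eq_one]
        exact Ne.symm hg
      simp [hg, this]
  · rw [add_mul, map_add, hx, hy]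
    split_ifs <;> simp

theorem sum_twistCoeff_mul_groupLike [Fintype Γ] (x : CrossedProduct c.α) :
    ∑ g, c.twistCoeff g x * CrossedProduct.groupLike c.α g = x := by
  induction x using CrossedProduct.induction with
  | hadd x y hx hy => simp only [map_add, add_mul, Finset.sum_add_distrib, hx, hy]
  | hof h a =>
    simp only [twistCoeff_of, CrossedProduct.of_mul_groupLike, inv_mul_cancel_right]
    rw [← map_sum]
    congr 1
    conv_rhs => rw [← c.sum_projComponent a]
    exact ((Equiv.inv Γ).trans (Equiv.mulLeft h)).sum_comp fun g => c.projComponent g a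

end

/-- The elements `1 ⊗ g` normalize `∑ A_x ⊗ x`: one has `(1 ⊗ g)(a ⊗ x) = (α_g(a) ⊗ x)(1 ⊗ g)` as
`Γ` is commutative, and `α_g(a)` has degree `x` if `a` has, by invariance of `p`. -/
theorem exists_groupLike_mul_eq [CommGroup Γ] (c : InvariantCocentralAction k A Γ) (g : Γ)
    {x : CrossedProduct c.α} (hx : x ∈ c.twist) : ∃ y ∈ c.twist,
      CrossedProduct.groupLike c.α g * x = y * CrossedProduct.groupLike c.α g := by
  refine c.twist_induction (P := fun x => ∃ y ∈ c.twist,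
    CrossedProduct.groupLike c.α g * x = y * CrossedProduct.groupLike c.α g)
    (fun h a ha => ?_) (fun x y hx hy => ?_) hx
  · exact ⟨_, c.of_mem_twist (c.α_mem_component (g := g) ha), by
      rw [CrossedProduct.groupLike_mul_of, CrossedProduct.of_mul_groupLike, mul_comm g h]⟩
  · obtain ⟨x', hx', hx⟩ := hx
    obtain ⟨y', hy', hy⟩ := hy
    exact ⟨x' + y', add_mem hx' hy', by rw [mul_add, add_mul, hx, hy]⟩

/-- The crossed product `A ⋊ Γ` is a crossed extension of the graded twisting of `A`. -/
noncomputable def twistCrossedExtension [CommGroup Γ] [Fintype Γ] [DecidableEq Γ]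
    (c : InvariantCocentralAction k A Γ) {B : Type u} [Ring B] [HopfAlgebra k B]
    (j : B →ₐc[k] CrossedProduct c.α) (hj : Function.Injective j)
    (hrange : LinearMap.range (j : B →ₗ[k] CrossedProduct c.α) = c.twist) :
    CrossedExtension k B (CrossedProduct c.α) Γ :=
  let J : B ≃ₗ[k] LinearMap.range (j : B →ₗ[k] CrossedProduct c.α) :=
    LinearEquiv.ofInjective (j : B →ₗ[k] CrossedProduct c.α) hj
  have hJ (x) : j (J.symm x) = x := congrArg Subtype.val (J.apply_symm_apply x)
  have hmem (b) : j b ∈ c.twist := hrange ▸ LinearMap.mem_range_self _ b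
  let π (g : Γ) : CrossedProduct c.α →ₗ[k] B :=
    J.symm.toLinearMap ∘ₗ (c.twistCoeff g).codRestrict _ fun x => hrange ▸ c.twistCoeff_mem g x
  have hπ (g x) : j (π g x) = c.twistCoeff g x := hJ _
  { incl := j
    u := CrossedProduct.groupLike c.α
    comul_u := CrossedProduct.comul_groupLike c.α
    proj := π
    proj_incl_mul := fun g h b => hj (by
      rw [hπ, c.twistCoeff_mul_groupLike g h (hmem b)]
      split_ifs <;> simp)
    sum_proj := fun x => by
      simp only [hπ]
      exact c.sum_twistCoeff_mul_groupLike x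
    normal := fun g b => by
      obtain ⟨y, hy, h⟩ := c.exists_groupLike_mul_eq g (hmem b)
      rw [← hrange] at hy
      obtain ⟨b', rfl⟩ := hy
      exact ⟨b', h⟩ }

end InvariantCocentralAction

end GradedTwisting

theorem theorem4 {k : Type u} [Field k] [IsAlgClosed k] [CharZero k]
    {A B : Type u} [Ring A] [HopfAlgebra k A] [Ring B] [HopfAlgebra k B]
    {Γ : Type v} [CommGroup Γ] [Finite Γ] (h : IsGradedTwisting k A B Γ) :
    cd k A = cd k B ∧ (IsCosemisimple k A → cdGS k A = cdGS k B) := by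
  classical
  obtain ⟨c, j, hj, hrange⟩ := h
  have := Fintype.ofFinite Γ
  -- replace `Γ` by a copy in the universe of `A`, so that `A ⋊ Γ` lives there too
  let f : Shrink.{u} Γ ≃* Γ := Shrink.mulEquiv
  let φ := (CrossedProduct.comapEquiv c.α f).symm
  let E := (CrossedProduct.crossedExtension c.α).congr φ f
  let E' := (c.twistCrossedExtension j hj hrange).congr φ f
  exact ⟨E.cd_eq.trans E'.cd_eq.symm, fun _ => E.cdGS_eq.trans E'.cdGS_eq.symm⟩
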